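/- **Setting.** Let $G=SU_2\times SU_2$, let $H\subset G$ be the diagonal subgroup, and let $V=\mathfrak h\cong\mathfrak{su}_2$ with the adjoint action of $H$. Identify $SU_2$ with the unit quaternions. Put $U=(\tfrac i2,\tfrac i2)\in\mathfrak h$, and give $V$ the $H$-invariant Euclidean norm with $|U|=1$. For $a\in(0,\infty]$ let $M=G\times_H\{v\in V:|v|<a\}$, a $G$-equivariant tubular neighbourhood of the singular orbit $S=G\times_H\{0\}\cong S^3$ (for $a=\infty$, $M=G\times_HV\cong TS^3$). Let $\gamma_t=[e,tU]$ for $|t|<a$, put $\xi=\gamma_t'$, and for $X\in\mathfrak g=\mathfrak{su}_2\oplus\mathfrak{su}_2$ let $\widehat X$ be the vector field on $M$ induced by $X$. With $A=(\tfrac i2,-\tfrac i2)$, $E=\tfrac{j}{2\sqrt2}$, $F=\tfrac{k}{2\sqrt2}$, $E_1=(E,0)$, $V_1=(F,0)$, $E_2=(0,E)$, $V_2=(0,F)$, the vectors $(\xi,\widehat A,\widehat E_1,\widehat V_1,\widehat E_2,\widehat V_2)$ form a basis of $T_{\gamma_t}M$ for $t\ne0$. Let $(\xi^*,A^*,E_1^*,V_1^*,E_2^*,V_2^*)$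 be the dual basis, and set $$\omega^1=\xi^*\wedge A^*,\quad \omega^2=E_1^*\wedge V_1^*,\quad \omega^3=E_2^*\wedge V_2^*,\quad \omega^4=E_1^*\wedge E_2^*+V_1^*\wedge V_2^*,\quad \omega^5=E_1^*\wedge V_2^*-V_1^*\wedge E_2^*.$$ A nearly Kähler structure $(g,J)$ on a manifold is an almost Hermitian structure with Riemannian metric $g$ such that $(\nabla_XJ)X=0$ for all vector fields $X$, where $\nabla$ is the Levi-Civita connection of $g$. It is strict if $\nabla_vJ\neq0$ for every non-zero tangent vector $v$. Its Kähler form is $g(J\cdot,\cdot)$. A 3-form $\theta$ on a 6-dimensional real vector space $W$ is stable if, for a volume form $\tau$ and the endomorphism $S_\theta$ defined by $\alpha(S_\theta v)\,\tau=(\iota_v\theta)\wedge\theta\wedge\alpha$ for all $v\in W$, $\alpha\in W^*$, one has $S_\theta^2=P(\theta)\,\mathrm{Id}$ with $P(\theta)<0$ (this does not depend on $\tau$). **Proposition.** Let $\omega$ be a $G$-invariant 2-form on $M\setminus S$ which is the Kähler form of a strict nearly Kähler structure $(g,J)$ on $M\setminus S$. Assume that $\gamma$ is a unit-speed normal geodesic,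 that is, $g(\xi,\xi)=1$ and $g(\xi,\widehat X)=0$ at $\gamma_t$ for all $X\in\mathfrak g$ and all $t\neq 0$ with $|t|<a$. Assume that $\omega$ extends smoothly to $M$, and denote the extension also by $\omega$. Then there are functions $f_1,\dots,f_5$, smooth on $(-a,a)$ (and necessarily unique), with $\omega_{\gamma_t}=\sum_{i=1}^5f_i(t)\,\omega^i$ for $0<|t|<a$. If $f_1(0)\neq0$, then 1. $f_4\equiv0$ on $(-a,a)$ and $f_5'(0)\neq0$; 2. the 3-form $d\omega$ is stable at every point of $M$, including the points of $S$. -/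

import Mathlib

open Set Filter Topology Bundle
open scoped Manifold ContDiff Quaternion ENNReal

noncomputable section

namespace NearlyKahler

/-! ### Stable 3-forms on a six-dimensional real vector space -/

section Stable

variable {W : Type*} [AddCommGroup W] [Module ℝ W] [TopologicalSpace W]

/-- The endomorphism `S_θ` attached to a 3-form `θ` and to the volume form
`τ = e⁰ ∧ ⋯ ∧ e⁵` of a basis `e`: it is determined by
`α (S_θ v) τ = (ι_v θ) ∧ θ ∧ α` for every covector `α`. Evaluating both sides on
`(e₀, …, e₅)` gives the formula below (`12 = 2! 3! 1!`). -/
def stableEndo (e : Module.Basis (Fin 6) ℝ W) (θ : W [⋀^Fin 3]→L[ℝ] ℝ) (v : W) : W :=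
  (12 : ℝ)⁻¹ • ∑ σ : Equiv.Perm (Fin 6),
    (((Equiv.Perm.sign σ : ℤ) : ℝ) * θ ![v, e (σ 0), e (σ 1)]
      * θ ![e (σ 2), e (σ 3), e (σ 4)]) • e (σ 5)

/-- A 3-form `θ` is stable if `S_θ ∘ S_θ = P(θ) · id` with `P(θ) < 0`. Replacing the volume form
by a multiple `c τ` replaces `P` by `c⁻² P`, so the choice of the basis is immaterial. -/
def IsStableForm (θ : W [⋀^Fin 3]→L[ℝ] ℝ) : Prop :=
  ∃ (e : Module.Basis (Fin 6) ℝ W) (P : ℝ), P < 0 ∧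
    ∀ v : W, stableEndo e θ (stableEndo e θ v) = P • v

end Stable

/-! ### Differential forms on a manifold without boundary -/

section Forms

variable {E : Type*} [NormedAddCommGroup E] [NormedSpace ℝ E]
  {H : Type*} [TopologicalSpace H] (I : ModelWithCorners ℝ E H)
  (M : Type*) [TopologicalSpace M] [ChartedSpace H M]

/-- A (not necessarily smooth) differential `k`-form on `M`. -/
abbrev DiffForm (k : ℕ) : Type _ := ∀ x : M, TangentSpace I x [⋀^Fin k]→L[ℝ] ℝ

variable {I M} {k : ℕ}

/-- The expression of a `k`-form in the preferred chart at `x₀`: its pull-back under the inverse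
of the chart. -/
def DiffForm.inChart (α : DiffForm I M k) (x₀ : M) (y : E) : E [⋀^Fin k]→L[ℝ] ℝ :=
  (α ((extChartAt I x₀).symm y)).compContinuousLinearMap
    (mfderiv 𝓘(ℝ, E) I (extChartAt I x₀).symm y)

/-- Smoothness of a `k`-form on an open set `U`, in charts. -/
def DiffForm.SmoothOn (α : DiffForm I M k) (U : Set M) : Prop :=
  ∀ x₀ : M, ContDiffOn ℝ ∞ (α.inChart x₀)
    ((extChartAt I x₀).target ∩ (extChartAt I x₀).symm ⁻¹' U)

/-- The exterior derivative of a `k`-form, computed in the preferred chart at each point. -/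
def DiffForm.d (α : DiffForm I M k) : DiffForm I M (k + 1) := fun x =>
  (extDeriv (α.inChart x) (extChartAt I x x)).compContinuousLinearMap
    (mfderiv I 𝓘(ℝ, E) (extChartAt I x) x)

end Forms

/-! ### Strict nearly Kähler structures on an open subset of a manifold -/

section NK

variable {E : Type*} [NormedAddCommGroup E] [NormedSpace ℝ E]
  {H : Type*} [TopologicalSpace H] (I : ModelWithCorners ℝ E H)
  {M : Type*} [TopologicalSpace M] [ChartedSpace H M] [IsManifold I 1 M]

/-- `g` is a smooth Riemannian metric on the open set `U`. -/
structure IsRiemannianMetricOn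
    (g : ∀ x : M, TangentSpace I x →L[ℝ] TangentSpace I x →L[ℝ] ℝ) (U : Set M) : Prop where
  smooth : ContMDiffOn I (I.prod 𝓘(ℝ, E →L[ℝ] E →L[ℝ] ℝ)) ∞
    (fun x => TotalSpace.mk' (E →L[ℝ] E →L[ℝ] ℝ)
      (E := fun x : M => TangentSpace I x →L[ℝ] TangentSpace I x →L[ℝ] ℝ) x (g x)) U
  symm : ∀ x ∈ U, ∀ v w : TangentSpace I x, g x v w = g x w v
  pos : ∀ x ∈ U, ∀ v : TangentSpace I x, v ≠ 0 → 0 < g x v v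

/-- `J` is a smooth almost complex structure on the open set `U`. -/
structure IsAlmostComplexOn
    (J : ∀ x : M, TangentSpace I x →L[ℝ] TangentSpace I x) (U : Set M) : Prop where
  smooth : ContMDiffOn I (I.prod 𝓘(ℝ, E →L[ℝ] E)) ∞
    (fun x => TotalSpace.mk' (E →L[ℝ] E)
      (E := fun x : M => TangentSpace I x →L[ℝ] TangentSpace I x) x (J x)) U
  sq : ∀ x ∈ U, ∀ v : TangentSpace I x, J x (J x v) = -v

/-- `cov` is the Levi-Civita connection of `g` on the open set `U`; here `cov Y x v` is
`(∇_v Y)(x)`. -/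
structure IsLeviCivitaOn
    (g : ∀ x : M, TangentSpace I x →L[ℝ] TangentSpace I x →L[ℝ] ℝ)
    (cov : (∀ x : M, TangentSpace I x) → ∀ x : M, TangentSpace I x →L[ℝ] TangentSpace I x)
    (U : Set M) : Prop where
  isCovariantDerivative : IsCovariantDerivativeOn E cov U
  torsion_free : ∀ (X Y : ∀ x : M, TangentSpace I x), ∀ x ∈ U,
    MDiffAt (T% X) x → MDiffAt (T% Y) x →
      cov Y x (X x) - cov X x (Y x) = VectorField.mlieBracket I X Y x
  metric : ∀ (Y Z : ∀ x : M, TangentSpace I x), ∀ x ∈ U,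
    MDiffAt (T% Y) x → MDiffAt (T% Z) x → ∀ v : TangentSpace I x,
      mvfderiv I (fun y => g y (Y y) (Z y)) x v = g x (cov Y x v) (Z x) + g x (Y x) (cov Z x v)

/-- `(g, J)` is a strict nearly Kähler structure on the open set `U`: an almost Hermitian structure
with `(∇_X J) X = 0` for all vector fields `X`, and `∇_v J ≠ 0` for all `v ≠ 0`, where `∇` is the
Levi-Civita connection of `g` and `(∇_v J) Y = ∇_v (J Y) - J (∇_v Y)`. -/
structure IsStrictNearlyKahlerOn
    (g : ∀ x : M, TangentSpace I x →L[ℝ] TangentSpace I x →L[ℝ] ℝ)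
    (J : ∀ x : M, TangentSpace I x →L[ℝ] TangentSpace I x) (U : Set M) : Prop where
  metric : IsRiemannianMetricOn I g U
  complex : IsAlmostComplexOn I J U
  hermitian : ∀ x ∈ U, ∀ v w : TangentSpace I x, g x (J x v) (J x w) = g x v w
  nearlyKahler : ∃ cov : (∀ x : M, TangentSpace I x) →
      ∀ x : M, TangentSpace I x →L[ℝ] TangentSpace I x,
    IsLeviCivitaOn I g cov U ∧
    (∀ X : ∀ x : M, TangentSpace I x, ∀ x ∈ U, MDiffAt (T% X) x →
      cov (fun y => J y (X y)) x (X x) - J x (cov X x (X x)) = 0) ∧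
    (∀ x ∈ U, ∀ v : TangentSpace I x, v ≠ 0 →
      ∃ Y : ∀ x : M, TangentSpace I x, MDiffAt (T% Y) x ∧
        cov (fun y => J y (Y y)) x v - J x (cov Y x v) ≠ 0)

end NK

/-! ### The group `G = SU₂ × SU₂` and the `G`-manifold `G ×_H V` -/

/-- The unit quaternions, i.e. `SU₂`; as a manifold, the three-sphere. -/
abbrev SU2 : Type := Metric.sphere (0 : ℍ[ℝ]) 1

instance finrankQuaternion : Fact (Module.finrank ℝ ℍ[ℝ] = 3 + 1) :=
  ⟨Quaternion.finrank_eq_four⟩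

/-- The imaginary quaternions, i.e. the Lie algebra `su₂` with bracket `xy - yx`. -/
def imH : Submodule ℝ ℍ[ℝ] where
  carrier := {q | q.re = 0}
  add_mem' {p q} hp hq := by
    simp only [mem_ofPred_eq] at hp hq ⊢
    simp [hp, hq]
  zero_mem' := by simp
  smul_mem' c q hq := by
    simp only [mem_ofPred_eq] at hq ⊢
    simp [hq]

/-- The imaginary quaternion `x i + y j + z k`. -/
def imQ (x y z : ℝ) : imH := ⟨⟨0, x, y, z⟩, rfl⟩

/-- The exponential map `su₂ → SU₂`. -/
def expSU2 (X : imH) : SU2 :=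
  ⟨NormedSpace.exp (X : ℍ[ℝ]), by
    have h : (X : ℍ[ℝ]).re = 0 := X.2
    simp [Quaternion.norm_exp, h]⟩

/-- The adjoint action `w ↦ q w q⁻¹` of `SU₂` on `su₂`. -/
def adj (q : SU2) (w : imH) : imH :=
  ⟨(q : ℍ[ℝ]) * w * ((q⁻¹ : SU2) : ℍ[ℝ]), by
    have hw : (w : ℍ[ℝ]).re = 0 := w.2
    have h1 : ((q : ℍ[ℝ]) * w * ((q⁻¹ : SU2) : ℍ[ℝ])).re
        = (((q⁻¹ : SU2) : ℍ[ℝ]) * ((q : ℍ[ℝ]) * w)).re := by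
      simp only [Quaternion.re_mul]
      ring
    have h2 : ((q⁻¹ : SU2) : ℍ[ℝ]) * (q : ℍ[ℝ]) = 1 := by
      exact congrArg (fun x : SU2 => (x : ℍ[ℝ])) (inv_mul_cancel q)
    change ((q : ℍ[ℝ]) * w * ((q⁻¹ : SU2) : ℍ[ℝ])).re = 0
    rw [h1, ← mul_assoc, h2, one_mul, hw]⟩

lemma adj_mul (p q : SU2) (w : imH) : adj (p * q) w = adj p (adj q w) := by
  apply Subtype.ext
  simp [adj, mul_assoc]

lemma adj_one (w : imH) : adj 1 w = w := by
  apply Subtype.ext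
  simp [adj]

/-- The manifold `G ×_H V`, `H` the diagonal of `G = SU₂ × SU₂` acting on `V = su₂` by the adjoint
representation, in its global trivialisation `[(a, b), v] ↦ (a b⁻¹, Ad_b v)`
(see `assoc_eq_iff`, `assoc_surjective`, `assoc_equivariant`). -/
abbrev TS3 : Type := SU2 × imH

/-- The model with corners of the six-manifold `TS3`. -/
abbrev modelTS3 : ModelWithCorners ℝ (EuclideanSpace ℝ (Fin 3) × imH)
    (ModelProd (EuclideanSpace ℝ (Fin 3)) imH) := (𝓡 3).prod 𝓘(ℝ, imH)

/-- The action of `G = SU₂ × SU₂` on `G ×_H V`. -/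
def act (h : SU2 × SU2) (p : TS3) : TS3 := (h.1 * p.1 * h.2⁻¹, adj h.2 p.2)

/-- The projection `G × V → G ×_H V`. -/
def assoc (h : SU2 × SU2) (v : imH) : TS3 := (h.1 * h.2⁻¹, adj h.2 v)

lemma act_one (p : TS3) : act 1 p = p := by
  simp [act, adj_one]

lemma act_mul (h h' : SU2 × SU2) (p : TS3) : act (h * h') p = act h (act h' p) := by
  simp [act, adj_mul, mul_assoc]

lemma assoc_equivariant (h h' : SU2 × SU2) (v : imH) :
    assoc (h * h') v = act h (assoc h' v) := by
  simp [act, assoc, adj_mul, mul_assoc]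

lemma assoc_surjective (p : TS3) : ∃ h v, assoc h v = p :=
  ⟨(p.1, 1), p.2, by simp [assoc, adj_one]⟩

lemma assoc_eq_iff (h h' : SU2 × SU2) (v v' : imH) :
    assoc h v = assoc h' v' ↔ ∃ q : SU2, h' = h * (q, q) ∧ v' = adj q⁻¹ v := by
  constructor
  · intro e
    have e1 : h.1 * h.2⁻¹ = h'.1 * h'.2⁻¹ := congrArg Prod.fst e
    have e2 : adj h.2 v = adj h'.2 v' := congrArg Prod.snd e
    refine ⟨h.2⁻¹ * h'.2, Prod.ext ?_ ?_, ?_⟩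
    · simp [← mul_assoc, e1]
    · simp
    · rw [mul_inv_rev, inv_inv, adj_mul, e2, ← adj_mul, inv_mul_cancel, adj_one]
  · rintro ⟨q, rfl, rfl⟩
    simp [assoc, ← adj_mul, mul_assoc]

/-- The tubular neighbourhood `{[h, v] : |v| < a}` of radius `a ∈ (0, ∞]` of the singular orbit;
the norm on `V` is the one for which the vector `U = (i/2, i/2)` of `V` has norm one. -/
def tube (a : ℝ≥0∞) : Set TS3 := {p | ‖p.2‖ₑ < a}

/-- The singular orbit `S ≅ S³`. -/
def singularOrbit : Set TS3 := {p | p.2 = 0}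

/-- The curve `γ_t = [e, t U]`. -/
def gammaCurve (t : ℝ) : TS3 := (1, imQ t 0 0)

/-- The velocity `ξ` of `γ` at `γ_t`. -/
def xiVec (t : ℝ) : TangentSpace modelTS3 (gammaCurve t) :=
  mfderiv 𝓘(ℝ, ℝ) modelTS3 gammaCurve t (1 : ℝ)

/-- The value at `p` of the vector field `X̂` on `G ×_H V` induced by `X ∈ su₂ + su₂`, the velocity
at `s = 0` of `s ↦ exp (s X) · p`. -/
def hatVec (X : imH × imH) (p : TS3) : TangentSpace modelTS3 p :=
  mfderiv 𝓘(ℝ, ℝ) modelTS3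
    (fun s : ℝ => act (expSU2 (s • X.1), expSU2 (s • X.2)) p) 0 (1 : ℝ)

/-- The generator `H` of the Cartan subalgebra, with `ad H` a complex structure on `H^⊥`. -/
def elemH : imH := imQ (1 / 2) 0 0

/-- The element `E` of `H^⊥`, of Cartan-Killing square length `-1`
(the Cartan-Killing form is `-8` times the Euclidean product of `ℍ`). -/
def elemE : imH := imQ 0 (1 / (2 * √2)) 0

/-- The element `V = [H, E]`. -/
def elemV : imH := imQ 0 0 (1 / (2 * √2))

/-- The frame `(ξ, Â, Ê₁, V̂₁, Ê₂, V̂₂)` at `γ_t`, where `A = (H, -H)`, `E₁ = (E, 0)`, `V₁ = (V, 0)`,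
`E₂ = (0, E)`, `V₂ = (0, V)`. It is a basis of the tangent space for `t ≠ 0`. -/
def frame (t : ℝ) : Fin 6 → TangentSpace modelTS3 (gammaCurve t) :=
  ![xiVec t, hatVec (elemH, -elemH) (gammaCurve t),
    hatVec (elemE, 0) (gammaCurve t), hatVec (elemV, 0) (gammaCurve t),
    hatVec (0, elemE) (gammaCurve t), hatVec (0, elemV) (gammaCurve t)]

/-- The 2-form `eⁱ ∧ eʲ` of the dual coframe, in the components `c`, `d` of two vectors. -/
def coWedge (i j : Fin 6) (c d : Fin 6 → ℝ) : ℝ := c i * d j - c j * d i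

/-- The value of the combination `∑ᵢ xᵢ ωⁱ` on the vectors with components `c`, `d`, where
`ω¹ = ξ* ∧ A*`, `ω² = E₁* ∧ V₁*`, `ω³ = E₂* ∧ V₂*`, `ω⁴ = E₁* ∧ E₂* + V₁* ∧ V₂*` and
`ω⁵ = E₁* ∧ V₂* - V₁* ∧ E₂*`. -/
def invForm (x₁ x₂ x₃ x₄ x₅ : ℝ) (c d : Fin 6 → ℝ) : ℝ :=
  x₁ * coWedge 0 1 c d + x₂ * coWedge 2 3 c d + x₃ * coWedge 4 5 c d
    + x₄ * (coWedge 2 4 c d + coWedge 3 5 c d)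
    + x₅ * (coWedge 2 5 c d - coWedge 3 4 c d)

/-- Invariance of a 2-form under `G` on a `G`-stable set `U`. -/
def IsInvariantOn (κ : DiffForm modelTS3 TS3 2) (U : Set TS3) : Prop :=
  ∀ h : SU2 × SU2, ∀ p ∈ U,
    (κ (act h p)).compContinuousLinearMap (mfderiv modelTS3 modelTS3 (act h) p) = κ p

end NearlyKahler

end

open Set Filter Topology Bundle
open scoped Manifold ContDiff Quaternion ENNReal

noncomputable section

namespace NearlyKahler

section Pullback

variable {E : Type*} [NormedAddCommGroup E] [NormedSpace ℝ E]
  {H : Type*} [TopologicalSpace H] {I : ModelWithCorners ℝ E H}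
  {M : Type*} [TopologicalSpace M] [ChartedSpace H M]
  {F : Type*} [NormedAddCommGroup F] [NormedSpace ℝ F] {k : ℕ}

/-- The pull-back of a `k`-form under a map from a normed space. -/
def DiffForm.pullback (η : DiffForm I M k) (f : F → M) (z : F) : F [⋀^Fin k]→L[ℝ] ℝ :=
  (η (f z)).compContinuousLinearMap (mfderiv 𝓘(ℝ, F) I f z)

lemma DiffForm.inChart_eq_pullback (η : DiffForm I M k) (x₀ : M) :
    η.inChart x₀ = η.pullback (extChartAt I x₀).symm := rfl

lemma DiffForm.compContinuousLinearMap_congr (η : DiffForm I M k) {q q' : M} (h : q' = q)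
    (A : F →L[ℝ] E) :
    (η q').compContinuousLinearMap (show F →L[ℝ] TangentSpace I q' from A)
      = (η q).compContinuousLinearMap (show F →L[ℝ] TangentSpace I q from A) := by
  subst h; rfl

variable [I.Boundaryless] [IsManifold I ∞ M]

omit [I.Boundaryless] in
lemma mdifferentiableAt_extChartAt' {x₀ q : M} (hq : q ∈ (extChartAt I x₀).source) :
    MDifferentiableAt I 𝓘(ℝ, E) (extChartAt I x₀) q := by
  have : IsManifold I 1 M := .of_le (n := ∞) (by simp)
  exact mdifferentiableAt_extChartAt (by simpa using hq)

lemma mdifferentiableAt_extChartAt_symm' {x₀ : M} {y : E} (hy : y ∈ (extChartAt I x₀).target) :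
    MDifferentiableAt 𝓘(ℝ, E) I (extChartAt I x₀).symm y := by
  have : IsManifold I 1 M := .of_le (n := ∞) (by simp)
  have := mdifferentiableWithinAt_extChartAt_symm hy
  rwa [I.range_eq_univ, mdifferentiableWithinAt_univ] at this

lemma mfderiv_symm_comp_mfderiv {x₀ q : M} (hq : q ∈ (extChartAt I x₀).source) (v : E) :
    (mfderiv 𝓘(ℝ, E) I (extChartAt I x₀).symm (extChartAt I x₀ q) : E →L[ℝ] E)
      ((mfderiv I 𝓘(ℝ, E) (extChartAt I x₀) q : E →L[ℝ] E) v) = v := by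
  have : IsManifold I 1 M := .of_le (n := ∞) (by simp)
  have := mfderivWithin_extChartAt_symm_comp_mfderiv_extChartAt' (I := I) hq
  rw [I.range_eq_univ, mfderivWithin_univ] at this
  exact DFunLike.congr_fun this v

lemma mfderiv_comp_mfderiv_symm {x₀ q : M} (hq : q ∈ (extChartAt I x₀).source) (v : E) :
    (mfderiv I 𝓘(ℝ, E) (extChartAt I x₀) q : E →L[ℝ] E)
      ((mfderiv 𝓘(ℝ, E) I (extChartAt I x₀).symm (extChartAt I x₀ q) : E →L[ℝ] E) v) = v := by
  have : IsManifold I 1 M := .of_le (n := ∞) (by simp)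
  have := mfderiv_extChartAt_comp_mfderivWithin_extChartAt_symm' (I := I) hq
  rw [I.range_eq_univ, mfderivWithin_univ] at this
  exact DFunLike.congr_fun this v

lemma fderiv_extChartAt_comp {f : F → M} {z : F} {x₀ : M} (hf : MDifferentiableAt 𝓘(ℝ, F) I f z)
    (hz : f z ∈ (extChartAt I x₀).source) (v : F) :
    fderiv ℝ (extChartAt I x₀ ∘ f) z v
      = (mfderiv I 𝓘(ℝ, E) (extChartAt I x₀) (f z) : E →L[ℝ] E)
        ((mfderiv 𝓘(ℝ, F) I f z : F →L[ℝ] E) v) := by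
  have := mfderiv_comp z (mdifferentiableAt_extChartAt' hz) hf
  rw [mfderiv_eq_fderiv] at this
  exact DFunLike.congr_fun this v

lemma DiffForm.inChart_extChartAt (η : DiffForm I M k) {x₀ q : M}
    (hq : q ∈ (extChartAt I x₀).source) :
    η.inChart x₀ (extChartAt I x₀ q) = (η q).compContinuousLinearMap
      (show E →L[ℝ] TangentSpace I q from
        mfderiv 𝓘(ℝ, E) I (extChartAt I x₀).symm (extChartAt I x₀ q)) :=
  η.compContinuousLinearMap_congr ((extChartAt I x₀).left_inv hq) _

lemma DiffForm.pullback_eq_inChart (η : DiffForm I M k) {f : F → M} {z : F} {x₀ : M}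
    (hf : MDifferentiableAt 𝓘(ℝ, F) I f z) (hz : f z ∈ (extChartAt I x₀).source) :
    η.pullback f z = (η.inChart x₀ ((extChartAt I x₀ ∘ f) z)).compContinuousLinearMap
      (fderiv ℝ (extChartAt I x₀ ∘ f) z) := by
  rw [Function.comp_apply, η.inChart_extChartAt hz]
  ext v
  change (η (f z)) (fun i => _) = (η (f z)) (fun i => _)
  congr 1
  funext i
  change (mfderiv 𝓘(ℝ, F) I f z : F →L[ℝ] E) (v i) = (mfderiv 𝓘(ℝ, E) I (extChartAt I x₀).symm
    (extChartAt I x₀ (f z)) : E →L[ℝ] E) (fderiv ℝ (extChartAt I x₀ ∘ f) z (v i))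
  rw [fderiv_extChartAt_comp hf hz]
  exact (mfderiv_symm_comp_mfderiv hz _).symm

lemma contDiffAt_extChartAt_comp {f : F → M} {z : F} {x₀ : M}
    (hf : ContMDiffAt 𝓘(ℝ, F) I ∞ f z) (hz : f z ∈ (extChartAt I x₀).source) :
    ContDiffAt ℝ ∞ (extChartAt I x₀ ∘ f) z := by
  rw [← contMDiffAt_iff_contDiffAt]
  exact (contMDiffAt_extChartAt' (n := ∞) (by simpa using hz)).comp z hf

lemma DiffForm.pullback_eventuallyEq (η : DiffForm I M k) {f : F → M} {z : F} {x₀ : M}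
    (hf : ContMDiffAt 𝓘(ℝ, F) I ∞ f z) (hz : f z ∈ (extChartAt I x₀).source) :
    η.pullback f =ᶠ[𝓝 z] fun z => (η.inChart x₀ ((extChartAt I x₀ ∘ f) z)).compContinuousLinearMap
      (fderiv ℝ (extChartAt I x₀ ∘ f) z) := by
  have h1 : ∀ᶠ z' in 𝓝 z, f z' ∈ (extChartAt I x₀).source :=
    hf.continuousAt.preimage_mem_nhds ((isOpen_extChartAt_source x₀).mem_nhds hz)
  have h2 : ∀ᶠ z' in 𝓝 z, ContMDiffAt 𝓘(ℝ, F) I 1 f z' :=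
    (contMDiffAt_iff_contMDiffAt_nhds (by simp)).1 (hf.of_le (by simp))
  filter_upwards [h1, h2] with z' h1 h2
  exact η.pullback_eq_inChart (h2.mdifferentiableAt (by simp)) h1

/-- The exterior derivative commutes with pull-backs to normed spaces. -/
lemma DiffForm.extDeriv_pullback (η : DiffForm I M k) {f : F → M} {z : F}
    (hf : ContMDiffAt 𝓘(ℝ, F) I ∞ f z)
    (hη : DifferentiableAt ℝ (η.inChart (f z)) (extChartAt I (f z) (f z))) :
    extDeriv (η.pullback f) z = η.d.pullback f z := by
  have hz := mem_extChartAt_source (I := I) (f z)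
  rw [(η.pullback_eventuallyEq hf hz).extDeriv_eq,
    _root_.extDeriv_pullback (f := extChartAt I (f z) ∘ f) hη (contDiffAt_extChartAt_comp hf hz)
      (by rw [minSmoothness_of_isRCLikeNormedField]; exact ENat.LEInfty.out)]
  ext v
  change (extDeriv (η.inChart (f z)) (extChartAt I (f z) (f z))) (fun i => _)
    = (extDeriv (η.inChart (f z)) (extChartAt I (f z) (f z))) (fun i => _)
  congr 1
  funext i
  exact fderiv_extChartAt_comp (hf.mdifferentiableAt (by simp)) hz (v i)

/-- Differentiability of a form at a point, in the preferred chart. -/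
def DiffForm.DiffAt (η : DiffForm I M k) (x : M) : Prop :=
  DifferentiableAt ℝ (η.inChart x) (extChartAt I x x)

lemma DiffForm.SmoothOn.contDiffAt {η : DiffForm I M k} {U : Set M} (h : η.SmoothOn U)
    (hU : IsOpen U) (x₀ : M) {y : E} (hy : y ∈ (extChartAt I x₀).target)
    (hyU : (extChartAt I x₀).symm y ∈ U) : ContDiffAt ℝ ∞ (η.inChart x₀) y := by
  refine (h x₀).contDiffAt ?_
  have := (continuousOn_extChartAt_symm (I := I) x₀).isOpen_inter_preimage
    (isOpen_extChartAt_target (I := I) x₀) hU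
  exact this.mem_nhds ⟨hy, hyU⟩

lemma DiffForm.SmoothOn.diffAt {η : DiffForm I M k} {U : Set M} (h : η.SmoothOn U)
    (hU : IsOpen U) {x : M} (hx : x ∈ U) : η.DiffAt x :=
  (h.contDiffAt hU x (mem_extChartAt_target x) (by simpa using hx)).differentiableAt (by simp)

lemma contDiffAt_alternating_apply {E' : Type*} [NormedAddCommGroup E'] [NormedSpace ℝ E']
    {n : WithTop ℕ∞} {α : F → E' [⋀^Fin k]→L[ℝ] ℝ} {w : Fin k → F → E'} {z : F}
    (hα : ContDiffAt ℝ n α z) (hw : ∀ i, ContDiffAt ℝ n (w i) z) :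
    ContDiffAt ℝ n (fun x => α x (fun i => w i x)) z := by
  induction k with
  | zero =>
    have h := ((ContinuousMultilinearMap.apply ℝ (fun _ : Fin 0 => E') ℝ ![]).comp
      (ContinuousAlternatingMap.toContinuousMultilinearMapLI (𝕜 := ℝ) (E := E') (F := ℝ)
        (ι := Fin 0)).toContinuousLinearMap).contDiff.contDiffAt.comp z hα
    convert h using 2 with x
    exact congrArg (α x) (Subsingleton.elim _ _)
  | succ k ih =>
    let L : (E' [⋀^Fin (k + 1)]→L[ℝ] ℝ) →L[ℝ] (E' →L[ℝ] E' [⋀^Fin k]→L[ℝ] ℝ) :=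
      ContinuousAlternatingMap.curryLeftLI.toContinuousLinearMap
    have h0 : ContDiffAt ℝ n (fun x => (α x).curryLeft) z := by
      have hL : ContDiff ℝ n (⇑L) := by fun_prop
      exact hL.contDiffAt.comp z hα
    have h := ih (h0.clm_apply (hw 0)) (fun i => hw i.succ)
    convert h using 2 with x
    simp only [ContinuousAlternatingMap.curryLeft_apply_apply]
    congr 1
    funext i
    refine Fin.cases ?_ (fun j => ?_) i <;> simp [Matrix.vecCons]

lemma DiffForm.SmoothOn.contDiffAt_pullback_apply {η : DiffForm I M k} {U : Set M}
    (h : η.SmoothOn U) (hU : IsOpen U) {f : F → M} {z : F} (hf : ContMDiffAt 𝓘(ℝ, F) I ∞ f z)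
    (hz : f z ∈ U) (v : Fin k → F) : ContDiffAt ℝ ∞ (fun z => η.pullback f z v) z := by
  have hs := mem_extChartAt_source (I := I) (f z)
  have h0 := contDiffAt_extChartAt_comp hf hs
  have h1 : ContDiffAt ℝ ∞ (η.inChart (f z)) ((extChartAt I (f z) ∘ f) z) :=
    h.contDiffAt hU _ (mem_extChartAt_target _) (by simpa using hz)
  have h2 : ContDiffAt ℝ ∞ (fderiv ℝ (extChartAt I (f z) ∘ f)) z :=
    h0.fderiv_right (by simp)
  refine ContDiffAt.congr_of_eventuallyEq ?_
    ((η.pullback_eventuallyEq hf hs).mono fun z' h => DFunLike.congr_fun h v)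
  exact contDiffAt_alternating_apply
    (w := fun i z' => fderiv ℝ (extChartAt I (f z) ∘ f) z' (v i)) (h1.comp z h0)
    (fun i => h2.clm_apply (contDiffAt_const (c := v i)))

lemma DiffForm.DiffAt.differentiableAt_pullback {η : DiffForm I M k} {f : F → M} {z : F}
    (hη : η.DiffAt (f z)) (hf : ContMDiffAt 𝓘(ℝ, F) I ∞ f z) :
    DifferentiableAt ℝ (η.pullback f) z := by
  have hs := mem_extChartAt_source (I := I) (f z)
  have h0 := contDiffAt_extChartAt_comp hf hs
  refine DifferentiableAt.congr_of_eventuallyEq ?_ (η.pullback_eventuallyEq hf hs)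
  have h2 : ContDiffAt ℝ ∞ (fderiv ℝ (extChartAt I (f z) ∘ f)) z :=
    h0.fderiv_right (by simp)
  have h1 : DifferentiableAt ℝ (η.inChart (f z)) ((extChartAt I (f z) ∘ f) z) := hη
  exact (h1.comp z (h0.differentiableAt (by simp))
    ).continuousAlternatingMapCompContinuousLinearMap (h2.differentiableAt (by simp))

/-- The exterior derivative of a smooth form is smooth. -/
lemma DiffForm.SmoothOn.d {η : DiffForm I M k} {U : Set M} (h : η.SmoothOn U) (hU : IsOpen U) :
    η.d.SmoothOn U := by
  intro x₀ y hy
  have key : ∀ y' ∈ (extChartAt I x₀).target ∩ (extChartAt I x₀).symm ⁻¹' U,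
      η.d.inChart x₀ y' = extDeriv (η.inChart x₀) y' := by
    intro y' hy'
    have hc : ContMDiffAt 𝓘(ℝ, E) I ∞ (extChartAt I x₀).symm y' :=
      (contMDiffOn_extChartAt_symm (n := ∞) x₀).contMDiffAt
        ((isOpen_extChartAt_target x₀).mem_nhds hy'.1)
    rw [DiffForm.inChart_eq_pullback, DiffForm.inChart_eq_pullback,
      DiffForm.extDeriv_pullback η hc (h.diffAt hU hy'.2)]
  have h1 : ContDiffAt ℝ ∞ (extDeriv (η.inChart x₀)) y := by
    change ContDiffAt ℝ ∞ (fun x => ContinuousAlternatingMap.alternatizeUncurryFin (fderiv ℝ (η.inChart x₀) x)) y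
    simpa [Function.comp_def] using
      (ContinuousAlternatingMap.alternatizeUncurryFinCLM ℝ E ℝ).contDiff.contDiffAt.comp y
      ((h.contDiffAt hU x₀ hy.1 hy.2).fderiv_right (m := ∞) (by simp))
  exact h1.contDiffWithinAt.congr key (key y hy)

end Pullback

section Ext
variable {E : Type*} [NormedAddCommGroup E] [NormedSpace ℝ E]
  {H : Type*} [TopologicalSpace H] {I : ModelWithCorners ℝ E H}
  {M : Type*} [TopologicalSpace M] [ChartedSpace H M]

/-- The constant vector field on a normed space. -/
def constField (v : E) (y : E) : TangentSpace 𝓘(ℝ, E) y := v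

lemma mdifferentiableAt_constField (v y : E) : MDiffAt (T% (constField v)) y :=
  (contMDiffAt_vectorSpace_iff_contDiffAt.2 (show ContDiffAt ℝ 1 (fun _ : E => v) y from
    contDiffAt_const)).mdifferentiableAt (by simp)

lemma mlieBracket_constField (v w y : E) :
    VectorField.mlieBracket 𝓘(ℝ, E) (constField v) (constField w) y = 0 := by
  rw [← VectorField.mlieBracketWithin_univ, VectorField.mlieBracketWithin_eq_lieBracketWithin]
  change fderivWithin ℝ (fun _ : E => w) univ y v - fderivWithin ℝ (fun _ : E => v) univ y w = 0
  simp

variable (I) in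
/-- The vector field with constant components `v` in the preferred chart at `p`. -/
def chartField (p : M) (v : E) (q : M) : TangentSpace I q :=
  VectorField.mpullback I 𝓘(ℝ, E) (extChartAt I p) (constField v) q

variable [I.Boundaryless] [IsManifold I ∞ M]

lemma chartField_apply {p q : M} (hq : q ∈ (extChartAt I p).source) (v : E) :
    chartField I p v q = (mfderiv 𝓘(ℝ, E) I (extChartAt I p).symm (extChartAt I p q) :
      E →L[ℝ] E) v := by
  have : IsManifold I 1 M := .of_le (n := ∞) (by simp)
  have h1 := isInvertible_mfderiv_extChartAt (I := I) hq
  have h2 := mfderiv_comp_mfderiv_symm (I := I) hq v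
  exact h1.inverse_apply_eq.2 h2.symm

omit [I.Boundaryless] in
lemma chartField_self {p : M} (v : E) : chartField I p v p = v := by
  have : IsManifold I 1 M := .of_le (n := ∞) (by simp)
  refine (isInvertible_mfderiv_extChartAt (mem_extChartAt_source p)).inverse_apply_eq.2 ?_
  rw [mfderiv_extChartAt_self]
  rfl

omit [I.Boundaryless] in
lemma mdifferentiableAt_chartField [CompleteSpace E] {p : M} (v : E) :
    MDiffAt (T% (chartField I p v)) p := by
  have : IsManifold I 2 M := .of_le (n := ∞) ENat.LEInfty.out
  have : IsManifold I 1 M := .of_le (n := ∞) (by simp)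
  exact (mdifferentiableAt_constField v _).mpullback_vectorField
    (contMDiffAt_extChartAt (n := 2))
    (isInvertible_mfderiv_extChartAt (mem_extChartAt_source p)) le_rfl

omit [I.Boundaryless] in
lemma mlieBracket_chartField [CompleteSpace E] {p : M} (v w : E) :
    VectorField.mlieBracket I (chartField I p v) (chartField I p w) p = 0 := by
  have : IsManifold I 2 M := .of_le (n := ∞) ENat.LEInfty.out
  have : IsManifold I 1 M := .of_le (n := ∞) (by simp)
  have : IsManifold I (minSmoothness ℝ 3) M := .of_le (n := ∞) (by
    rw [minSmoothness_of_isRCLikeNormedField]; exact ENat.LEInfty.out)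
  refine (VectorField.mpullback_mlieBracket (I := I) (I' := 𝓘(ℝ, E)) (f := extChartAt I p)
    (x₀ := p) (mdifferentiableAt_constField v _) (mdifferentiableAt_constField w _) (n := 2)
    contMDiffAt_extChartAt (by rw [minSmoothness_of_isRCLikeNormedField])).symm.trans ?_
  rw [VectorField.mpullback_apply, mlieBracket_constField]
  exact map_zero _

lemma DiffForm.apply_chartField_eventuallyEq {k : ℕ} (η : DiffForm I M k) (p : M) (v : Fin k → E) :
    (fun q => η q (fun i => chartField I p (v i) q))
      =ᶠ[𝓝 p] fun q => η.inChart p (extChartAt I p q) v := by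
  filter_upwards [extChartAt_source_mem_nhds (I := I) p] with q hq
  rw [η.inChart_extChartAt hq]
  change (η q) (fun i => _) = (η q) (fun i => _)
  congr 1
  funext i
  exact chartField_apply hq (v i)

lemma mvfderiv_comp_extChartAt_self {f : E → ℝ} {p : M}
    (hf : DifferentiableAt ℝ f (extChartAt I p p)) (u : E) :
    mvfderiv I (fun q => f (extChartAt I p q)) p u = fderiv ℝ f (extChartAt I p p) u := by
  have : IsManifold I 1 M := .of_le (n := ∞) (by simp)
  have h1 := mfderiv_comp p hf.mdifferentiableAt
    (mdifferentiableAt_extChartAt' (I := I) (mem_extChartAt_source p))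
  rw [mfderiv_extChartAt_self, mfderiv_eq_fderiv] at h1
  exact DFunLike.congr_fun h1 u

lemma DiffForm.DiffAt.mvfderiv_apply_chartField {k : ℕ} {η : DiffForm I M k} {p : M}
    (h : η.DiffAt p) (v : Fin k → E) (u : E) :
    mvfderiv I (fun q => η q (fun i => chartField I p (v i) q)) p u
      = fderiv ℝ (fun y => η.inChart p y v) (extChartAt I p p) u := by
  have h0 : DifferentiableAt ℝ (fun y => η.inChart p y v) (extChartAt I p p) :=
    (ContinuousAlternatingMap.apply ℝ E ℝ v).differentiableAt.comp _ h
  refine Eq.trans ?_ (mvfderiv_comp_extChartAt_self h0 u)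
  exact DFunLike.congr_fun (η.apply_chartField_eventuallyEq p v).mfderiv_eq u

/-- The exterior derivative of a 2-form in terms of fields with constant components. -/
lemma DiffForm.DiffAt.d_apply_chartField {η : DiffForm I M 2} {p : M} (h : η.DiffAt p)
    (u v w : E) : η.d p ![(u : TangentSpace I p), v, w]
      = mvfderiv I (fun q => η q ![chartField I p v q, chartField I p w q]) p u
      + mvfderiv I (fun q => η q ![chartField I p w q, chartField I p u q]) p v
      + mvfderiv I (fun q => η q ![chartField I p u q, chartField I p v q]) p w := by
  have : IsManifold I 1 M := .of_le (n := ∞) (by simp)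
  have key (a b c : E) : mvfderiv I (fun q => η q ![chartField I p a q, chartField I p b q]) p c
      = fderiv ℝ (fun y => η.inChart p y ![a, b]) (extChartAt I p p) c := by
    rw [← h.mvfderiv_apply_chartField ![a, b] c]
    congr 2
    funext q
    congr 1
    funext i
    fin_cases i <;> rfl
  have hd : η.d p ![(u : TangentSpace I p), v, w]
      = extDeriv (η.inChart p) (extChartAt I p p) ![u, v, w] := by
    change extDeriv (η.inChart p) (extChartAt I p p) (fun i => _) = _
    congr 1
    funext i
    have := mfderiv_extChartAt_self (I := I) (x := p)
    exact DFunLike.congr_fun this _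
  have hsw : (fun y => η.inChart p y ![u, w]) = fun y => - η.inChart p y ![w, u] := by
    funext y
    have := (η.inChart p y).map_swap ![w, u] (i := 0) (j := 1) (by decide)
    refine Eq.trans ?_ this
    change (η.inChart p y) _ = (η.inChart p y) _
    congr 1
    funext i
    fin_cases i <;> rfl
  have r0 : (0 : Fin 3).removeNth ![u, v, w] = ![v, w] := by
    funext i; fin_cases i <;> rfl
  have r1 : (1 : Fin 3).removeNth ![u, v, w] = ![u, w] := by
    funext i; fin_cases i <;> rfl
  have r2 : (2 : Fin 3).removeNth ![u, v, w] = ![u, v] := by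
    funext i; fin_cases i <;> rfl
  rw [hd, key, key, key, extDeriv_apply h, Fin.sum_univ_three, r0, r1, r2, hsw, fderiv_fun_neg]
  simp

lemma mdifferentiableAt_coord {X : ∀ q : M, TangentSpace I q} {p : M}
    : MDiffAt (T% X) p ↔
    MDifferentiableAt I 𝓘(ℝ, E) (fun q => (mfderiv I 𝓘(ℝ, E) (extChartAt I p) q : E →L[ℝ] E) (X q)) p := by
  have : IsManifold I 1 M := .of_le (n := ∞) (by simp)
  refine (mdifferentiableAt_section _ _).trans ?_
  have hE : (fun q => (trivializationAt E (TangentSpace I) p (TotalSpace.mk' E q (X q))).2) =ᶠ[𝓝 p]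
      (fun q => (mfderiv I 𝓘(ℝ, E) (extChartAt I p) q : E →L[ℝ] E) (X q)) := by
    filter_upwards [extChartAt_source_mem_nhds (I := I) p] with q hq
    have hq' : q ∈ (chartAt H p).source := by simpa using hq
    have h := TangentBundle.continuousLinearMapAt_trivializationAt (I := I) hq'
    refine Eq.trans ?_ (DFunLike.congr_fun h (X q))
    exact ((trivializationAt E (TangentSpace I) p).continuousLinearMapAt_apply_of_mem ℝ
      (by simpa using hq') (X q)).symm
  exact ⟨fun h => h.congr_of_eventuallyEq hE.symm, fun h => h.congr_of_eventuallyEq hE⟩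

/-- The interior product of a form with a vector field. -/
def DiffForm.interior {k : ℕ} (η : DiffForm I M (k + 1)) (X : ∀ q : M, TangentSpace I q) :
    DiffForm I M k := fun q => (show E [⋀^Fin (k + 1)]→L[ℝ] ℝ from η q).curryLeft (X q : E)

lemma DiffForm.DiffAt.interior {k : ℕ} {η : DiffForm I M (k + 1)} {p : M} (h : η.DiffAt p)
    {X : ∀ q : M, TangentSpace I q} (hX : MDiffAt (T% X) p) : (η.interior X).DiffAt p := by
  have : IsManifold I 1 M := .of_le (n := ∞) (by simp)
  set x : M → E := fun q => (mfderiv I 𝓘(ℝ, E) (extChartAt I p) q : E →L[ℝ] E) (X q) with hx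
  have hxd : MDifferentiableAt I 𝓘(ℝ, E) x p := mdifferentiableAt_coord.1 hX
  have hxd' : DifferentiableAt ℝ (x ∘ (extChartAt I p).symm) (extChartAt I p p) := by
    refine mdifferentiableAt_iff_differentiableAt.1 (MDifferentiableAt.comp (I' := I) _ ?_
      (mdifferentiableAt_extChartAt_symm' (mem_extChartAt_target p)))
    rwa [extChartAt_to_inv]
  have hE : (η.interior X).inChart p =ᶠ[𝓝 (extChartAt I p p)]
      fun y => (η.inChart p y).curryLeft ((x ∘ (extChartAt I p).symm) y) := by
    filter_upwards [extChartAt_target_mem_nhds (I := I) p] with y hy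
    ext v
    change (η ((extChartAt I p).symm y)) (Fin.cons _ fun i => _)
      = (η ((extChartAt I p).symm y)) (fun i => _)
    congr 1
    have hq := (extChartAt I p).map_target hy
    have h1 := mfderiv_symm_comp_mfderiv hq (X ((extChartAt I p).symm y))
    rw [(extChartAt I p).right_inv hy] at h1
    funext i
    refine Fin.cases h1.symm (fun j => rfl) i
  refine DifferentiableAt.congr_of_eventuallyEq ?_ hE
  let L : (E [⋀^Fin (k + 1)]→L[ℝ] ℝ) →L[ℝ] (E →L[ℝ] E [⋀^Fin k]→L[ℝ] ℝ) :=
      ContinuousAlternatingMap.curryLeftLI.toContinuousLinearMap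
  have h0 : DifferentiableAt ℝ (fun y => (η.inChart p y).curryLeft) (extChartAt I p p) :=
    ((show ContDiff ℝ 1 (⇑L) by fun_prop).differentiable (by simp)).differentiableAt.comp _ h
  exact h0.clm_apply hxd'

lemma DiffForm.DiffAt.mdifferentiableAt_apply {η : DiffForm I M 2} {p : M} (h : η.DiffAt p)
    {X Y : ∀ q : M, TangentSpace I q} (hX : MDiffAt (T% X) p) (hY : MDiffAt (T% Y) p) :
    MDifferentiableAt I 𝓘(ℝ, ℝ) (fun q => η q ![X q, Y q]) p := by
  have h2 := (h.interior hX).interior hY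
  have hE : (fun q => η q ![X q, Y q]) =ᶠ[𝓝 p] (fun y =>
      (DiffForm.interior (η.interior X) Y).inChart p y ![]) ∘ extChartAt I p := by
    filter_upwards [extChartAt_source_mem_nhds (I := I) p] with q hq
    rw [Function.comp_apply, DiffForm.inChart_extChartAt _ hq]
    change (η q) ![X q, Y q] = (η q) (Fin.cons (X q) (Fin.cons (Y q) fun i => _))
    congr 1
    funext i
    fin_cases i <;> rfl
  refine MDifferentiableAt.congr_of_eventuallyEq ?_ hE
  refine MDifferentiableAt.comp (I' := 𝓘(ℝ, E)) p (DifferentiableAt.mdifferentiableAt ?_)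
    (mdifferentiableAt_extChartAt' (mem_extChartAt_source p))
  exact (ContinuousAlternatingMap.apply ℝ E ℝ ![]).differentiableAt.comp _ h2

end Ext

section Alternating
variable {W : Type*} [AddCommGroup W] [Module ℝ W] [TopologicalSpace W]

lemma alt2_add_left (α : W [⋀^Fin 2]→L[ℝ] ℝ) (a b c : W) :
    α ![a + b, c] = α ![a, c] + α ![b, c] := α.toAlternatingMap.map_vecCons_add ![c] a b

lemma alt2_smul_left (α : W [⋀^Fin 2]→L[ℝ] ℝ) (r : ℝ) (a c : W) :
    α ![r • a, c] = r * α ![a, c] := α.toAlternatingMap.map_vecCons_smul ![c] r a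

lemma alt2_swap (α : W [⋀^Fin 2]→L[ℝ] ℝ) (a b : W) : α ![a, b] = - α ![b, a] := by
  refine Eq.trans ?_ (α.toAlternatingMap.map_swap ![b, a] (i := 0) (j := 1) (by decide))
  change α _ = α _
  congr 1
  funext i
  fin_cases i <;> rfl

lemma alt2_add_right (α : W [⋀^Fin 2]→L[ℝ] ℝ) (a b c : W) :
    α ![c, a + b] = α ![c, a] + α ![c, b] := by
  rw [alt2_swap, alt2_add_left, alt2_swap α a, alt2_swap α b]; ring

lemma alt2_smul_right (α : W [⋀^Fin 2]→L[ℝ] ℝ) (r : ℝ) (a c : W) :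
    α ![c, r • a] = r * α ![c, a] := by
  rw [alt2_swap, alt2_smul_left, alt2_swap α a]; ring

lemma alt2_neg_left (α : W [⋀^Fin 2]→L[ℝ] ℝ) (a c : W) : α ![-a, c] = - α ![a, c] := by
  simpa using alt2_smul_left α (-1) a c

lemma alt2_neg_right (α : W [⋀^Fin 2]→L[ℝ] ℝ) (a c : W) : α ![c, -a] = - α ![c, a] := by
  simpa using alt2_smul_right α (-1) a c

end Alternating

section Pointwise

variable {E : Type*} [NormedAddCommGroup E] [NormedSpace ℝ E]
  {H : Type*} [TopologicalSpace H] {I : ModelWithCorners ℝ E H}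
  {M : Type*} [TopologicalSpace M] [ChartedSpace H M]
  [I.Boundaryless] [IsManifold I ∞ M] [FiniteDimensional ℝ E]
  {cov : (∀ x : M, TangentSpace I x) → ∀ x : M, TangentSpace I x →L[ℝ] TangentSpace I x}
  {U : Set M} {p : M}

/-- The covariant derivative of a field with constant components at the centre of the chart. -/
def nabla (cov : (∀ x : M, TangentSpace I x) → ∀ x : M, TangentSpace I x →L[ℝ] TangentSpace I x)
    (p : M) (v u : E) : E := cov (chartField I p v) p (u : TangentSpace I p)

/-- The value of a 2-form on two elements of the model space. -/
def DiffForm.val (η : DiffForm I M 2) (p : M) (v w : E) : ℝ :=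
  η p ![(v : TangentSpace I p), (w : TangentSpace I p)]

/-- The covariant derivative of a 2-form. -/
def DiffForm.nabla (cov : (∀ x : M, TangentSpace I x) →
    ∀ x : M, TangentSpace I x →L[ℝ] TangentSpace I x) (η : DiffForm I M 2)
    (p : M) (u v w : E) : ℝ :=
  mvfderiv I (fun q => η q ![chartField I p v q, chartField I p w q]) p (u : TangentSpace I p)
    - η.val p (NearlyKahler.nabla cov p v u) w - η.val p v (NearlyKahler.nabla cov p w u)

lemma tensorialAt_leibniz (hcov : IsCovariantDerivativeOn E cov U) (hp : p ∈ U)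
    {η : DiffForm I M 2} (hη : η.DiffAt p) {Z : ∀ x : M, TangentSpace I x}
    (hZ : MDiffAt (T% Z) p) (u : TangentSpace I p) :
    TensorialAt I E (fun Y : ∀ x : M, TangentSpace I x => mvfderiv I (fun q => η q ![Y q, Z q]) p u
      - η p ![cov Y p u, Z p] - η p ![Y p, cov Z p u]) p where
  smul {f Y} hf hY := by
    have h1 : (fun q => η q ![(f • Y) q, Z q]) = f * fun q => η q ![Y q, Z q] := by
      funext q
      exact alt2_smul_left (η q) (f q) (Y q) (Z q)
    have h2 := hcov.leibniz hY hf hp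
    rw [h1, mvfderiv_mul hf (hη.mdifferentiableAt_apply hY hZ), h2]
    have e1 := alt2_add_left (η p) (f p • cov Y p u) ((mvfderiv I f p u) • Y p) (Z p)
    have e2 := alt2_smul_left (η p) (f p) (cov Y p u) (Z p)
    have e3 := alt2_smul_left (η p) (mvfderiv I f p u) (Y p) (Z p)
    have e4 := alt2_smul_left (η p) (f p) (Y p) (cov Z p u)
    change f p * mvfderiv I (fun q => η q ![Y q, Z q]) p u + η p ![Y p, Z p] * mvfderiv I f p u
      - η p ![f p • cov Y p u + (mvfderiv I f p u) • Y p, Z p] - η p ![f p • Y p, cov Z p u]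
      = f p * _
    rw [e1, e2, e3, e4]
    ring
  add {Y Y'} hY hY' := by
    have h1 : (fun q => η q ![(Y + Y') q, Z q])
        = (fun q => η q ![Y q, Z q]) + fun q => η q ![Y' q, Z q] := by
      funext q
      exact alt2_add_left (η q) (Y q) (Y' q) (Z q)
    have h2 := hcov.add hY hY' hp
    rw [h1, mvfderiv_add (hη.mdifferentiableAt_apply hY hZ) (hη.mdifferentiableAt_apply hY' hZ), h2]
    have e1 := alt2_add_left (η p) (cov Y p u) (cov Y' p u) (Z p)
    have e2 := alt2_add_left (η p) (Y p) (Y' p) (cov Z p u)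
    change mvfderiv I (fun q => η q ![Y q, Z q]) p u + mvfderiv I (fun q => η q ![Y' q, Z q]) p u
      - η p ![cov Y p u + cov Y' p u, Z p] - η p ![Y p + Y' p, cov Z p u] = _
    rw [e1, e2]
    ring

omit [I.Boundaryless] [IsManifold I ∞ M] [FiniteDimensional ℝ E] in
lemma mvfderiv_congr {f f' : M → ℝ} (h : f =ᶠ[𝓝 p] f') (u : TangentSpace I p) :
    mvfderiv I f p u = mvfderiv I f' p u :=
  DFunLike.congr_fun (h.mfderiv_eq (I := I) (I' := 𝓘(ℝ, ℝ))) u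

omit [I.Boundaryless] [IsManifold I ∞ M] [FiniteDimensional ℝ E] in
lemma mvfderiv_apply_swap (η : DiffForm I M 2) (Y Z : ∀ x : M, TangentSpace I x)
    (u : TangentSpace I p) : mvfderiv I (fun q => η q ![Y q, Z q]) p u
      = - mvfderiv I (fun q => η q ![Z q, Y q]) p u := by
  have h1 : (fun q => η q ![Y q, Z q]) = - fun q => η q ![Z q, Y q] := by
    funext q
    exact alt2_swap (η q) (Y q) (Z q)
  rw [h1, mvfderiv_neg]
  rfl

/-- The Leibniz rule for the covariant derivative of a 2-form. -/
lemma DiffForm.DiffAt.mvfderiv_apply (hcov : IsCovariantDerivativeOn E cov U) (hp : p ∈ U)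
    {η : DiffForm I M 2} (hη : η.DiffAt p) {Y Z : ∀ x : M, TangentSpace I x}
    (hY : MDiffAt (T% Y) p) (hZ : MDiffAt (T% Z) p) (u : E) :
    mvfderiv I (fun q => η q ![Y q, Z q]) p (u : TangentSpace I p)
      = η.nabla cov p u (Y p) (Z p) + η.val p (cov Y p (u : TangentSpace I p)) (Z p)
        + η.val p (Y p) (cov Z p (u : TangentSpace I p)) := by
  have hy := mdifferentiableAt_chartField (E := E) (I := I) (p := p) (Y p)
  have hz := mdifferentiableAt_chartField (E := E) (I := I) (p := p) (Z p)
  have h1 := (tensorialAt_leibniz hcov hp hη hZ u).pointwise hY hy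
    (chartField_self (E := E) (Y p)).symm
  have h2 := (tensorialAt_leibniz hcov hp hη hy u).pointwise hZ hz
    (chartField_self (E := E) (Z p)).symm
  have m1 := mvfderiv_apply_swap (p := p) η Z (chartField I p (Y p)) u
  have m2 := mvfderiv_apply_swap (p := p) η (chartField I p (Z p)) (chartField I p (Y p)) u
  rw [m1, m2] at h2
  have e1 := chartField_self (I := I) (p := p) (E := E) (Y p)
  have e2 := chartField_self (I := I) (p := p) (E := E) (Z p)
  rw [e1] at h1 h2
  rw [e2] at h2
  have s1 := alt2_swap (η p) (cov Z p u) (Y p)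
  have s2 := alt2_swap (η p) (Z p) (cov (chartField I p (Y p)) p u)
  have s3 := alt2_swap (η p) (cov (chartField I p (Z p)) p u) (Y p)
  rw [s1, s2, s3] at h2
  simp only [DiffForm.nabla, DiffForm.val, NearlyKahler.nabla]
  linarith

/-- The data of a nearly Kähler structure on an open set, with its Levi-Civita connection. -/
structure IsNearlyKahlerWith
    (g : ∀ x : M, TangentSpace I x →L[ℝ] TangentSpace I x →L[ℝ] ℝ)
    (J : ∀ x : M, TangentSpace I x →L[ℝ] TangentSpace I x)
    (cov : (∀ x : M, TangentSpace I x) → ∀ x : M, TangentSpace I x →L[ℝ] TangentSpace I x)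
    (U : Set M) : Prop where
  isOpen : IsOpen U
  metric : IsRiemannianMetricOn I g U
  complex : IsAlmostComplexOn I J U
  hermitian : ∀ x ∈ U, ∀ v w : TangentSpace I x, g x (J x v) (J x w) = g x v w
  leviCivita : IsLeviCivitaOn I g cov U
  nearlyKahler : ∀ X : ∀ x : M, TangentSpace I x, ∀ x ∈ U, MDiffAt (T% X) x →
    cov (fun y => J y (X y)) x (X x) - J x (cov X x (X x)) = 0

/-- An endomorphism of the tangent space, on the model space. -/
def endoAt (J : ∀ x : M, TangentSpace I x →L[ℝ] TangentSpace I x) (p : M) : E →L[ℝ] E := J p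

/-- A bilinear form on the tangent space, on the model space. -/
def bilinAt (g : ∀ x : M, TangentSpace I x →L[ℝ] TangentSpace I x →L[ℝ] ℝ) (p : M) :
    E →L[ℝ] E →L[ℝ] ℝ := g p

/-- The value of a 3-form on three elements of the model space. -/
def DiffForm.val₃ (η : DiffForm I M 3) (p : M) (u v w : E) : ℝ :=
  η p ![(u : TangentSpace I p), v, w]

/-- The covariant derivative of an endomorphism field. -/
def nablaJ (J : ∀ x : M, TangentSpace I x →L[ℝ] TangentSpace I x)
    (cov : (∀ x : M, TangentSpace I x) → ∀ x : M, TangentSpace I x →L[ℝ] TangentSpace I x)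
    (p : M) (u v : E) : E :=
  cov (fun q => J q (chartField I p v q)) p (u : TangentSpace I p)
    - J p (cov (chartField I p v) p (u : TangentSpace I p))

lemma companion_algebra {W : Type*} [AddCommGroup W] {B C : W → W → W → ℝ} {σ τ : W → W → ℝ}
    {D : W → W → W} {j : W → W} (hB : ∀ u v w, B u v w = - B u w v)
    (hC : ∀ u v w, C u v w = - C u w v) (hBn : ∀ u v w, B u (-v) w = - B u v w)
    (R : ∀ u v w, C u v w = B u (j v) w + σ (D u v) w)
    (t₁ : ∀ a b, τ a b = σ (j a) b) (t₂ : ∀ a b, τ a b = σ a (j b))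
    (σn : ∀ a b, σ (-a) b = - σ a b)
    (Ds : ∀ u v, D u v = - D v u) (Dj : ∀ u v, D u (j v) = - j (D u v)) (jj : ∀ v, j (j v) = -v)
    (u v w : W) :
    B u v w + B v w u + B w u v
      + (B u (j v) (j w) + B (j v) (j w) u + B (j w) u (j v))
      + (C (j u) v w + C v w (j u) + C w (j u) v)
      + (C (j u) (j v) (j w) + C (j v) (j w) (j u) + C (j w) (j u) (j v))
      = 4 * (τ (D u w) v - τ (D u v) w) := by
  have τn (a b : W) : τ (-a) b = - τ a b := by
    rw [t₂, t₂, σn]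
  have τj (a b : W) : τ (j a) (j b) = - τ a b := by
    rw [t₁, jj, σn, ← t₂]
  have Rj (u v w : W) : C u (j v) w = - B u v w - τ (D u v) w := by
    rw [R, jj, hBn, Dj, σn, ← t₁]; ring
  have Rr (u v w : W) : C u v w = B u v (j w) - σ (D u w) v := by
    rw [hC, R, hB]; ring
  have Rjr (u v w : W) : C u v (j w) = - B u v w + τ (D u w) v := by
    rw [hC, Rj, hB]; ring
  have Dl (u v : W) : D (j u) v = j (D v u) := by
    rw [Ds, Dj, neg_neg]
  have a1 : B u v w + B u (j v) (j w) = τ (D u w) v - τ (D u v) w := by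
    have h1 := R u v (j w)
    have h2 := Rjr u v w
    rw [← t₂] at h1
    linarith
  have a2 : C (j u) v w + C (j u) (j v) (j w) = τ (D u w) v - τ (D u v) w := by
    have h1 := Rr (j u) v w
    have h2 := Rj (j u) v (j w)
    rw [Dl, ← t₁, Ds w u, τn] at h1
    rw [Dl, τj, Ds v u, τn] at h2
    linarith
  have a3 : B v w u + C v w (j u) = - τ (D u v) w := by
    rw [Rjr, Ds v u, τn]; ring
  have a4 : B (j v) (j w) u + C (j v) (j w) (j u) = - τ (D u v) w := by
    rw [Rjr, Dl, τj]; ring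
  have a5 : B w u v + C w (j u) v = τ (D u w) v := by
    rw [Rj, Ds w u, τn]; ring
  have a6 : B (j w) u (j v) + C (j w) (j u) (j v) = τ (D u w) v := by
    rw [Rj, Dl, τj]; ring
  linarith

namespace IsNearlyKahlerWith

variable {g : ∀ x : M, TangentSpace I x →L[ℝ] TangentSpace I x →L[ℝ] ℝ}
  {J : ∀ x : M, TangentSpace I x →L[ℝ] TangentSpace I x}

lemma mdifferentiableAt_J (h : IsNearlyKahlerWith g J cov U) (hp : p ∈ U)
    {X : ∀ x : M, TangentSpace I x} (hX : MDiffAt (T% X) p) :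
    MDiffAt (T% (fun q => J q (X q))) p := by
  have h1 := (h.complex.smooth.contMDiffAt (h.isOpen.mem_nhds hp)).mdifferentiableAt (by simp)
  exact h1.clm_bundle_apply hX

lemma nablaJ_skew_aux (h : IsNearlyKahlerWith g J cov U) (hp : p ∈ U)
    {X Y : ∀ x : M, TangentSpace I x} (hX : MDiffAt (T% X) p) (hY : MDiffAt (T% Y) p) :
    (cov (fun q => J q (X q)) p (Y p) - J p (cov X p (Y p)) : E)
      = - (cov (fun q => J q (Y q)) p (X p) - J p (cov Y p (X p))) := by
  have hc := h.leviCivita.isCovariantDerivative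
  have h1 := h.nearlyKahler (X + Y) p hp (mdifferentiableAt_add_section hX hY)
  have h2 := h.nearlyKahler X p hp hX
  have h3 := h.nearlyKahler Y p hp hY
  have hJ : (fun y => J y ((X + Y) y)) = (fun y => J y (X y)) + fun y => J y (Y y) := by
    funext y
    exact map_add (J y) _ _
  rw [hJ, hc.add hX hY hp,
    hc.add (h.mdifferentiableAt_J hp hX) (h.mdifferentiableAt_J hp hY) hp] at h1
  rw [eq_neg_iff_add_eq_zero]
  have k : ∀ (A B C D : TangentSpace I p →L[ℝ] TangentSpace I p) (j : TangentSpace I p →L[ℝ] TangentSpace I p)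
    (x y : TangentSpace I p), (A + B) (x + y) - j ((C + D) (x + y)) = 0 → A x - j (C x) = 0 →
      B y - j (D y) = 0 → (A y - j (C y)) + (B x - j (D x)) = 0 := by
    intro A B C D j x y e1 e2 e3
    simp only [_root_.add_apply, map_add] at e1
    linear_combination (norm := abel) e1 - e2 - e3
  exact k _ _ _ _ _ _ _ h1 h2 h3

/-- `(∇_u J) Y` depends on the value of the field `Y` only. -/
lemma nablaJ_field (h : IsNearlyKahlerWith g J cov U) (hp : p ∈ U)
    {Y : ∀ x : M, TangentSpace I x} (hY : MDiffAt (T% Y) p) (u : E) :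
    (cov (fun q => J q (Y q)) p u - J p (cov Y p u) : E) = nablaJ J cov p u (Y p) := by
  have hu := mdifferentiableAt_chartField (E := E) (I := I) (p := p) u
  have hy := mdifferentiableAt_chartField (E := E) (I := I) (p := p) (Y p)
  have h1 := h.nablaJ_skew_aux hp hY hu
  have h2 := h.nablaJ_skew_aux hp hy hu
  have e1 := chartField_self (I := I) (p := p) (E := E) (Y p)
  have e2 := chartField_self (I := I) (p := p) (E := E) u
  rw [e2] at h1 h2
  rw [e1] at h2
  exact h1.trans h2.symm

lemma nablaJ_skew (h : IsNearlyKahlerWith g J cov U) (hp : p ∈ U) (u v : E) :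
    nablaJ J cov p u v = - nablaJ J cov p v u := by
  have h1 := h.nablaJ_skew_aux hp (mdifferentiableAt_chartField (E := E) (I := I) (p := p) v)
    (mdifferentiableAt_chartField (E := E) (I := I) (p := p) u)
  rw [chartField_self (E := E) u, chartField_self (E := E) v] at h1
  exact h1

lemma nabla_symm (h : IsNearlyKahlerWith g J cov U) (hp : p ∈ U) (u v : E) :
    nabla cov p u v = nabla cov p v u := by
  have h1 := h.leviCivita.torsion_free (chartField I p u) (chartField I p v) p hp
    (mdifferentiableAt_chartField u) (mdifferentiableAt_chartField v)
  rw [mlieBracket_chartField, chartField_self (E := E) u, chartField_self (E := E) v] at h1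
  exact (sub_eq_zero.1 h1).symm

lemma endoAt_sq (h : IsNearlyKahlerWith g J cov U) (hp : p ∈ U) (v : E) :
    endoAt J p (endoAt J p v) = -v := h.complex.sq p hp v

lemma bilinAt_symm (h : IsNearlyKahlerWith g J cov U) (hp : p ∈ U) (v w : E) :
    bilinAt g p v w = bilinAt g p w v := h.metric.symm p hp v w

lemma bilinAt_endoAt (h : IsNearlyKahlerWith g J cov U) (hp : p ∈ U) (v w : E) :
    bilinAt g p (endoAt J p v) w = - bilinAt g p v (endoAt J p w) := by
  have h1 : bilinAt g p (endoAt J p v) (endoAt J p (endoAt J p w)) = bilinAt g p v (endoAt J p w) :=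
    h.hermitian p hp v (endoAt J p w)
  rw [h.endoAt_sq hp, map_neg] at h1
  linarith

lemma cov_J (h : IsNearlyKahlerWith g J cov U) (hp : p ∈ U)
    {Y : ∀ x : M, TangentSpace I x} (hY : MDiffAt (T% Y) p) (u : E) :
    (cov (fun q => J q (Y q)) p u : E)
      = nablaJ J cov p u (Y p) + endoAt J p (cov Y p u : TangentSpace I p) :=
  sub_eq_iff_eq_add.1 (h.nablaJ_field hp hY u)

lemma nablaJ_J (h : IsNearlyKahlerWith g J cov U) (hp : p ∈ U) (u v : E) :
    nablaJ J cov p u (endoAt J p v) = - endoAt J p (nablaJ J cov p u v) := by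
  have hv := mdifferentiableAt_chartField (E := E) (I := I) (p := p) v
  have hc := h.leviCivita.isCovariantDerivative
  have h1 := h.cov_J hp (h.mdifferentiableAt_J hp hv) u
  have h2 : cov (fun q => J q (J q (chartField I p v q))) p = cov ((-1 : ℝ) • chartField I p v) p := by
    refine hc.congr_of_eventuallyEq (h.mdifferentiableAt_J hp (h.mdifferentiableAt_J hp hv))
      (MDifferentiableAt.smul_section mdifferentiableAt_const hv) (h.isOpen.mem_nhds hp) ?_
    filter_upwards [h.isOpen.mem_nhds hp] with q hq
    refine (h.complex.sq q hq _).trans ?_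
    exact (neg_one_smul ℝ (chartField I p v q)).symm
  have h3 := h.cov_J hp hv u
  have h4 : (cov ((-1 : ℝ) • chartField I p v) p u : E) = - nabla cov p v u := by
    rw [hc.smul_const _ hv hp]
    exact neg_one_smul ℝ (nabla cov p v u)
  rw [h2] at h1
  have h5 : (J p (chartField I p v p) : E) = endoAt J p v := by
    rw [chartField_self (E := E) v]; rfl
  have h6 : endoAt J p (cov (fun q => J q (chartField I p v q)) p u)
      = endoAt J p (nablaJ J cov p u (chartField I p v p) + endoAt J p (nabla cov p v u)) :=
    congrArg (endoAt J p) h3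
  rw [map_add, h.endoAt_sq hp, chartField_self (E := E) v] at h6
  have h7 := h4.symm.trans h1
  beta_reduce at h7
  rw [h5] at h7
  linear_combination (norm := abel) -h6 - h7

lemma mvfderiv_metric (h : IsNearlyKahlerWith g J cov U) (hp : p ∈ U)
    {Y Z : ∀ x : M, TangentSpace I x} (hY : MDiffAt (T% Y) p) (hZ : MDiffAt (T% Z) p) (v : E) :
    mvfderiv I (fun y => g y (Y y) (Z y)) p v
      = bilinAt g p (cov Y p v) (Z p) + bilinAt g p (Y p) (cov Z p v) :=
  h.leviCivita.metric Y Z p hp hY hZ v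

lemma metric_nablaJ (h : IsNearlyKahlerWith g J cov U) (hp : p ∈ U) (u v w : E) :
    bilinAt g p (nablaJ J cov p u v) w = - bilinAt g p v (nablaJ J cov p u w) := by
  have hv := mdifferentiableAt_chartField (E := E) (I := I) (p := p) v
  have hw := mdifferentiableAt_chartField (E := E) (I := I) (p := p) w
  have h1 := h.mvfderiv_metric hp (h.mdifferentiableAt_J hp hv) hw u
  have h2 := h.mvfderiv_metric hp hv (h.mdifferentiableAt_J hp hw) u
  have h3 : (fun y => g y (J y (chartField I p v y)) (chartField I p w y))
      =ᶠ[𝓝 p] - fun y => g y (chartField I p v y) (J y (chartField I p w y)) := by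
    filter_upwards [h.isOpen.mem_nhds hp] with q hq
    exact h.bilinAt_endoAt hq _ _
  have h4 := mvfderiv_congr (I := I) h3 u
  have h5 : mvfderiv I (fun y => g y (J y (chartField I p v y)) (chartField I p w y)) p u
      = - mvfderiv I (fun y => g y (chartField I p v y) (J y (chartField I p w y))) p u := by
    refine Eq.trans h4 ?_
    exact DFunLike.congr_fun mvfderiv_neg u
  rw [h1, h2] at h5
  have e1 := h.cov_J hp hv u
  have e2 := h.cov_J hp hw u
  rw [e1, e2, chartField_self (E := E) v, chartField_self (E := E) w] at h5
  rw [map_add (bilinAt g p), map_add (bilinAt g p v), _root_.add_apply] at h5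
  have e3 := h.bilinAt_endoAt hp (cov (chartField I p v) p u) w
  have e4 := h.bilinAt_endoAt hp v (cov (chartField I p w) p u)
  change _ + bilinAt g p (endoAt J p v) (cov (chartField I p w) p u) = -(bilinAt g p (cov (chartField I p v) p u) (endoAt J p w) + _) at h5
  linarith

lemma d_apply (h : IsNearlyKahlerWith g J cov U) (hp : p ∈ U) {κ : DiffForm I M 2}
    (hK : ∀ p ∈ U, ∀ v w : TangentSpace I p, κ p ![v, w] = g p (J p v) w) (hκ : κ.DiffAt p)
    (u v w : E) : κ.d.val₃ p u v w = 3 * bilinAt g p (nablaJ J cov p u v) w := by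
  have key (u v w : E) : mvfderiv I (fun q => κ q ![chartField I p v q, chartField I p w q]) p u
      = bilinAt g p (nablaJ J cov p u v) w + bilinAt g p (endoAt J p (nabla cov p v u)) w
        + bilinAt g p (endoAt J p v) (nabla cov p w u) := by
    have hv := mdifferentiableAt_chartField (E := E) (I := I) (p := p) v
    have hw := mdifferentiableAt_chartField (E := E) (I := I) (p := p) w
    have h1 := h.mvfderiv_metric hp (h.mdifferentiableAt_J hp hv) hw u
    have h3 : (fun q => κ q ![chartField I p v q, chartField I p w q])
      =ᶠ[𝓝 p] fun y => g y (J y (chartField I p v y)) (chartField I p w y) := by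
      filter_upwards [h.isOpen.mem_nhds hp] with q hq
      exact hK q hq _ _
    have h4 := mvfderiv_congr (I := I) h3 u
    refine Eq.trans h4 (h1.trans ?_)
    have e1 := h.cov_J hp hv u
    rw [e1, chartField_self (E := E) v, chartField_self (E := E) w, map_add, _root_.add_apply]
    rfl
  have h1 := hκ.d_apply_chartField u v w
  rw [key, key, key] at h1
  refine h1.trans ?_
  have s1 := h.nabla_symm hp u v
  have s2 := h.nabla_symm hp v w
  have s3 := h.nabla_symm hp w u
  have t1 (a b : E) : bilinAt g p (endoAt J p a) b = - bilinAt g p (endoAt J p b) a := by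
    rw [h.bilinAt_endoAt hp, h.bilinAt_symm hp]
  have D2 (a b c : E) : bilinAt g p (nablaJ J cov p a b) c
      = - bilinAt g p (nablaJ J cov p b a) c := by
    rw [h.nablaJ_skew hp a b, map_neg, _root_.neg_apply]
  rw [s1, s2, s3]
  linarith [h.metric_nablaJ hp v w u, h.bilinAt_symm hp w (nablaJ J cov p v u), D2 v u w, D2 w u v,
    h.metric_nablaJ hp u w v, h.bilinAt_symm hp w (nablaJ J cov p u v), t1 (nabla cov p v u) w,
    t1 (nabla cov p w v) u, t1 (nabla cov p u w) v]

/-- The covariant derivatives of a form of type `(2, 0) + (0, 2)` and of its companion. -/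
lemma nabla_companion (h : IsNearlyKahlerWith g J cov U) (hp : p ∈ U) {σ τ : DiffForm I M 2}
    (hσ : σ.DiffAt p) (hτ : ∀ᶠ q in 𝓝 p, ∀ v w : TangentSpace I q, τ q ![v, w] = σ q ![J q v, w])
    (u v w : E) : τ.nabla cov p u v w
      = σ.nabla cov p u (endoAt J p v) w + σ.val p (nablaJ J cov p u v) w := by
  have hv := mdifferentiableAt_chartField (E := E) (I := I) (p := p) v
  have hw := mdifferentiableAt_chartField (E := E) (I := I) (p := p) w
  have hc := h.leviCivita.isCovariantDerivative
  have h1 : mvfderiv I (fun q => τ q ![chartField I p v q, chartField I p w q]) p u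
      = mvfderiv I (fun q => σ q ![J q (chartField I p v q), chartField I p w q]) p u :=
    mvfderiv_congr (hτ.mono fun q hq => hq _ _) u
  have h2 := hσ.mvfderiv_apply hc hp (h.mdifferentiableAt_J hp hv) hw u
  rw [h2] at h1
  have e1 := h.cov_J hp hv u
  rw [e1, chartField_self (E := E) v, chartField_self (E := E) w] at h1
  have h4 : τ.val p (nabla cov p v u) w = σ.val p (endoAt J p (nabla cov p v u)) w :=
    hτ.self_of_nhds _ _
  have h5 : τ.val p v (nabla cov p w u) = σ.val p (endoAt J p v) (nabla cov p w u) :=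
    hτ.self_of_nhds _ _
  have h6 : σ.val p (nablaJ J cov p u v + endoAt J p (nabla cov p v u)) w
    = σ.val p (nablaJ J cov p u v) w + σ.val p (endoAt J p (nabla cov p v u)) w :=
    alt2_add_left (σ p) _ _ _
  change _ = σ.nabla cov p u (endoAt J p v) w
    + σ.val p (nablaJ J cov p u v + endoAt J p (nabla cov p v u)) w
    + σ.val p (endoAt J p v) (nabla cov p w u) at h1
  rw [h6] at h1
  rw [DiffForm.nabla, h1, h4, h5]
  ring

lemma d_eq_nabla (h : IsNearlyKahlerWith g J cov U) (hp : p ∈ U) {σ : DiffForm I M 2}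
    (hσ : σ.DiffAt p) (u v w : E) : σ.d.val₃ p u v w
      = σ.nabla cov p u v w + σ.nabla cov p v w u + σ.nabla cov p w u v := by
  refine (hσ.d_apply_chartField u v w).trans ?_
  have s (a b c : E) : σ.val p (nabla cov p a b) c = - σ.val p c (nabla cov p b a) := by
    rw [h.nabla_symm hp a b]; exact alt2_swap (σ p) _ _
  simp only [DiffForm.nabla]
  linarith [s v u w, s w v u, s u w v]

lemma _root_.NearlyKahler.DiffForm.nabla_swap (σ : DiffForm I M 2) (u v w : E) :
    σ.nabla cov p u v w = - σ.nabla cov p u w v := by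
  have h1 := mvfderiv_apply_swap (p := p) σ (chartField I p v) (chartField I p w) u
  have h2 : σ.val p (nabla cov p v u) w = - σ.val p w (nabla cov p v u) := alt2_swap (σ p) _ _
  have h3 : σ.val p (nabla cov p w u) v = - σ.val p v (nabla cov p w u) := alt2_swap (σ p) _ _
  simp only [DiffForm.nabla]
  linarith

/-- The second-order identity satisfied by the exterior derivatives of a form `σ` of type
`(2, 0) + (0, 2)` and of its companion `τ = σ(J·, ·)`. -/
lemma d_companion (h : IsNearlyKahlerWith g J cov U) (hp : p ∈ U) {σ τ : DiffForm I M 2}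
    (hσ : σ.DiffAt p) (hτd : τ.DiffAt p)
    (hτ : ∀ᶠ q in 𝓝 p, ∀ v w : TangentSpace I q, τ q ![v, w] = σ q ![J q v, w])
    (hτ' : ∀ᶠ q in 𝓝 p, ∀ v w : TangentSpace I q, τ q ![v, w] = σ q ![v, J q w]) (u v w : E) :
    σ.d.val₃ p u v w + σ.d.val₃ p u (endoAt J p v) (endoAt J p w)
      + τ.d.val₃ p (endoAt J p u) v w
      + τ.d.val₃ p (endoAt J p u) (endoAt J p v) (endoAt J p w)
      = 4 * (τ.val p (nablaJ J cov p u w) v - τ.val p (nablaJ J cov p u v) w) := by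
  have val1 (a b : E) : τ.val p a b = σ.val p (endoAt J p a) b := hτ.self_of_nhds a b
  have val2 (a b : E) : τ.val p a b = σ.val p a (endoAt J p b) := hτ'.self_of_nhds a b
  have hneg (u v w : E) : σ.nabla cov p u (-v) w = - σ.nabla cov p u v w := by
    have hv := mdifferentiableAt_chartField (E := E) (I := I) (p := p) v
    have h1 : chartField I p (-v) = (-1 : ℝ) • chartField I p v := by
      funext q
      refine (map_neg (mfderiv I 𝓘(ℝ, E) (extChartAt I p) q).inverse v).trans ?_
      exact (neg_one_smul ℝ (chartField I p v q)).symm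
    have h2 : NearlyKahler.nabla cov p (-v) u = - NearlyKahler.nabla cov p v u := by
      rw [NearlyKahler.nabla, h1, h.leviCivita.isCovariantDerivative.smul_const _ hv hp]
      exact neg_one_smul ℝ (NearlyKahler.nabla cov p v u)
    have h3 : (fun q => σ q ![chartField I p (-v) q, chartField I p w q])
        = - fun q => σ q ![chartField I p v q, chartField I p w q] := by
      funext q
      rw [h1]
      refine (alt2_smul_left (σ q) (-1) (chartField I p v q) (chartField I p w q)).trans ?_
      exact neg_one_mul _
    have h4 : mvfderiv I (fun q => σ q ![chartField I p (-v) q, chartField I p w q]) p u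
        = - mvfderiv I (fun q => σ q ![chartField I p v q, chartField I p w q]) p u := by
      rw [h3, mvfderiv_neg]
      rfl
    have h5 (a b : E) : σ.val p (-a) b = - σ.val p a b := alt2_neg_left (σ p) a b
    rw [DiffForm.nabla, DiffForm.nabla, h2, h4, h5, h5]
    ring
  rw [h.d_eq_nabla hp hσ, h.d_eq_nabla hp hσ, h.d_eq_nabla hp hτd, h.d_eq_nabla hp hτd]
  exact companion_algebra (fun u v w => DiffForm.nabla_swap σ u v w)
    (fun u v w => DiffForm.nabla_swap τ u v w) hneg (h.nabla_companion hp hσ hτ) val1 val2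
    (fun a b => alt2_neg_left (σ p) a b)
    (h.nablaJ_skew hp) (h.nablaJ_J hp)
    (h.endoAt_sq hp) u v w

end IsNearlyKahlerWith

end Pointwise

section StableTable

variable {W : Type*} [AddCommGroup W] [Module ℝ W] [TopologicalSpace W]

/-- The components of the real part of `dz⁰ ∧ dz¹ ∧ dz²` in the basis `x⁰, y⁰, x¹, y¹, x², y²`. -/
def reOmega (i j k : Fin 6) : ℤ :=
  let a : ℤ := i.val / 2
  let b : ℤ := j.val / 2
  let c : ℤ := k.val / 2
  (b - a) * (c - a) * (c - b) / 2 *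
    (match i.val % 2 + j.val % 2 + k.val % 2 with
      | 0 => 1
      | 2 => -1
      | _ => 0)

/-- The matrix of the standard complex structure. -/
def rotTable (l m : Fin 6) : ℤ :=
  if l.val / 2 = m.val / 2 then (m.val : ℤ) - l.val else 0

lemma sum_sign_reOmega : ∀ l m : Fin 6, (∑ σ : Equiv.Perm (Fin 6), if σ 5 = m then
    (Equiv.Perm.sign σ : ℤ) * reOmega l (σ 0) (σ 1) * reOmega (σ 2) (σ 3) (σ 4) else 0)
      = 24 * rotTable l m := by
  decide +kernel

lemma sum_rotTable : ∀ l n : Fin 6, ∑ m, rotTable l m * rotTable m n = if l = n then -1 else 0 := by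
  decide

lemma alt3_add (α : W [⋀^Fin 3]→L[ℝ] ℝ) (a b c d : W) :
    α ![a + b, c, d] = α ![a, c, d] + α ![b, c, d] := α.toAlternatingMap.map_vecCons_add ![c, d] a b

lemma alt3_smul (α : W [⋀^Fin 3]→L[ℝ] ℝ) (r : ℝ) (a c d : W) :
    α ![r • a, c, d] = r * α ![a, c, d] := α.toAlternatingMap.map_vecCons_smul ![c, d] r a

lemma alt3_swap01 (α : W [⋀^Fin 3]→L[ℝ] ℝ) (a b c : W) : α ![a, b, c] = - α ![b, a, c] := by
  refine Eq.trans ?_ (α.toAlternatingMap.map_swap ![b, a, c] (i := 0) (j := 1) (by decide))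
  change α _ = α _
  congr 1
  funext i
  fin_cases i <;> rfl

lemma alt3_swap12 (α : W [⋀^Fin 3]→L[ℝ] ℝ) (a b c : W) : α ![a, b, c] = - α ![a, c, b] := by
  refine Eq.trans ?_ (α.toAlternatingMap.map_swap ![a, c, b] (i := 1) (j := 2) (by decide))
  change α _ = α _
  congr 1
  funext i
  fin_cases i <;> rfl

/-- `stableEndo` as a linear map. -/
def stableLin (e : Module.Basis (Fin 6) ℝ W) (θ : W [⋀^Fin 3]→L[ℝ] ℝ) : W →ₗ[ℝ] W where
  toFun := stableEndo e θ
  map_add' v w := by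
    simp only [stableEndo, alt3_add, mul_add, add_mul, add_smul, Finset.sum_add_distrib, smul_add]
  map_smul' r v := by
    simp only [stableEndo, alt3_smul, RingHom.id_apply]
    rw [smul_comm r, Finset.smul_sum (r := r)]
    congr 1
    refine Finset.sum_congr rfl fun σ _ => ?_
    rw [smul_smul]
    congr 1
    ring

lemma isStableForm_of_basis (e : Module.Basis (Fin 6) ℝ W) {θ : W [⋀^Fin 3]→L[ℝ] ℝ} {c : ℝ}
    (hc : c ≠ 0) (h : ∀ i j k, θ ![e i, e j, e k] = c * reOmega i j k) : IsStableForm θ := by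
  have key (l : Fin 6) : stableEndo e θ (e l) = (2 * c ^ 2) • ∑ m, (rotTable l m : ℝ) • e m := by
    rw [stableEndo]
    simp only [h]
    have h1 (m : Fin 6) : (rotTable l m : ℝ) = 24⁻¹ * ∑ σ : Equiv.Perm (Fin 6), if σ 5 = m then
        ((Equiv.Perm.sign σ : ℤ) : ℝ) * reOmega l (σ 0) (σ 1) * reOmega (σ 2) (σ 3) (σ 4)
        else 0 := by
      have := sum_sign_reOmega l m
      have h2 : (24 : ℝ) * rotTable l m = ((24 * rotTable l m : ℤ) : ℝ) := by push_cast; ring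
      rw [eq_inv_mul_iff_mul_eq₀ (by norm_num), h2, ← this]
      push_cast
      rfl
    simp only [h1, Finset.smul_sum, Finset.mul_sum, Finset.sum_smul]
    rw [Finset.sum_comm]
    refine Finset.sum_congr rfl fun σ _ => ?_
    rw [Finset.sum_eq_single (σ 5)]
    · simp only [if_true, smul_smul]
      congr 1
      ring
    · intro m _ hm
      rw [if_neg (Ne.symm hm)]
      simp
    · simp
  refine ⟨e, -(2 * c ^ 2) ^ 2, by have : 0 < c ^ 2 := by positivity
                                  nlinarith, fun v => ?_⟩
  have h2 : stableLin e θ ∘ₗ stableLin e θ = (-(2 * c ^ 2) ^ 2) • LinearMap.id := by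
    refine e.ext fun l => ?_
    have k1 (l : Fin 6) : stableLin e θ (e l) = (2 * c ^ 2) • ∑ m, (rotTable l m : ℝ) • e m := key l
    rw [LinearMap.comp_apply, k1, map_smul, map_sum]
    simp only [map_smul, k1, Finset.smul_sum, smul_smul]
    rw [Finset.sum_comm]
    have h3 (n : Fin 6) : ∑ m, (2 * c ^ 2 * (rotTable l m * (2 * c ^ 2 * rotTable m n))) • e n
        = if l = n then (-(2 * c ^ 2) ^ 2) • e n else 0 := by
      have h4 := sum_rotTable l n
      have h5 : ∑ m, (rotTable l m : ℝ) * rotTable m n = if l = n then -1 else 0 := by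
        exact_mod_cast congrArg (Int.cast (R := ℝ)) h4
      rw [← Finset.sum_smul]
      have h6 : ∑ m, (2 * c ^ 2 * (rotTable l m * (2 * c ^ 2 * rotTable m n)) : ℝ)
          = (2 * c ^ 2) ^ 2 * ∑ m, (rotTable l m : ℝ) * rotTable m n := by
        rw [Finset.mul_sum]
        exact Finset.sum_congr rfl fun m _ => by ring
      rw [h6, h5]
      split_ifs <;> simp
    simp only [h3]
    simp
  exact LinearMap.congr_fun h2 v

lemma eq_zero_of_lt {f : Fin 6 → Fin 6 → Fin 6 → ℝ} (h1 : ∀ i j k, f i j k = - f j i k)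
    (h2 : ∀ i j k, f i j k = - f i k j) (h : ∀ i j k, i < j → j < k → f i j k = 0)
    (i j k : Fin 6) : f i j k = 0 := by
  rcases lt_trichotomy i j with a | rfl | a
  · rcases lt_trichotomy j k with b | rfl | b
    · exact h _ _ _ a b
    · linarith [h2 i j j]
    · rcases lt_trichotomy i k with d | rfl | d
      · rw [h2, h _ _ _ d b, neg_zero]
      · rw [h2]; linarith [h1 i i j]
      · rw [h2, h1, h _ _ _ d a]; simp
  · linarith [h1 i i k]
  · rcases lt_trichotomy i k with b | rfl | b
    · rw [h1, h _ _ _ a b, neg_zero]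
    · rw [h1]; linarith [h2 j i i]
    · rcases lt_trichotomy j k with d | rfl | d
      · rw [h1, h2, h _ _ _ d b]; simp
      · rw [h1, h2]; linarith [h1 j j i]
      · rw [h1, h2, h1, h _ _ _ d a]; simp

/-- A 3-form with the components of the real part of a complex volume form is stable. -/
lemma isStableForm_of_table (hW : Module.finrank ℝ W = 6) {θ : W [⋀^Fin 3]→L[ℝ] ℝ}
    (e : Fin 6 → W) {c : ℝ} (hc : c ≠ 0)
    (h024 : θ ![e 0, e 2, e 4] = c) (h035 : θ ![e 0, e 3, e 5] = -c)
    (h125 : θ ![e 1, e 2, e 5] = -c) (h134 : θ ![e 1, e 3, e 4] = -c)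
    (h01 : ∀ k, θ ![e 0, e 1, e k] = 0) (h23 : ∀ k, θ ![e 2, e 3, e k] = 0)
    (h45 : ∀ k, θ ![e 4, e 5, e k] = 0)
    (h025 : θ ![e 0, e 2, e 5] = 0) (h034 : θ ![e 0, e 3, e 4] = 0)
    (h124 : θ ![e 1, e 2, e 4] = 0) (h135 : θ ![e 1, e 3, e 5] = 0) : IsStableForm θ := by
  have h : ∀ i j k, θ ![e i, e j, e k] = c * reOmega i j k := by
    intro i j k
    rw [← sub_eq_zero]
    refine eq_zero_of_lt (f := fun i j k => θ ![e i, e j, e k] - c * reOmega i j k) ?_ ?_ ?_ i j k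
    · intro i j k
      have : reOmega i j k = - reOmega j i k := by revert i j k; decide
      rw [alt3_swap01, this]
      push_cast
      ring
    · intro i j k
      have : reOmega i j k = - reOmega i k j := by revert i j k; decide
      rw [alt3_swap12, this]
      push_cast
      ring
    · intro i j k hij hjk
      have h01' (k : Fin 6) : θ ![e k, e 0, e 1] = 0 := by
        rw [alt3_swap01, alt3_swap12, h01]; simp
      have h23' (k : Fin 6) : θ ![e k, e 2, e 3] = 0 := by
        rw [alt3_swap01, alt3_swap12, h23]; simp
      have h45' (k : Fin 6) : θ ![e k, e 4, e 5] = 0 := by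
        rw [alt3_swap01, alt3_swap12, h45]; simp
      have hl : ∀ i j k : Fin 6, i < j → j < k →
          ((i, j) = (0, 1) ∨ (i, j) = (2, 3) ∨ (j, k) = (2, 3) ∨ (j, k) = (4, 5)) ∧
            reOmega i j k = 0 ∨
          (i, j, k) ∈ [(0, 2, 4), (0, 3, 5), (1, 2, 5), (1, 3, 4), (0, 2, 5), (0, 3, 4), (1, 2, 4),
            (1, 3, 5)] := by decide
      rcases hl i j k hij hjk with ⟨h1, h2⟩ | h1
      · rw [h2]
        simp only [Prod.mk.injEq] at h1
        rcases h1 with ⟨rfl, rfl⟩ | ⟨rfl, rfl⟩ | ⟨rfl, rfl⟩ | ⟨rfl, rfl⟩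
        · simp [h01]
        · simp [h23]
        · simp [h23']
        · simp [h45']
      · simp only [List.mem_cons, Prod.mk.injEq, List.not_mem_nil, or_false] at h1
        rcases h1 with ⟨rfl, rfl, rfl⟩ | ⟨rfl, rfl, rfl⟩ | ⟨rfl, rfl, rfl⟩ | ⟨rfl, rfl, rfl⟩ |
          ⟨rfl, rfl, rfl⟩ | ⟨rfl, rfl, rfl⟩ | ⟨rfl, rfl, rfl⟩ | ⟨rfl, rfl, rfl⟩
        · rw [h024, show reOmega 0 2 4 = 1 by decide]; simp
        · rw [h035, show reOmega 0 3 5 = -1 by decide]; simp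
        · rw [h125, show reOmega 1 2 5 = -1 by decide]; simp
        · rw [h134, show reOmega 1 3 4 = -1 by decide]; simp
        · rw [h025, show reOmega 0 2 5 = 0 by decide]; simp
        · rw [h034, show reOmega 0 3 4 = 0 by decide]; simp
        · rw [h124, show reOmega 1 2 4 = 0 by decide]; simp
        · rw [h135, show reOmega 1 3 5 = 0 by decide]; simp
  have hli : LinearIndependent ℝ e := by
    rw [Fintype.linearIndependent_iff]
    intro x hx l
    have hl : ∀ l : Fin 6, ∃ j k : Fin 6, reOmega l j k ≠ 0 ∧ ∀ m, m ≠ l → reOmega m j k = 0 := by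
      decide
    obtain ⟨j, k, hl1, hl2⟩ := hl l
    let L : W →ₗ[ℝ] ℝ :=
      { toFun := fun v => θ ![v, e j, e k]
        map_add' := fun a b => alt3_add θ a b _ _
        map_smul' := fun r a => alt3_smul θ r a _ _ }
    have h1 := congrArg L hx
    rw [map_sum, map_zero, Finset.sum_eq_single l] at h1
    · rw [map_smul] at h1
      have h2 : L (e l) = c * reOmega l j k := h l j k
      rw [h2, smul_eq_mul] at h1
      have h3 : (reOmega l j k : ℝ) ≠ 0 := by exact_mod_cast hl1
      exact (mul_eq_zero.1 h1).resolve_right (mul_ne_zero hc h3)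
    · intro m _ hm
      have h2 : L (e m) = c * reOmega m j k := h m j k
      rw [map_smul, h2, hl2 m hm]
      simp
    · simp
  have hfd : FiniteDimensional ℝ W := FiniteDimensional.of_finrank_pos (by omega)
  let b := basisOfLinearIndependentOfCardEqFinrank hli (by simp [hW])
  have hb : ∀ i, b i = e i := fun i => by
    simp [b]
  exact isStableForm_of_basis b hc (by simpa only [hb] using h)

end StableTable

section ComplexType

variable {W : Type*} [AddCommGroup W] [Module ℝ W] [TopologicalSpace W]

lemma alt3_neg (α : W [⋀^Fin 3]→L[ℝ] ℝ) (a c d : W) : α ![-a, c, d] = - α ![a, c, d] := by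
  simpa using alt3_smul α (-1) a c d

lemma alt3_rot (α : W [⋀^Fin 3]→L[ℝ] ℝ) (a b c : W) : α ![a, b, c] = α ![b, c, a] := by
  rw [alt3_swap01, alt3_swap12, neg_neg]

lemma alt3_neg_right (α : W [⋀^Fin 3]→L[ℝ] ℝ) (a c d : W) : α ![c, d, -a] = - α ![c, d, a] := by
  rw [← alt3_rot, alt3_neg, alt3_rot α a]

lemma alt3_add_right (α : W [⋀^Fin 3]→L[ℝ] ℝ) (a b c d : W) :
    α ![c, d, a + b] = α ![c, d, a] + α ![c, d, b] := by
  rw [← alt3_rot, alt3_add, alt3_rot α a, alt3_rot α b]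

lemma alt3_smul_right (α : W [⋀^Fin 3]→L[ℝ] ℝ) (r : ℝ) (a c d : W) :
    α ![c, d, r • a] = r * α ![c, d, a] := by
  rw [← alt3_rot, alt3_smul, alt3_rot α a]

lemma alt3_self (α : W [⋀^Fin 3]→L[ℝ] ℝ) (a b : W) : α ![a, a, b] = 0 := by
  linarith [alt3_swap01 α a a b]

/-- A nondegenerate 3-form of type `(3, 0) + (0, 3)` on a space of real dimension six is stable. -/
lemma isStableForm_of_type (hW : Module.finrank ℝ W = 6) {θ : W [⋀^Fin 3]→L[ℝ] ℝ}
    (J : W →ₗ[ℝ] W) (hJ : ∀ v, J (J v) = -v) (hθ : ∀ x y z, θ ![J x, y, z] = θ ![x, J y, z])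
    (hne : θ ≠ 0) : IsStableForm θ := by
  obtain ⟨v, hv⟩ := DFunLike.ne_iff.1 hne
  have hv' : θ ![v 0, v 1, v 2] ≠ 0 := by
    have h1 : v = ![v 0, v 1, v 2] := by
      funext i
      fin_cases i <;> rfl
    rw [← h1]
    exact hv
  have hθ' (x y z : W) : θ ![x, J y, z] = θ ![x, y, J z] := by
    rw [← hθ, alt3_swap12, hθ, alt3_swap12, neg_neg]
  set a := v 0
  set b := v 1
  set x := θ ![a, b, v 2] with hx
  set y := θ ![a, b, J (v 2)] with hy
  set w := x • v 2 + y • J (v 2) with hw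
  have h1 : θ ![a, b, w] = x ^ 2 + y ^ 2 := by
    rw [hw, alt3_add_right, alt3_smul_right, alt3_smul_right]; ring
  have h2 : θ ![a, b, J w] = 0 := by
    rw [hw, map_add, map_smul, map_smul, hJ, alt3_add_right, alt3_smul_right, alt3_smul_right,
      alt3_neg_right]
    ring
  have h3 (x y : W) : θ ![x, J x, y] = 0 := by rw [hθ', alt3_self]
  refine isStableForm_of_table hW ![a, J a, b, J b, w, J w] (c := x ^ 2 + y ^ 2) (by positivity)
    h1 ?_ ?_ ?_ (fun k => h3 _ _) (fun k => h3 _ _) (fun k => h3 _ _) h2 ?_ ?_ ?_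
  · change θ ![a, J b, J w] = _
    rw [hθ', hJ, alt3_neg_right, h1]
  · change θ ![J a, b, J w] = _
    rw [hθ, hθ', hJ, alt3_neg_right, h1]
  · change θ ![J a, J b, w] = _
    rw [hθ, hθ', hθ', hJ, alt3_neg_right, h1]
  · change θ ![a, J b, w] = _
    rw [hθ', h2]
  · change θ ![J a, b, w] = _
    rw [hθ, hθ', h2]
  · change θ ![J a, J b, J w] = _
    rw [hθ, hθ', hθ', hJ, alt3_neg_right, h2, neg_zero]

/-- A complex structure is determined by a 2-form which it tames and a nondegenerate form of type
`(3, 0) + (0, 3)`. -/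
lemma complexStructure_unique {θ : W [⋀^Fin 3]→L[ℝ] ℝ} {κ : W [⋀^Fin 2]→L[ℝ] ℝ}
    (hne : ∀ v, v ≠ 0 → ∃ x y, θ ![v, x, y] ≠ 0) (J J' : W →ₗ[ℝ] W) (hJ : ∀ v, J (J v) = -v)
    (hJ' : ∀ v, J' (J' v) = -v) (hθ : ∀ x y z, θ ![J x, y, z] = θ ![x, J y, z])
    (hθ' : ∀ x y z, θ ![J' x, y, z] = θ ![x, J' y, z]) (hκ : ∀ v, v ≠ 0 → 0 < κ ![v, J v])
    (hκ' : ∀ v, v ≠ 0 → 0 < κ ![v, J' v]) : J = J' := by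
  have k (x y z : W) : θ ![x, J y, z] = θ ![x, y, J z] := by
    rw [← hθ, alt3_swap12, hθ, alt3_swap12, neg_neg]
  have k' (x y z : W) : θ ![x, J' y, z] = θ ![x, y, J' z] := by
    rw [← hθ', alt3_swap12, hθ', alt3_swap12, neg_neg]
  have hcomm (v : W) : J (J' v) = J' (J v) := by
    by_contra hn
    obtain ⟨x, y, h⟩ := hne _ (sub_ne_zero.2 hn)
    refine h ?_
    have e1 : θ ![J (J' v), x, y] = θ ![v, J x, J' y] := by rw [hθ, hθ', k']
    have e2 : θ ![J' (J v), x, y] = θ ![v, J x, J' y] := by rw [hθ', k', hθ]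
    rw [sub_eq_add_neg, alt3_add, alt3_neg, e1, e2]
    ring
  have hinj (v : W) (h : J (J' v) = v) : v = 0 := by
    by_contra hv
    have h1 : J v = - J' v := by
      have := congrArg J h
      rw [hJ] at this
      exact this.symm
    have h2 := hκ v hv
    rw [h1, alt2_neg_right] at h2
    linarith [hκ' v hv]
  refine LinearMap.ext fun v => ?_
  have h1 : J (J' (v + J (J' v))) = v + J (J' v) := by
    rw [map_add, map_add, ← hcomm (J' v), hJ, hJ', neg_neg, add_comm]
  have h2 := hinj _ h1
  have h3 : J' (J v) = -v := by
    rw [← hcomm]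
    exact (neg_eq_of_add_eq_zero_right h2).symm
  have h4 := congrArg J' h3
  rw [hJ', map_neg] at h4
  exact neg_injective h4

end ComplexType

section Adapted

variable {W : Type*} [AddCommGroup W] [Module ℝ W]

lemma eq_zero_of_orthogonal {n : ℕ} [FiniteDimensional ℝ W] (hW : Module.finrank ℝ W = n)
    (g : W →ₗ[ℝ] W →ₗ[ℝ] ℝ) (hs : ∀ v w, g v w = g w v) (hp : ∀ v, v ≠ 0 → 0 < g v v)
    (e : Fin n → W) (he : ∀ i, e i ≠ 0) (ho : ∀ i j, i < j → g (e i) (e j) = 0) {x : W}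
    (hx : ∀ i, g x (e i) = 0) : x = 0 := by
  by_contra hx0
  have h1 : LinearIndependent ℝ (Fin.cons x e : Fin (n + 1) → W) := by
    refine LinearMap.linearIndependent_of_isOrthoᵢ (B := g) ?_ ?_
    · intro i j
      refine Fin.cases (Fin.cases ?_ (fun j => ?_) j) (fun i => Fin.cases ?_ (fun j => ?_) j) i
      · intro h; exact absurd rfl h
      · intro _; exact hx j
      · intro _; exact (hs _ _).trans (hx i)
      · intro h
        have hij : i ≠ j := fun h' => h (by rw [h'])
        rcases lt_or_gt_of_ne hij with h | h
        · exact ho i j h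
        · exact (hs _ _).trans (ho j i h)
    · intro i
      refine Fin.cases ?_ (fun i => ?_) i
      · exact (hp x hx0).ne'
      · exact (hp _ (he i)).ne'
  have h2 := h1.fintype_card_le_finrank
  simp [hW] at h2

/-- A basis adapted to `D = ∇_u J` of the orthogonal complement of `u` and `J u`. -/
lemma exists_adapted_basis [FiniteDimensional ℝ W] (hW : Module.finrank ℝ W = 6)
    (g : W →ₗ[ℝ] W →ₗ[ℝ] ℝ) (hs : ∀ v w, g v w = g w v) (hp : ∀ v, v ≠ 0 → 0 < g v v)
    (J : W →ₗ[ℝ] W) (hJ : ∀ v, J (J v) = -v) (hgJ : ∀ v w, g (J v) w = - g v (J w))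
    (D : W →ₗ[ℝ] W) (hD : ∀ v w, g (D v) w = - g v (D w)) (hDJ : ∀ v, D (J v) = - J (D v))
    {u : W} (hu : g u u = 1) (hDu : D u = 0) (hne : ∃ v, D v ≠ 0) :
    ∃ (v₁ v₂ : W) (lam n : ℝ), 0 < lam ∧ 0 < n ∧ D v₁ = v₂ ∧ D v₂ = -lam • v₁ ∧
      g u v₁ = 0 ∧ g (J u) v₁ = 0 ∧ g u v₂ = 0 ∧ g (J u) v₂ = 0 ∧
      g v₁ v₁ = n ∧ g v₂ v₂ = lam * n ∧ g v₁ v₂ = 0 ∧ g v₁ (J v₂) = 0 := by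
  have hDJu : D (J u) = 0 := by rw [hDJ, hDu, map_zero, neg_zero]
  have hJJ (v : W) : g v (J v) = 0 := by linarith [hgJ v v, hs (J v) v]
  have hJJ2 (v w : W) : g (J v) (J w) = g v w := by rw [hgJ, hJ, map_neg, neg_neg]
  have hDD (v : W) : g v (D v) = 0 := by linarith [hD v v, hs (D v) v]
  have hJD (v : W) : g v (J (D v)) = 0 := by
    have h1 := hgJ v (D v)
    have h2 := hD (J v) v
    rw [hDJ, map_neg, LinearMap.neg_apply] at h2
    linarith [hs v (J (D v))]
  obtain ⟨v, hv⟩ := hne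
  set v₁ := v - g u v • u - g (J u) v • J u with hv₁
  have hDv : D v₁ = D v := by simp [hv₁, hDu, hDJu]
  have hv0 : v₁ ≠ 0 := fun h => hv (by rw [← hDv, h, map_zero])
  have o1 : g u v₁ = 0 := by
    simp only [hv₁, map_sub, map_smul, smul_eq_mul, hu, hJJ]; ring
  have o2 : g (J u) v₁ = 0 := by
    simp only [hv₁, map_sub, map_smul, smul_eq_mul, hJJ2, hu, hs (J u) u, hJJ]; ring
  have hv20 : D v₁ ≠ 0 := by rwa [hDv]
  have o3 : g u (D v₁) = 0 := by
    have := hD u v₁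
    rw [hDu, map_zero, LinearMap.zero_apply] at this
    linarith
  have o4 : g (J u) (D v₁) = 0 := by
    have := hD (J u) v₁
    rw [hDJu, map_zero, LinearMap.zero_apply] at this
    linarith
  have hn := hp v₁ hv0
  have hm := hp _ hv20
  set lam := g (D v₁) (D v₁) / g v₁ v₁ with hlam
  have hlam' : lam * g v₁ v₁ = g (D v₁) (D v₁) := by rw [hlam]; field_simp
  have hJ0 (x : W) (hx : x ≠ 0) : J x ≠ 0 := fun h => hx (by
    have := hJ x
    rw [h, map_zero] at this
    exact neg_eq_zero.1 this.symm)
  have hu0 : u ≠ 0 := fun h => by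
    rw [h, map_zero] at hu
    exact zero_ne_one hu
  have sJ1 (x y : W) (h : g (J x) y = 0) : g x (J y) = 0 := by linarith [hgJ x y]
  have key : D (D v₁) + lam • v₁ = 0 := by
    refine eq_zero_of_orthogonal hW g hs hp ![u, J u, v₁, J v₁, D v₁, J (D v₁)] ?_ ?_ ?_
    · intro i
      fin_cases i
      exacts [hu0, hJ0 _ hu0, hv0, hJ0 _ hv0, hv20, hJ0 _ hv20]
    · have hl : ∀ i j : Fin 6, i < j → (i, j) ∈ [((0 : Fin 6), (1 : Fin 6)), (0, 2), (0, 3), (0, 4),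
          (0, 5), (1, 2), (1, 3), (1, 4), (1, 5), (2, 3), (2, 4), (2, 5), (3, 4), (3, 5),
          (4, 5)] := by decide
      intro i j hij
      have h1 := hl i j hij
      simp only [List.mem_cons, Prod.mk.injEq, List.not_mem_nil, or_false] at h1
      rcases h1 with ⟨rfl, rfl⟩ | ⟨rfl, rfl⟩ | ⟨rfl, rfl⟩ | ⟨rfl, rfl⟩ | ⟨rfl, rfl⟩ | ⟨rfl, rfl⟩ |
        ⟨rfl, rfl⟩ | ⟨rfl, rfl⟩ | ⟨rfl, rfl⟩ | ⟨rfl, rfl⟩ | ⟨rfl, rfl⟩ | ⟨rfl, rfl⟩ | ⟨rfl, rfl⟩ |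
        ⟨rfl, rfl⟩ | ⟨rfl, rfl⟩
      · exact hJJ u
      · exact o1
      · exact sJ1 _ _ o2
      · exact o3
      · exact sJ1 _ _ o4
      · exact o2
      · exact (hJJ2 _ _).trans o1
      · exact o4
      · exact (hJJ2 _ _).trans o3
      · exact hJJ v₁
      · exact hDD v₁
      · exact hJD v₁
      · exact (hgJ v₁ (D v₁)).trans (by rw [hJD, neg_zero])
      · exact (hJJ2 _ _).trans (hDD v₁)
      · exact hJJ (D v₁)
    · have a0 (y : W) : g (D (D v₁) + lam • v₁) y = lam * g v₁ y - g (D v₁) (D y) := by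
        rw [map_add, map_smul, LinearMap.add_apply, LinearMap.smul_apply, hD (D v₁) y, smul_eq_mul]
        ring
      have b1 : g (D v₁) (D (D v₁)) = 0 := hDD (D v₁)
      have b2 : g (D v₁) (J (D (D v₁))) = 0 := hJD (D v₁)
      intro i
      rw [a0]
      fin_cases i
      · change lam * g v₁ u - g (D v₁) (D u) = 0
        rw [hDu, hs v₁, o1]; simp
      · change lam * g v₁ (J u) - g (D v₁) (D (J u)) = 0
        rw [hDJu, hs v₁, o2]; simp
      · change lam * g v₁ v₁ - g (D v₁) (D v₁) = 0
        rw [hlam']; ring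
      · change lam * g v₁ (J v₁) - g (D v₁) (D (J v₁)) = 0
        rw [hDJ, hJJ, map_neg, hJJ]; ring
      · change lam * g v₁ (D v₁) - g (D v₁) (D (D v₁)) = 0
        rw [hDD, b1]; ring
      · change lam * g v₁ (J (D v₁)) - g (D v₁) (D (J (D v₁))) = 0
        rw [hDJ, hJD, map_neg, b2]; ring
  refine ⟨v₁, D v₁, lam, g v₁ v₁, div_pos hm hn, hn, rfl, ?_, o1, o2, o3, o4, rfl, hlam'.symm,
    hDD v₁, hJD v₁⟩
  rw [neg_smul]
  exact eq_neg_of_add_eq_zero_left key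

end Adapted

section Ambient

@[simp] lemma re_imQ (x y z : ℝ) : ((imQ x y z : imH) : ℍ[ℝ]).re = 0 := rfl
@[simp] lemma imI_imQ (x y z : ℝ) : ((imQ x y z : imH) : ℍ[ℝ]).imI = x := rfl
@[simp] lemma imJ_imQ (x y z : ℝ) : ((imQ x y z : imH) : ℍ[ℝ]).imJ = y := rfl
@[simp] lemma imK_imQ (x y z : ℝ) : ((imQ x y z : imH) : ℍ[ℝ]).imK = z := rfl
@[simp] lemma re_imH (X : imH) : (X : ℍ[ℝ]).re = 0 := X.2

lemma imH_ext {X Y : imH} (h1 : (X : ℍ[ℝ]).imI = (Y : ℍ[ℝ]).imI)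
    (h2 : (X : ℍ[ℝ]).imJ = (Y : ℍ[ℝ]).imJ) (h3 : (X : ℍ[ℝ]).imK = (Y : ℍ[ℝ]).imK) : X = Y := by
  apply Subtype.ext
  ext
  · simp
  · exact h1
  · exact h2
  · exact h3

/-- The model space of `TS3`. -/
abbrev ModelE : Type := EuclideanSpace ℝ (Fin 3) × imH

lemma finrank_modelE : Module.finrank ℝ ModelE = 6 := by
  have h1 : Module.finrank ℝ imH = 3 := by
    let e : imH ≃ₗ[ℝ] (Fin 3 → ℝ) :=
      { toFun := fun q => ![(q : ℍ[ℝ]).imI, (q : ℍ[ℝ]).imJ, (q : ℍ[ℝ]).imK]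
        map_add' := fun p q => by ext i; fin_cases i <;> simp
        map_smul' := fun r q => by ext i; fin_cases i <;> simp
        invFun := fun v => imQ (v 0) (v 1) (v 2)
        left_inv := fun q => by apply imH_ext <;> simp
        right_inv := fun v => by ext i; fin_cases i <;> simp }
    rw [e.finrank_eq]
    simp
  rw [Module.finrank_prod, h1]
  simp

/-- The imaginary part of a quaternion, as a continuous linear map. -/
def imPart : ℍ[ℝ] →L[ℝ] imH :=
  LinearMap.toContinuousLinearMap
    { toFun := fun q => imQ q.imI q.imJ q.imK
      map_add' := fun p q => by apply imH_ext <;> simp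
      map_smul' := fun r q => by apply imH_ext <;> simp }

lemma imPart_apply (q : ℍ[ℝ]) : imPart q = imQ q.imI q.imJ q.imK := rfl

lemma imPart_coe (q : imH) : imPart q = q := by
  apply imH_ext <;> simp [imPart_apply]

lemma coe_inv_SU2 (q : SU2) : ((q⁻¹ : SU2) : ℍ[ℝ]) = star (q : ℍ[ℝ]) := by
  have h : ‖(q : ℍ[ℝ])‖ = 1 := by simp
  have h1 : ((q⁻¹ : SU2) : ℍ[ℝ]) = (q : ℍ[ℝ])⁻¹ := rfl
  rw [h1, Quaternion.inv_def, Quaternion.normSq_eq_norm_mul_self, h]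
  simp

lemma norm_adj (q : SU2) (w : imH) : ‖adj q w‖ = ‖w‖ := by
  change ‖(q : ℍ[ℝ]) * w * ((q⁻¹ : SU2) : ℍ[ℝ])‖ = ‖(w : ℍ[ℝ])‖
  simp

/-- The derivative of the inclusion of the sphere. -/
def sphD (q : SU2) : EuclideanSpace ℝ (Fin 3) →L[ℝ] ℍ[ℝ] :=
  mfderiv (𝓡 3) 𝓘(ℝ, ℍ[ℝ]) (fun q : SU2 => (q : ℍ[ℝ])) q

lemma sphD_injective (q : SU2) : Function.Injective (sphD q) :=
  injective_mvfderiv_subtypeVal_sphere (E := ℍ[ℝ]) q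

/-- A tangent vector of `TS3` in the ambient space. -/
def ambD (p : TS3) : ModelE →L[ℝ] ℍ[ℝ] × imH :=
  ((sphD p.1).comp (ContinuousLinearMap.fst ℝ _ _)).prod (ContinuousLinearMap.snd ℝ _ _)

lemma ambD_apply (p : TS3) (u : ModelE) : ambD p u = (sphD p.1 u.1, u.2) := rfl

lemma ambD_injective (p : TS3) : Function.Injective (ambD p) := by
  intro u v h
  simp only [ambD_apply, Prod.mk.injEq] at h
  exact Prod.ext (sphD_injective _ h.1) h.2

variable {E' : Type*} [NormedAddCommGroup E'] [NormedSpace ℝ E']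
  {H' : Type*} [TopologicalSpace H'] {I' : ModelWithCorners ℝ E' H'}
  {N : Type*} [TopologicalSpace N] [ChartedSpace H' N]

lemma contMDiff_TS3 {n : WithTop ℕ∞} [IsManifold I' n N] {f : N → TS3}
    (h1 : ContMDiff I' 𝓘(ℝ, ℍ[ℝ]) n (fun x => ((f x).1 : ℍ[ℝ])))
    (h2 : ContMDiff I' 𝓘(ℝ, imH) n (fun x => (f x).2)) : ContMDiff I' modelTS3 n f :=
  (ContMDiff.codRestrict_sphere h1 (fun x => (f x).1.2)).prodMk h2

lemma contMDiff_coe_fst {n : WithTop ℕ∞} :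
    ContMDiff modelTS3 𝓘(ℝ, ℍ[ℝ]) n (fun p : TS3 => (p.1 : ℍ[ℝ])) :=
  contMDiff_coe_sphere.comp contMDiff_fst

lemma contMDiff_snd_TS3 {n : WithTop ℕ∞} :
    ContMDiff modelTS3 𝓘(ℝ, imH) n (fun p : TS3 => p.2) := contMDiff_snd

lemma mfderiv_coe_fst (p : TS3) (u : ModelE) :
    (mfderiv modelTS3 𝓘(ℝ, ℍ[ℝ]) (fun p : TS3 => (p.1 : ℍ[ℝ])) p : ModelE →L[ℝ] ℍ[ℝ]) u
      = sphD p.1 u.1 := by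
  have h := mfderiv_comp (I := modelTS3) (I' := 𝓡 3) (I'' := 𝓘(ℝ, ℍ[ℝ])) p
    (g := fun q : SU2 => (q : ℍ[ℝ])) (f := Prod.fst)
    ((contMDiff_coe_sphere (m := 1) p.1).mdifferentiableAt (by simp)) mdifferentiableAt_fst
  rw [mfderiv_fst] at h
  exact DFunLike.congr_fun h u

lemma ambD_mfderiv {f : N → TS3} {z : N} (hf : MDifferentiableAt I' modelTS3 f z) (v : E') :
    ambD (f z) ((mfderiv I' modelTS3 f z : E' →L[ℝ] ModelE) v)
      = ((mfderiv I' 𝓘(ℝ, ℍ[ℝ]) (fun z => ((f z).1 : ℍ[ℝ])) z : E' →L[ℝ] ℍ[ℝ]) v,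
        (mfderiv I' 𝓘(ℝ, imH) (fun z => (f z).2) z : E' →L[ℝ] imH) v) := by
  have h1 := mfderiv_comp z ((contMDiff_coe_fst (n := 1) (f z)).mdifferentiableAt (by simp)) hf
  have h2 := mfderiv_comp z ((contMDiff_snd_TS3 (n := 1) (f z)).mdifferentiableAt (by simp)) hf
  have h3 := DFunLike.congr_fun h1 v
  have h4 := DFunLike.congr_fun h2 v
  refine Prod.ext ?_ ?_
  · refine Eq.trans ?_ h3.symm
    exact (mfderiv_coe_fst (f z) _).symm
  · refine Eq.trans ?_ h4.symm
    have h5 := mfderiv_snd (I := 𝓡 3) (I' := 𝓘(ℝ, imH)) (x := f z)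
    exact (DFunLike.congr_fun h5 _).symm

variable {F : Type*} [NormedAddCommGroup F] [NormedSpace ℝ F]

lemma ambD_mfderiv_of_hasFDerivAt {f : F → TS3} {z : F}
    (hf : MDifferentiableAt 𝓘(ℝ, F) modelTS3 f z) {f₁ : F →L[ℝ] ℍ[ℝ]} {f₂ : F →L[ℝ] imH}
    (h1 : HasFDerivAt (fun z => ((f z).1 : ℍ[ℝ])) f₁ z) (h2 : HasFDerivAt (fun z => (f z).2) f₂ z)
    (v : F) : ambD (f z) ((mfderiv 𝓘(ℝ, F) modelTS3 f z : F →L[ℝ] ModelE) v) = (f₁ v, f₂ v) := by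
  refine (ambD_mfderiv hf v).trans ?_
  rw [mfderiv_eq_fderiv, mfderiv_eq_fderiv, h1.fderiv, h2.fderiv]
  rfl

/-- Conjugation by quaternions, as a continuous linear map. -/
def mulLR (a b : ℍ[ℝ]) : ℍ[ℝ] →L[ℝ] ℍ[ℝ] :=
  (ContinuousLinearMap.mul ℝ ℍ[ℝ] a).comp ((ContinuousLinearMap.mul ℝ ℍ[ℝ]).flip b)

lemma mulLR_apply (a b x : ℍ[ℝ]) : mulLR a b x = a * x * b := (mul_assoc a x b).symm

/-- The adjoint action, as a continuous linear map. -/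
def adjL (q : SU2) : imH →L[ℝ] imH :=
  imPart.comp ((mulLR q ((q⁻¹ : SU2) : ℍ[ℝ])).comp imH.subtypeL)

lemma adjL_apply (q : SU2) (w : imH) : adjL q w = adj q w := by
  have h : adjL q w = imPart (mulLR q ((q⁻¹ : SU2) : ℍ[ℝ]) w) := rfl
  rw [h, mulLR_apply]
  exact imPart_coe (adj q w)

lemma contMDiff_act (h : SU2 × SU2) : ContMDiff modelTS3 modelTS3 ∞ (act h) := by
  refine contMDiff_TS3 ?_ ?_
  · exact ((mulLR h.1 ((h.2⁻¹ : SU2) : ℍ[ℝ])).contMDiff.comp contMDiff_coe_fst).congr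
      fun p => (mulLR_apply _ _ _).symm
  · exact ((adjL h.2).contMDiff.comp contMDiff_snd_TS3).congr fun p => (adjL_apply _ _).symm

/-- The derivative of the action of `h`. -/
def actD (h : SU2 × SU2) (p : TS3) : ModelE →L[ℝ] ModelE := mfderiv modelTS3 modelTS3 (act h) p

lemma ambD_actD (h : SU2 × SU2) (p : TS3) (u : ModelE) :
    ambD (act h p) (actD h p u)
      = ((h.1 : ℍ[ℝ]) * (ambD p u).1 * ((h.2⁻¹ : SU2) : ℍ[ℝ]), adj h.2 (ambD p u).2) := by
  refine (ambD_mfderiv ((contMDiff_act h p).mdifferentiableAt (by simp)) u).trans ?_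
  refine Prod.ext ?_ ?_
  · have e : (fun z : TS3 => ((act h z).1 : ℍ[ℝ]))
        = mulLR h.1 ((h.2⁻¹ : SU2) : ℍ[ℝ]) ∘ fun p : TS3 => (p.1 : ℍ[ℝ]) :=
      funext fun p => (mulLR_apply _ _ _).symm
    have h1 := mfderiv_comp (I := modelTS3) (I' := 𝓘(ℝ, ℍ[ℝ])) (I'' := 𝓘(ℝ, ℍ[ℝ])) p
      (mulLR h.1 ((h.2⁻¹ : SU2) : ℍ[ℝ])).mdifferentiableAt
      ((contMDiff_coe_fst (n := 1) p).mdifferentiableAt (by simp))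
    rw [e, h1, ContinuousLinearMap.mfderiv_eq]
    exact (congrArg (mulLR _ _) (mfderiv_coe_fst p u)).trans (mulLR_apply _ _ _)
  · have e : (fun z : TS3 => (act h z).2) = adjL h.2 ∘ fun p : TS3 => p.2 :=
      funext fun p => (adjL_apply _ _).symm
    have h1 := mfderiv_comp (I := modelTS3) (I' := 𝓘(ℝ, imH)) (I'' := 𝓘(ℝ, imH)) p
      (adjL h.2).mdifferentiableAt ((contMDiff_snd_TS3 (n := 1) p).mdifferentiableAt (by simp))
    rw [e, h1, ContinuousLinearMap.mfderiv_eq]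
    have h5 := mfderiv_snd (I := 𝓡 3) (I' := 𝓘(ℝ, imH)) (x := p)
    exact (congrArg (adjL h.2) (DFunLike.congr_fun h5 u)).trans (adjL_apply _ _)

lemma contMDiff_gammaCurve : ContMDiff 𝓘(ℝ, ℝ) modelTS3 ∞ gammaCurve := by
  refine contMDiff_TS3 contMDiff_const ?_
  have : (fun t => (gammaCurve t).2) = fun t : ℝ => t • imQ 1 0 0 := by
    funext t
    apply imH_ext <;> simp [gammaCurve]
  rw [this]
  exact (contDiff_id.smul contDiff_const).contMDiff

lemma ambD_xiVec (t : ℝ) : ambD (gammaCurve t) (xiVec t) = (0, imQ 1 0 0) := by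
  have h := ambD_mfderiv_of_hasFDerivAt (f := gammaCurve) (z := t)
    ((contMDiff_gammaCurve t).mdifferentiableAt (by simp)) (f₁ := 0)
    (f₂ := ContinuousLinearMap.toSpanSingleton ℝ (imQ 1 0 0)) (hasFDerivAt_const _ _) ?_ 1
  · refine h.trans ?_
    simp
  · have : (fun t => (gammaCurve t).2) = fun t : ℝ => t • imQ 1 0 0 := by
      funext t
      apply imH_ext <;> simp [gammaCurve]
    rw [this]
    exact ((hasDerivAt_id t).smul_const (imQ 1 0 0)).hasFDerivAt.congr_fderiv (by ext <;> simp)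

lemma contDiff_exp_smul (X : ℍ[ℝ]) : ContDiff ℝ ∞ fun s : ℝ => NormedSpace.exp (s • X) := by
  have h : ContDiff ℝ ∞ (NormedSpace.exp : ℍ[ℝ] → ℍ[ℝ]) :=
    contDiff_iff_contDiffAt.2 fun x => (NormedSpace.exp_analytic (𝕂 := ℝ) x).contDiffAt
  exact h.comp (contDiff_id.smul contDiff_const)

lemma coe_inv_expSU2 (X : imH) (s : ℝ) :
    (((expSU2 (s • X))⁻¹ : SU2) : ℍ[ℝ]) = NormedSpace.exp (s • (-X : ℍ[ℝ])) := by
  rw [coe_inv_SU2]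
  change star (NormedSpace.exp ((s • X : imH) : ℍ[ℝ])) = _
  rw [NormedSpace.star_exp]
  congr 1
  ext <;> simp

lemma ambD_hatVec (X : imH × imH) (p : TS3) : ambD p (hatVec X p)
    = ((X.1 : ℍ[ℝ]) * p.1 - p.1 * X.2, imPart ((X.2 : ℍ[ℝ]) * p.2 - p.2 * X.2)) := by
  set f : ℝ → TS3 := fun s => act (expSU2 (s • X.1), expSU2 (s • X.2)) p with hf
  have hE (Y : imH) : ContDiff ℝ ∞ (fun s : ℝ => ((expSU2 (s • Y) : SU2) : ℍ[ℝ])) :=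
    contDiff_exp_smul (Y : ℍ[ℝ])
  have hE' (Y : imH) : ContDiff ℝ ∞ (fun s : ℝ => (((expSU2 (s • Y))⁻¹ : SU2) : ℍ[ℝ])) := by
    simp only [coe_inv_expSU2]
    exact contDiff_exp_smul (-Y : ℍ[ℝ])
  have hd (Y : imH) : HasDerivAt (fun s : ℝ => ((expSU2 (s • Y) : SU2) : ℍ[ℝ])) (Y : ℍ[ℝ]) 0 := by
    have := hasDerivAt_exp_smul_const (𝕂 := ℝ) (Y : ℍ[ℝ]) 0
    simp only [zero_smul, NormedSpace.exp_zero, one_mul] at this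
    exact this
  have hd' (Y : imH) :
      HasDerivAt (fun s : ℝ => (((expSU2 (s • Y))⁻¹ : SU2) : ℍ[ℝ])) (-Y : ℍ[ℝ]) 0 := by
    have := hasDerivAt_exp_smul_const (𝕂 := ℝ) (-Y : ℍ[ℝ]) 0
    simp only [coe_inv_expSU2]
    simpa using this
  have h0 (Y : imH) : ((expSU2 ((0 : ℝ) • Y) : SU2) : ℍ[ℝ]) = 1 := by
    change NormedSpace.exp (((0 : ℝ) • Y : imH) : ℍ[ℝ]) = 1
    simp
  have h0' (Y : imH) : (((expSU2 ((0 : ℝ) • Y))⁻¹ : SU2) : ℍ[ℝ]) = 1 := by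
    rw [coe_inv_expSU2]
    simp
  have e1 : (fun s => ((f s).1 : ℍ[ℝ])) = fun s => ((expSU2 (s • X.1) : SU2) : ℍ[ℝ]) * p.1
      * (((expSU2 (s • X.2))⁻¹ : SU2) : ℍ[ℝ]) := rfl
  have e2 : (fun s => (f s).2) = fun s => imPart (((expSU2 (s • X.2) : SU2) : ℍ[ℝ]) * p.2
      * (((expSU2 (s • X.2))⁻¹ : SU2) : ℍ[ℝ])) := by
    funext s
    exact (imPart_coe _).symm
  have hs : ContMDiff 𝓘(ℝ, ℝ) modelTS3 ∞ f := by
    refine contMDiff_TS3 ?_ ?_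
    · rw [e1]
      exact (((hE X.1).mul contDiff_const).mul (hE' X.2)).contMDiff
    · rw [e2]
      exact (imPart.contDiff.comp (((hE X.2).mul contDiff_const).mul (hE' X.2))).contMDiff
  have d1 := ((hd X.1).mul_const (p.1 : ℍ[ℝ])).mul (hd' X.2)
  have d2 := imPart.hasFDerivAt.comp_hasDerivAt (0 : ℝ)
    (((hd X.2).mul_const (p.2 : ℍ[ℝ])).mul (hd' X.2))
  simp only [h0, h0', one_mul, mul_one] at d1 d2
  have h := ambD_mfderiv_of_hasFDerivAt (f := f) (z := 0) ((hs 0).mdifferentiableAt (by simp))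
    (by rw [e1]; exact d1.hasFDerivAt) (by rw [e2]; exact d2.hasFDerivAt) 1
  have hp : f 0 = p := by
    have h1 (Y : imH) : expSU2 ((0 : ℝ) • Y) = 1 := Subtype.ext (h0 Y)
    simp only [hf, h1]
    exact act_one p
  have h2 : ambD (f 0) ((mfderiv 𝓘(ℝ, ℝ) modelTS3 f 0 : ℝ →L[ℝ] ModelE) 1)
      = ambD p (hatVec X p) := by
    rw [hp]
    rfl
  refine h2.symm.trans (h.trans ?_)
  simp [sub_eq_add_neg]

end Ambient

section Parametrisation

/-- The first coordinate of `su₂`. -/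
def cI : imH →L[ℝ] ℝ := LinearMap.toContinuousLinearMap
  { toFun := fun q => (q : ℍ[ℝ]).imI, map_add' := fun _ _ => by simp, map_smul' := fun _ _ => by simp }

/-- The second coordinate of `su₂`. -/
def cJ : imH →L[ℝ] ℝ := LinearMap.toContinuousLinearMap
  { toFun := fun q => (q : ℍ[ℝ]).imJ, map_add' := fun _ _ => by simp, map_smul' := fun _ _ => by simp }

/-- The third coordinate of `su₂`. -/
def cK : imH →L[ℝ] ℝ := LinearMap.toContinuousLinearMap
  { toFun := fun q => (q : ℍ[ℝ]).imK, map_add' := fun _ _ => by simp, map_smul' := fun _ _ => by simp }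

lemma cI_apply (X : imH) : cI X = (X : ℍ[ℝ]).imI := rfl
lemma cJ_apply (X : imH) : cJ X = (X : ℍ[ℝ]).imJ := rfl
lemma cK_apply (X : imH) : cK X = (X : ℍ[ℝ]).imK := rfl

/-- The square norm of `1 + X`. -/
def nsq (X : imH) : ℝ := 1 + cI X ^ 2 + cJ X ^ 2 + cK X ^ 2

lemma nsq_pos (X : imH) : 0 < nsq X := by unfold nsq; positivity

lemma contDiff_nsq : ContDiff ℝ ∞ nsq := by
  unfold nsq
  fun_prop

/-- A local parametrisation of `SU₂`. -/
def sig (X : imH) : SU2 := ⟨(√(nsq X))⁻¹ • (1 + (X : ℍ[ℝ])), by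
  have h : ‖(1 + (X : ℍ[ℝ]))‖ = √(nsq X) := by
    rw [← Real.sqrt_mul_self (norm_nonneg (1 + (X : ℍ[ℝ]))), ← Quaternion.normSq_eq_norm_mul_self,
      Quaternion.normSq_def']
    congr 1
    simp [nsq, cI_apply, cJ_apply, cK_apply]
  have h0 : 0 < √(nsq X) := Real.sqrt_pos.2 (nsq_pos X)
  rw [mem_sphere_zero_iff_norm, norm_smul, h, norm_inv, Real.norm_of_nonneg h0.le,
    inv_mul_cancel₀ h0.ne']⟩

lemma coe_sig (X : imH) : ((sig X : SU2) : ℍ[ℝ]) = (√(nsq X))⁻¹ • (1 + (X : ℍ[ℝ])) := rfl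

lemma sig_zero : sig 0 = 1 := by
  apply Subtype.ext
  rw [coe_sig]
  simp [nsq]

lemma contDiff_sig : ContDiff ℝ ∞ (fun X : imH => ((sig X : SU2) : ℍ[ℝ])) := by
  simp only [coe_sig]
  refine ContDiff.smul (ContDiff.inv (contDiff_nsq.sqrt fun X => (nsq_pos X).ne')
    fun X => (Real.sqrt_pos.2 (nsq_pos X)).ne') ?_
  exact contDiff_const.add imH.subtypeL.contDiff

/-- The Maurer-Cartan form in the parametrisation `sig`. -/
def mc (X : imH) : imH →L[ℝ] imH := LinearMap.toContinuousLinearMap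
  { toFun := fun v => (nsq X)⁻¹ • imQ (cI v - (cJ X * cK v - cK X * cJ v))
      (cJ v - (cK X * cI v - cI X * cK v)) (cK v - (cI X * cJ v - cJ X * cI v))
    map_add' := fun v w => by
      rw [← smul_add]
      congr 1
      apply imH_ext <;> simp <;> ring
    map_smul' := fun r v => by
      rw [RingHom.id_apply, smul_comm r]
      congr 1
      apply imH_ext <;> simp <;> ring }

lemma mc_apply (X v : imH) : mc X v
    = (nsq X)⁻¹ • imQ (cI v - (cJ X * cK v - cK X * cJ v))
      (cJ v - (cK X * cI v - cI X * cK v)) (cK v - (cI X * cJ v - cJ X * cI v)) := rfl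

lemma hasFDerivAt_sig (X : imH) : HasFDerivAt (fun X : imH => ((sig X : SU2) : ℍ[ℝ]))
    (((mulLR (sig X) 1).comp imH.subtypeL).comp (mc X)) X := by
  have hn : HasFDerivAt nsq (((2 * cI X) • cI) + ((2 * cJ X) • cJ) + ((2 * cK X) • cK)) X := by
    unfold nsq
    have h1 := (cI.hasFDerivAt (x := X)).pow 2
    have h2 := (cJ.hasFDerivAt (x := X)).pow 2
    have h3 := (cK.hasFDerivAt (x := X)).pow 2
    refine (((h1.const_add 1).add h2).add h3).congr_fderiv ?_
    ext v
    simp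
  have h0 := nsq_pos X
  have hs : 0 < √(nsq X) := Real.sqrt_pos.2 h0
  have hsq : √(nsq X) * √(nsq X) = nsq X := Real.mul_self_sqrt h0.le
  have hr := ((hasDerivAt_inv hs.ne').comp_hasFDerivAt X (hn.sqrt h0.ne')).smul
    ((imH.subtypeL.hasFDerivAt (x := X)).const_add (1 : ℍ[ℝ]))
  refine hr.congr_fderiv ?_
  refine ContinuousLinearMap.ext fun v => ?_
  have lhs : (((mulLR (sig X) 1).comp imH.subtypeL).comp (mc X)) v
      = ((√(nsq X))⁻¹ • (1 + (X : ℍ[ℝ]))) * ((mc X v : imH) : ℍ[ℝ]) := by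
    refine (mulLR_apply _ _ _).trans ?_
    rw [mul_one]
    rfl
  have hN' : √(nsq X) * √(nsq X)
      = 1 + (X : ℍ[ℝ]).imI ^ 2 + (X : ℍ[ℝ]).imJ ^ 2 + (X : ℍ[ℝ]).imK ^ 2 := hsq
  rw [lhs, mc_apply]
  simp only [Function.comp_apply]
  clear lhs hr hn
  generalize √(nsq X) = s at *
  rw [← hsq]
  have h2 : s ^ 2 = 1 + (X : ℍ[ℝ]).imI ^ 2 + (X : ℍ[ℝ]).imJ ^ 2 + (X : ℍ[ℝ]).imK ^ 2 := by
    rw [pow_two, hN']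
  have hs0 := hs.ne'
  ext
  all_goals
    simp only [cI_apply, cJ_apply, cK_apply, _root_.add_apply, _root_.smul_apply,
      ContinuousLinearMap.smulRight_apply, Submodule.subtypeL_apply, Quaternion.re_add,
      Quaternion.imI_add, Quaternion.imJ_add, Quaternion.imK_add, Quaternion.re_smul,
      Quaternion.imI_smul, Quaternion.imJ_smul, Quaternion.imK_smul, Quaternion.re_mul,
      Quaternion.imI_mul, Quaternion.imJ_mul, Quaternion.imK_mul, smul_eq_mul,
      Submodule.coe_smul, imI_imQ, imJ_imQ, imK_imQ, re_imH, Quaternion.re_one,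
      Quaternion.imI_one, Quaternion.imJ_one, Quaternion.imK_one]
    field_simp
    try rw [h2]
    try ring

/-- The parametrisation of a neighbourhood of `γ_t` by a slice and the group. -/
def orbitMap (z : ℝ × imH × imH) : TS3 := act (sig z.2.1, sig z.2.2) (gammaCurve z.1)

/-- The components in the frame along `γ` of the derivative of `orbitMap`. -/
def orbitCoef (z v : ℝ × imH × imH) : Fin 6 → ℝ :=
  ![v.1, cI (mc z.2.1 v.2.1) - cI (mc z.2.2 v.2.2), 2 * √2 * cJ (mc z.2.1 v.2.1),
    2 * √2 * cK (mc z.2.1 v.2.1), 2 * √2 * cJ (mc z.2.2 v.2.2), 2 * √2 * cK (mc z.2.2 v.2.2)]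

/-- The frame along `γ`, in the model space. -/
def frameE (t : ℝ) (i : Fin 6) : ModelE := frame t i

/-- The vector with components `c` in the frame along `γ`. -/
def frameVec (t : ℝ) (c : Fin 6 → ℝ) : ModelE := ∑ i, c i • frameE t i

lemma ambD_frameVec (t : ℝ) (c : Fin 6 → ℝ) : ambD (gammaCurve t) (frameVec t c)
    = (((imQ (c 1) ((2 * √2)⁻¹ * (c 2 - c 4)) ((2 * √2)⁻¹ * (c 3 - c 5)) : imH) : ℍ[ℝ]),
      imQ (c 0) (2 * t * (2 * √2)⁻¹ * c 5) (- (2 * t * (2 * √2)⁻¹ * c 4))) := by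
  have h0 : ambD (gammaCurve t) (frameE t 0) = (0, imQ 1 0 0) := ambD_xiVec t
  have h1 : ambD (gammaCurve t) (frameE t 1) = _ := ambD_hatVec (elemH, -elemH) _
  have h2 : ambD (gammaCurve t) (frameE t 2) = _ := ambD_hatVec (elemE, 0) _
  have h3 : ambD (gammaCurve t) (frameE t 3) = _ := ambD_hatVec (elemV, 0) _
  have h4 : ambD (gammaCurve t) (frameE t 4) = _ := ambD_hatVec (0, elemE) _
  have h5 : ambD (gammaCurve t) (frameE t 5) = _ := ambD_hatVec (0, elemV) _
  have e1 : ((gammaCurve t).1 : ℍ[ℝ]) = 1 := rfl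
  have e2 : (gammaCurve t).2 = imQ t 0 0 := rfl
  rw [frameVec, Fin.sum_univ_six]
  simp only [map_add, map_smul]
  rw [h0, h1, h2, h3, h4, h5, e1, e2]
  refine Prod.ext ?_ ?_
  · ext <;> simp [elemH, elemE, elemV] <;> ring
  · apply imH_ext <;> simp [elemH, elemE, elemV, imPart_apply] <;> ring

lemma frameVec_injective {t : ℝ} (ht : t ≠ 0) : Function.Injective (frameVec t) := by
  intro c d h
  have h1 := congrArg (ambD (gammaCurve t)) h
  rw [ambD_frameVec, ambD_frameVec] at h1
  have hs : (2 * √2)⁻¹ ≠ 0 := by positivity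
  have a1 := congrArg (fun q : ℍ[ℝ] × imH => q.1.imI) h1
  have a2 := congrArg (fun q : ℍ[ℝ] × imH => q.1.imJ) h1
  have a3 := congrArg (fun q : ℍ[ℝ] × imH => q.1.imK) h1
  have a0 := congrArg (fun q : ℍ[ℝ] × imH => (q.2 : ℍ[ℝ]).imI) h1
  have a5 := congrArg (fun q : ℍ[ℝ] × imH => (q.2 : ℍ[ℝ]).imJ) h1
  have a4 := congrArg (fun q : ℍ[ℝ] × imH => (q.2 : ℍ[ℝ]).imK) h1
  simp only [imI_imQ, imJ_imQ, imK_imQ] at a0 a1 a2 a3 a4 a5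
  have h2t : 2 * t * (2 * √2)⁻¹ ≠ 0 := mul_ne_zero (by positivity) hs
  have b5 := mul_left_cancel₀ h2t a5
  have b4 := mul_left_cancel₀ h2t (neg_injective a4)
  have b2 := mul_left_cancel₀ hs a2
  have b3 := mul_left_cancel₀ hs a3
  funext i
  fin_cases i
  · exact a0
  · exact a1
  · change c 2 = d 2
    linarith
  · change c 3 = d 3
    linarith
  · exact b4
  · exact b5

lemma coe_inv_sig (X : imH) : (((sig X)⁻¹ : SU2) : ℍ[ℝ]) = star ((sig X : SU2) : ℍ[ℝ]) :=
  coe_inv_SU2 _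

/-- Quaternionic conjugation, as a continuous linear map. -/
def starCLM : ℍ[ℝ] →L[ℝ] ℍ[ℝ] := LinearMap.toContinuousLinearMap
  { toFun := fun q => star q, map_add' := fun _ _ => star_add _ _, map_smul' := fun _ _ => by simp }

lemma orbitMap_fst (z : ℝ × imH × imH) : ((orbitMap z).1 : ℍ[ℝ])
    = (sig z.2.1 : ℍ[ℝ]) * starCLM (sig z.2.2 : ℍ[ℝ]) := by
  change (sig z.2.1 : ℍ[ℝ]) * ((1 : SU2) : ℍ[ℝ]) * (((sig z.2.2)⁻¹ : SU2) : ℍ[ℝ]) = _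
  rw [coe_inv_sig]
  simp [starCLM]

lemma orbitMap_snd (z : ℝ × imH × imH) : (orbitMap z).2
    = imPart ((sig z.2.2 : ℍ[ℝ]) * (z.1 • (imQ 1 0 0 : ℍ[ℝ])) * starCLM (sig z.2.2 : ℍ[ℝ])) := by
  rw [← imPart_coe (orbitMap z).2]
  congr 1
  have h1 : (imQ z.1 0 0 : ℍ[ℝ]) = z.1 • (imQ 1 0 0 : ℍ[ℝ]) := by ext <;> simp
  change (sig z.2.2 : ℍ[ℝ]) * (imQ z.1 0 0 : ℍ[ℝ]) * (((sig z.2.2)⁻¹ : SU2) : ℍ[ℝ]) = _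
  rw [coe_inv_sig, h1]
  rfl

lemma contMDiff_orbitMap : ContMDiff 𝓘(ℝ, ℝ × imH × imH) modelTS3 ∞ orbitMap := by
  have hX : ContDiff ℝ ∞ fun z : ℝ × imH × imH => (sig z.2.1 : ℍ[ℝ]) :=
    contDiff_sig.comp (contDiff_fst.comp contDiff_snd)
  have hY : ContDiff ℝ ∞ fun z : ℝ × imH × imH => (sig z.2.2 : ℍ[ℝ]) :=
    contDiff_sig.comp (contDiff_snd.comp contDiff_snd)
  refine contMDiff_TS3 ?_ ?_
  · simp only [orbitMap_fst]
    exact (hX.mul (starCLM.contDiff.comp hY)).contMDiff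
  · simp only [orbitMap_snd]
    exact (imPart.contDiff.comp ((hY.mul (contDiff_fst.smul contDiff_const)).mul
      (starCLM.contDiff.comp hY))).contMDiff

lemma mfderiv_orbitMap (z v : ℝ × imH × imH) :
    (mfderiv 𝓘(ℝ, ℝ × imH × imH) modelTS3 orbitMap z : ℝ × imH × imH →L[ℝ] ModelE) v
      = actD (sig z.2.1, sig z.2.2) (gammaCurve z.1) (frameVec z.1 (orbitCoef z v)) := by
  let P₁ : ℝ × imH × imH →L[ℝ] imH := (ContinuousLinearMap.fst ℝ imH imH).comp (.snd ℝ ℝ _)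
  let P₂ : ℝ × imH × imH →L[ℝ] imH := (ContinuousLinearMap.snd ℝ imH imH).comp (.snd ℝ ℝ _)
  have hX : HasFDerivAt (fun z : ℝ × imH × imH => (sig z.2.1 : ℍ[ℝ])) _ z :=
    HasFDerivAt.comp (g := fun X : imH => ((sig X : SU2) : ℍ[ℝ])) (f := P₁) z
      (hasFDerivAt_sig _) P₁.hasFDerivAt
  have hY : HasFDerivAt (fun z : ℝ × imH × imH => (sig z.2.2 : ℍ[ℝ])) _ z :=
    HasFDerivAt.comp (g := fun X : imH => ((sig X : SU2) : ℍ[ℝ])) (f := P₂) z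
      (hasFDerivAt_sig _) P₂.hasFDerivAt
  have hY' : HasFDerivAt (fun z : ℝ × imH × imH => starCLM (sig z.2.2 : ℍ[ℝ])) _ z :=
    starCLM.hasFDerivAt.comp z hY
  have ht : HasFDerivAt (fun z : ℝ × imH × imH => z.1 • (imQ 1 0 0 : ℍ[ℝ])) _ z :=
    (hasFDerivAt_fst (𝕜 := ℝ)).smul_const (imQ 1 0 0 : ℍ[ℝ])
  have h := ambD_mfderiv_of_hasFDerivAt (f := orbitMap) (z := z)
    ((contMDiff_orbitMap z).mdifferentiableAt (by simp))
    (by simp only [orbitMap_fst]; exact hX.mul' hY')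
    (by simp only [orbitMap_snd]; exact imPart.hasFDerivAt.comp z ((hY.mul' ht).mul' hY')) v
  refine ambD_injective _ (h.trans ?_)
  refine Eq.trans ?_ (ambD_actD (sig z.2.1, sig z.2.2) (gammaCurve z.1) _).symm
  rw [ambD_frameVec]
  obtain ⟨t, X, Y⟩ := z
  obtain ⟨τ, v, w⟩ := v
  set m₁ := mc X v with hm1
  set m₂ := mc Y w with hm2
  have hst : star (m₂ : ℍ[ℝ]) = - (m₂ : ℍ[ℝ]) := by ext <;> simp
  have hs : (2 * √2)⁻¹ * (2 * √2) = 1 := inv_mul_cancel₀ (by positivity)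
  have e1 : ((imQ (orbitCoef (t, X, Y) (τ, v, w) 1)
      ((2 * √2)⁻¹ * (orbitCoef (t, X, Y) (τ, v, w) 2 - orbitCoef (t, X, Y) (τ, v, w) 4))
      ((2 * √2)⁻¹ * (orbitCoef (t, X, Y) (τ, v, w) 3 - orbitCoef (t, X, Y) (τ, v, w) 5)) : imH)
        : ℍ[ℝ]) = m₁ - m₂ := by
    have q (x y : ℝ) : (2 * √2)⁻¹ * (2 * √2 * x - 2 * √2 * y) = x - y := by
      rw [← mul_sub, ← mul_assoc, hs, one_mul]
    ext <;> simp [-mul_inv_rev, orbitCoef, q, cI_apply, cJ_apply, cK_apply, ← hm1, ← hm2]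
  have e2 : (imQ (orbitCoef (t, X, Y) (τ, v, w) 0)
      (2 * t * (2 * √2)⁻¹ * orbitCoef (t, X, Y) (τ, v, w) 5)
      (- (2 * t * (2 * √2)⁻¹ * orbitCoef (t, X, Y) (τ, v, w) 4)) : ℍ[ℝ])
        = τ • (imQ 1 0 0 : ℍ[ℝ]) + (m₂ * (t • (imQ 1 0 0 : ℍ[ℝ])) - (t • (imQ 1 0 0 : ℍ[ℝ])) * m₂) := by
    have q (x : ℝ) : 2 * t * (2 * √2)⁻¹ * (2 * √2 * x) = 2 * t * x := by
      rw [mul_assoc (2 * t), ← mul_assoc (2 * √2)⁻¹, hs, one_mul]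
    ext <;> simp [-mul_inv_rev, orbitCoef, q, cI_apply, cJ_apply, cK_apply, ← hm2] <;> ring
  rw [e1, coe_inv_sig]
  refine Prod.ext ?_ ?_
  · change (sig X : ℍ[ℝ]) * star (mulLR (sig Y) 1 m₂) + mulLR (sig X) 1 m₁ * star (sig Y : ℍ[ℝ])
      = (sig X : ℍ[ℝ]) * (m₁ - m₂) * star (sig Y : ℍ[ℝ])
    rw [mulLR_apply, mulLR_apply, mul_one, mul_one, star_mul, hst]
    noncomm_ring
  · rw [← adjL_apply]
    have hadj (q : ℍ[ℝ]) (u : imH) (hu : (u : ℍ[ℝ]) = q) : adjL (sig Y) u = imPart ((sig Y : ℍ[ℝ]) * q * star (sig Y : ℍ[ℝ])) := by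
      rw [← hu, ← coe_inv_sig, ← mulLR_apply]
      rfl
    rw [hadj _ _ e2]
    change imPart ((sig Y : ℍ[ℝ]) * (t • (imQ 1 0 0 : ℍ[ℝ])) * star (mulLR (sig Y) 1 m₂)
      + ((sig Y : ℍ[ℝ]) * (τ • (imQ 1 0 0 : ℍ[ℝ])) + mulLR (sig Y) 1 m₂ * (t • (imQ 1 0 0 : ℍ[ℝ])))
        * star (sig Y : ℍ[ℝ])) = _
    rw [mulLR_apply, mul_one, star_mul, hst]
    congr 1
    noncomm_ring

end Parametrisation

section InvariantForms

lemma cons6_0 (a b c d e f : ℝ) : (![a, b, c, d, e, f] : Fin 6 → ℝ) 0 = a := rfl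
lemma cons6_1 (a b c d e f : ℝ) : (![a, b, c, d, e, f] : Fin 6 → ℝ) 1 = b := rfl
lemma cons6_2 (a b c d e f : ℝ) : (![a, b, c, d, e, f] : Fin 6 → ℝ) 2 = c := rfl
lemma cons6_3 (a b c d e f : ℝ) : (![a, b, c, d, e, f] : Fin 6 → ℝ) 3 = d := rfl
lemma cons6_4 (a b c d e f : ℝ) : (![a, b, c, d, e, f] : Fin 6 → ℝ) 4 = e := rfl
lemma cons6_5 (a b c d e f : ℝ) : (![a, b, c, d, e, f] : Fin 6 → ℝ) 5 = f := rfl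

variable {E : Type*} [NormedAddCommGroup E] [NormedSpace ℝ E]
  {H : Type*} [TopologicalSpace H] {I : ModelWithCorners ℝ E H}
  {M : Type*} [TopologicalSpace M] [ChartedSpace H M]
  {F : Type*} [NormedAddCommGroup F] [NormedSpace ℝ F]

lemma DiffForm.pullback_val (η : DiffForm I M 2) (f : F → M) (z v w : F) :
    η.pullback f z ![v, w] = η.val (f z) ((mfderiv 𝓘(ℝ, F) I f z : F →L[ℝ] E) v)
      ((mfderiv 𝓘(ℝ, F) I f z : F →L[ℝ] E) w) := by
  change (η (f z)) (fun i => _) = (η (f z)) (fun i => _)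
  congr 1
  funext i
  fin_cases i <;> rfl

lemma DiffForm.pullback_val₃ (η : DiffForm I M 3) (f : F → M) (z u v w : F) :
    η.pullback f z ![u, v, w] = η.val₃ (f z) ((mfderiv 𝓘(ℝ, F) I f z : F →L[ℝ] E) u)
      ((mfderiv 𝓘(ℝ, F) I f z : F →L[ℝ] E) v) ((mfderiv 𝓘(ℝ, F) I f z : F →L[ℝ] E) w) := by
  change (η (f z)) (fun i => _) = (η (f z)) (fun i => _)
  congr 1
  funext i
  fin_cases i <;> rfl

lemma extDeriv_two_apply {β : F → F [⋀^Fin 2]→L[ℝ] ℝ} {z : F} (h : DifferentiableAt ℝ β z)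
    (u v w : F) : extDeriv β z ![u, v, w] = fderiv ℝ (fun x => β x ![v, w]) z u
      - fderiv ℝ (fun x => β x ![u, w]) z v + fderiv ℝ (fun x => β x ![u, v]) z w := by
  have r0 : (0 : Fin 3).removeNth ![u, v, w] = ![v, w] := by
    funext i; fin_cases i <;> rfl
  have r1 : (1 : Fin 3).removeNth ![u, v, w] = ![u, w] := by
    funext i; fin_cases i <;> rfl
  have r2 : (2 : Fin 3).removeNth ![u, v, w] = ![u, v] := by
    funext i; fin_cases i <;> rfl
  rw [extDeriv_apply h, Fin.sum_univ_three, r0, r1, r2]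
  simp [sub_eq_add_neg]

lemma hasDerivAt_line {β : F → F [⋀^Fin 2]→L[ℝ] ℝ} {z : F} (h : DifferentiableAt ℝ β z)
    (u v w : F) : HasDerivAt (fun s : ℝ => β (z + s • u) ![v, w])
      (fderiv ℝ (fun x => β x ![v, w]) z u) 0 := by
  have h0 : DifferentiableAt ℝ (fun x => β x ![v, w]) z :=
    (ContinuousAlternatingMap.apply ℝ F ℝ ![v, w]).differentiableAt.comp _ h
  have h1 : HasDerivAt (fun s : ℝ => z + s • u) u 0 := by
    simpa using ((hasDerivAt_id (0 : ℝ)).smul_const u).const_add z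
  have h2 := h0.hasFDerivAt
  have h3 : z = z + (0 : ℝ) • u := by simp
  rw [h3] at h2
  have h4 := h2.comp_hasDerivAt (0 : ℝ) h1
  rw [← h3] at h4
  exact h4

lemma hasDerivAt_invForm {y₁ y₂ y₃ y₄ y₅ : ℝ → ℝ} {z₁ z₂ z₃ z₄ z₅ : ℝ} {c d : ℝ → Fin 6 → ℝ}
    {c' d' : Fin 6 → ℝ} {s : ℝ} (h₁ : HasDerivAt y₁ z₁ s) (h₂ : HasDerivAt y₂ z₂ s)
    (h₃ : HasDerivAt y₃ z₃ s) (h₄ : HasDerivAt y₄ z₄ s) (h₅ : HasDerivAt y₅ z₅ s)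
    (hc : ∀ i, HasDerivAt (fun s => c s i) (c' i) s)
    (hd : ∀ i, HasDerivAt (fun s => d s i) (d' i) s) :
    HasDerivAt (fun s => invForm (y₁ s) (y₂ s) (y₃ s) (y₄ s) (y₅ s) (c s) (d s))
      (invForm z₁ z₂ z₃ z₄ z₅ (c s) (d s) + invForm (y₁ s) (y₂ s) (y₃ s) (y₄ s) (y₅ s) c' (d s)
        + invForm (y₁ s) (y₂ s) (y₃ s) (y₄ s) (y₅ s) (c s) d') s := by
  have hw (i j : Fin 6) : HasDerivAt (fun s => coWedge i j (c s) (d s))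
      (coWedge i j c' (d s) + coWedge i j (c s) d') s := by
    refine (((hc i).mul (hd j)).sub ((hc j).mul (hd i))).congr_deriv ?_
    simp only [coWedge]
    ring
  refine (((((h₁.mul (hw 0 1)).add (h₂.mul (hw 2 3))).add (h₃.mul (hw 4 5))).add
    (h₄.mul ((hw 2 4).add (hw 3 5)))).add (h₅.mul ((hw 2 5).sub (hw 3 4)))).congr_deriv ?_
  simp only [invForm, Pi.add_apply, Pi.sub_apply]
  ring

/-- The 3-form `ξ* ∧ α + A* ∧ β` in components, where `α = x₂ ω² + x₃ ω³ + x₄ ω⁴ + x₅ ω⁵` and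
`β = w₂ ω² + w₃ ω³ + w₄ ω⁴ + w₅ ω⁵`. -/
def triForm (x₂ x₃ x₄ x₅ w₂ w₃ w₄ w₅ : ℝ) (c d e : Fin 6 → ℝ) : ℝ :=
  c 0 * invForm 0 x₂ x₃ x₄ x₅ d e + d 0 * invForm 0 x₂ x₃ x₄ x₅ e c
    + e 0 * invForm 0 x₂ x₃ x₄ x₅ c d + c 1 * invForm 0 w₂ w₃ w₄ w₅ d e
    + d 1 * invForm 0 w₂ w₃ w₄ w₅ e c + e 1 * invForm 0 w₂ w₃ w₄ w₅ c d

lemma hasDerivAt_mc (X v : imH) : HasDerivAt (fun s : ℝ => mc (s • X) v)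
    (imQ (-(cJ X * cK v - cK X * cJ v)) (-(cK X * cI v - cI X * cK v))
      (-(cI X * cJ v - cJ X * cI v))) 0 := by
  set N : ℝ := cI X ^ 2 + cJ X ^ 2 + cK X ^ 2 with hN
  set w := imQ (-(cJ X * cK v - cK X * cJ v)) (-(cK X * cI v - cI X * cK v))
      (-(cI X * cJ v - cJ X * cI v)) with hw
  have h1 : HasDerivAt (fun s : ℝ => (1 + s ^ 2 * N)⁻¹) 0 0 := by
    have := (((hasDerivAt_id (0 : ℝ)).pow 2).mul_const N).const_add 1
    exact (this.inv (by simp)).congr_deriv (by simp)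
  have h2 : HasDerivAt (fun s : ℝ => v + s • w) w 0 := by
    simpa using ((hasDerivAt_id (0 : ℝ)).smul_const w).const_add v
  have h3 : HasDerivAt (fun s : ℝ => (1 + s ^ 2 * N)⁻¹ • (v + s • w)) w 0 := by
    exact (h1.smul h2).congr_deriv (by simp)
  refine h3.congr_of_eventuallyEq (Eventually.of_forall fun s => ?_)
  change mc (s • X) v = _
  rw [mc_apply]
  congr 1
  · simp only [nsq, map_smul, smul_eq_mul, hN]
    congr 1
    ring
  · apply imH_ext <;> simp [hw, cI_apply, cJ_apply, cK_apply] <;> ring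

/-- The derivative of `orbitCoef` at the base point. -/
def orbitCoef' (u v : ℝ × imH × imH) : Fin 6 → ℝ :=
  let cr (X v : imH) : imH := imQ (-(cJ X * cK v - cK X * cJ v)) (-(cK X * cI v - cI X * cK v))
      (-(cI X * cJ v - cJ X * cI v))
  ![0, cI (cr u.2.1 v.2.1) - cI (cr u.2.2 v.2.2), 2 * √2 * cJ (cr u.2.1 v.2.1),
    2 * √2 * cK (cr u.2.1 v.2.1), 2 * √2 * cJ (cr u.2.2 v.2.2), 2 * √2 * cK (cr u.2.2 v.2.2)]

lemma hasDerivAt_orbitCoef (t : ℝ) (u v : ℝ × imH × imH) (i : Fin 6) :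
    HasDerivAt (fun s : ℝ => orbitCoef ((t, 0, 0) + s • u) v i) (orbitCoef' u v i) 0 := by
  have h1 := hasDerivAt_mc u.2.1 v.2.1
  have h2 := hasDerivAt_mc u.2.2 v.2.2
  have e (s : ℝ) : orbitCoef ((t, 0, 0) + s • u) v = ![v.1,
      cI (mc (s • u.2.1) v.2.1) - cI (mc (s • u.2.2) v.2.2), 2 * √2 * cJ (mc (s • u.2.1) v.2.1),
      2 * √2 * cK (mc (s • u.2.1) v.2.1), 2 * √2 * cJ (mc (s • u.2.2) v.2.2),
      2 * √2 * cK (mc (s • u.2.2) v.2.2)] := by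
    simp [orbitCoef]
  simp only [e]
  fin_cases i
  · exact hasDerivAt_const _ _
  · exact (cI.hasFDerivAt.comp_hasDerivAt (0 : ℝ) h1).sub (cI.hasFDerivAt.comp_hasDerivAt (0 : ℝ) h2)
  · exact (cJ.hasFDerivAt.comp_hasDerivAt (0 : ℝ) h1).const_mul _
  · exact (cK.hasFDerivAt.comp_hasDerivAt (0 : ℝ) h1).const_mul _
  · exact (cJ.hasFDerivAt.comp_hasDerivAt (0 : ℝ) h2).const_mul _
  · exact (cK.hasFDerivAt.comp_hasDerivAt (0 : ℝ) h2).const_mul _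

/-- The vector with given components in the frame. -/
def orbitVec (c : Fin 6 → ℝ) : ℝ × imH × imH :=
  (c 0, imQ (c 1) ((2 * √2)⁻¹ * c 2) ((2 * √2)⁻¹ * c 3),
    imQ 0 ((2 * √2)⁻¹ * c 4) ((2 * √2)⁻¹ * c 5))

lemma orbitCoef_orbitVec (t : ℝ) (c : Fin 6 → ℝ) : orbitCoef (t, 0, 0) (orbitVec c) = c := by
  have hq : 2 * √2 * (2 * √2)⁻¹ = 1 := mul_inv_cancel₀ (by positivity)
  have q (x : ℝ) : 2 * √2 * ((2 * √2)⁻¹ * x) = x := by rw [← mul_assoc, hq, one_mul]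
  have h0 : nsq 0 = 1 := by simp [nsq]
  funext i
  fin_cases i <;>
    simp [-mul_inv_rev, orbitCoef, orbitVec, mc_apply, h0, cI_apply, cJ_apply, cK_apply]

lemma orbitCoef'_orbitVec (c d : Fin 6 → ℝ) : orbitCoef' (orbitVec c) (orbitVec d)
    = ![0, (c 4 * d 5 - c 5 * d 4 - (c 2 * d 3 - c 3 * d 2)) / 8, c 1 * d 3 - c 3 * d 1,
      c 2 * d 1 - c 1 * d 2, 0, 0] := by
  have hq : 2 * √2 * (2 * √2)⁻¹ = 1 := mul_inv_cancel₀ (by positivity)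
  have hq3 : (2 * √2)⁻¹ * (2 * √2)⁻¹ = (1 / 8 : ℝ) := by
    rw [← mul_inv]
    have := Real.mul_self_sqrt (show (0 : ℝ) ≤ 2 by norm_num)
    rw [show (2 * √2 * (2 * √2) : ℝ) = 8 by linarith]
    norm_num
  funext i
  fin_cases i
  · simp [orbitCoef']
  · simp [-mul_inv_rev, orbitCoef', orbitVec, cI_apply, cJ_apply, cK_apply]
    linear_combination (c 4 * d 5 - c 5 * d 4 - (c 2 * d 3 - c 3 * d 2)) * hq3
  · simp [-mul_inv_rev, orbitCoef', orbitVec, cI_apply, cJ_apply, cK_apply]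
    linear_combination (c 1 * d 3 - c 3 * d 1) * hq
  · simp [-mul_inv_rev, orbitCoef', orbitVec, cI_apply, cJ_apply, cK_apply]
    linear_combination (c 2 * d 1 - c 1 * d 2) * hq
  · simp [-mul_inv_rev, orbitCoef', orbitVec, cI_apply, cJ_apply, cK_apply]
  · simp [-mul_inv_rev, orbitCoef', orbitVec, cI_apply, cJ_apply, cK_apply]

lemma actD_one (p : TS3) (u : ModelE) : actD 1 p u = u := by
  have : act 1 = id := funext act_one
  rw [actD, this]
  exact DFunLike.congr_fun (mfderiv_id (I := modelTS3) (x := p)) u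

lemma orbitMap_base (t : ℝ) : orbitMap (t, 0, 0) = gammaCurve t := by
  simp only [orbitMap, sig_zero]
  exact act_one _

lemma mfderiv_orbitMap_base (t : ℝ) (c : Fin 6 → ℝ) :
    (mfderiv 𝓘(ℝ, ℝ × imH × imH) modelTS3 orbitMap (t, 0, 0) : ℝ × imH × imH →L[ℝ] ModelE)
      (orbitVec c) = frameVec t c := by
  rw [mfderiv_orbitMap, orbitCoef_orbitVec]
  simp only [sig_zero]
  exact actD_one _ _

/-- Invariance of a 2-form along the orbit of a point. -/
def InvariantAlong (η : DiffForm modelTS3 TS3 2) (p : TS3) : Prop :=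
  ∀ h : SU2 × SU2, ∀ v w : ModelE, η.val (act h p) (actD h p v) (actD h p w) = η.val p v w

/-- The exterior derivative of an invariant 2-form. -/
lemma d_invariant {η : DiffForm modelTS3 TS3 2} {t : ℝ} (hη : η.DiffAt (gammaCurve t))
    (hinv : ∀ᶠ t' in 𝓝 t, InvariantAlong η (gammaCurve t')) {y₁ y₂ y₃ y₄ y₅ : ℝ → ℝ}
    {z₁ z₂ z₃ z₄ z₅ : ℝ}
    (hval : ∀ᶠ t' in 𝓝 t, ∀ c d, η.val (gammaCurve t') (frameVec t' c) (frameVec t' d)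
      = invForm (y₁ t') (y₂ t') (y₃ t') (y₄ t') (y₅ t') c d)
    (h₁ : HasDerivAt y₁ z₁ t) (h₂ : HasDerivAt y₂ z₂ t)
    (h₃ : HasDerivAt y₃ z₃ t) (h₄ : HasDerivAt y₄ z₄ t) (h₅ : HasDerivAt y₅ z₅ t)
    (c d e : Fin 6 → ℝ) :
    η.d.val₃ (gammaCurve t) (frameVec t c) (frameVec t d) (frameVec t e)
      = triForm (z₂ + y₁ t / 4) (z₃ - y₁ t / 4) z₄ z₅ 0 0 (2 * y₅ t) (-2 * y₄ t) c d e := by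
  have hb := orbitMap_base t
  have hs : ContMDiffAt 𝓘(ℝ, ℝ × imH × imH) modelTS3 ∞ orbitMap (t, 0, 0) := contMDiff_orbitMap _
  have hη' : η.DiffAt (orbitMap (t, 0, 0)) := by rwa [hb]
  have h0 := η.extDeriv_pullback hs hη'
  have hdiff := hη'.differentiableAt_pullback hs
  have h6 := DFunLike.congr_fun h0 ![orbitVec c, orbitVec d, orbitVec e]
  rw [η.d.pullback_val₃, mfderiv_orbitMap_base, mfderiv_orbitMap_base, mfderiv_orbitMap_base, hb,
    extDeriv_two_apply hdiff] at h6
  rw [← h6]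
  have key (u v w : ℝ × imH × imH) : fderiv ℝ (fun x => η.pullback orbitMap x ![v, w]) (t, 0, 0) u
      = invForm (u.1 * z₁) (u.1 * z₂) (u.1 * z₃) (u.1 * z₄) (u.1 * z₅) (orbitCoef (t, 0, 0) v)
          (orbitCoef (t, 0, 0) w)
        + invForm (y₁ t) (y₂ t) (y₃ t) (y₄ t) (y₅ t) (orbitCoef' u v) (orbitCoef (t, 0, 0) w)
        + invForm (y₁ t) (y₂ t) (y₃ t) (y₄ t) (y₅ t) (orbitCoef (t, 0, 0) v) (orbitCoef' u w) := by
    have k1 := hasDerivAt_line hdiff u v w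
    have hl : HasDerivAt (fun s : ℝ => t + s * u.1) u.1 0 := by
      simpa using ((hasDerivAt_id (0 : ℝ)).mul_const u.1).const_add t
    have hl0 : t + (0 : ℝ) * u.1 = t := by simp
    have hy {y : ℝ → ℝ} {z : ℝ} (h : HasDerivAt y z t) :
        HasDerivAt (fun s : ℝ => y (t + s * u.1)) (u.1 * z) 0 := by
      rw [← hl0] at h
      rw [mul_comm]
      exact h.comp (0 : ℝ) hl
    have k2 := hasDerivAt_invForm (hy h₁) (hy h₂) (hy h₃) (hy h₄) (hy h₅)
      (hasDerivAt_orbitCoef t u v) (hasDerivAt_orbitCoef t u w)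
    simp only [hl0, zero_smul, add_zero] at k2
    refine k1.unique (k2.congr_of_eventuallyEq ?_)
    have hc : Tendsto (fun s : ℝ => t + s * u.1) (𝓝 0) (𝓝 t) := by
      have := hl.continuousAt.tendsto
      rwa [hl0] at this
    filter_upwards [hc.eventually hinv, hc.eventually hval] with s hi hv
    rw [η.pullback_val, mfderiv_orbitMap, mfderiv_orbitMap]
    exact (hi _ _ _).trans (hv _ _)
  rw [key, key, key]
  have e0 (c : Fin 6 → ℝ) : (orbitVec c).1 = c 0 := rfl
  simp only [orbitCoef_orbitVec, orbitCoef'_orbitVec, e0]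
  simp only [invForm, coWedge, triForm, cons6_0, cons6_1, cons6_2, cons6_3, cons6_4, cons6_5]
  ring

end InvariantForms

section Slice

lemma enorm_adj (q : SU2) (w : imH) : ‖adj q w‖ₑ = ‖w‖ₑ := by
  rw [← ofReal_norm, ← ofReal_norm, norm_adj]

lemma isOpen_tube (a : ℝ≥0∞) : IsOpen (tube a) :=
  isOpen_lt (continuous_enorm.comp continuous_snd) continuous_const

lemma isOpen_tube_diff (a : ℝ≥0∞) : IsOpen (tube a \ singularOrbit) :=
  (isOpen_tube a).sdiff (isClosed_eq continuous_snd continuous_const)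

lemma act_mem_tube {a : ℝ≥0∞} (h : SU2 × SU2) {p : TS3} (hp : p ∈ tube a) : act h p ∈ tube a := by
  change ‖adj h.2 p.2‖ₑ < a
  rw [enorm_adj]
  exact hp

/-- A parametrisation of `G ×_H V` near the fibre over the base point. -/
def sliceMap (z : imH × imH) : TS3 := (sig z.1, z.2)

lemma sliceMap_zero (w : imH) : sliceMap (0, w) = (1, w) := by rw [sliceMap, sig_zero]

lemma contMDiff_sliceMap : ContMDiff 𝓘(ℝ, imH × imH) modelTS3 ∞ sliceMap :=
  contMDiff_TS3 (contDiff_sig.comp contDiff_fst).contMDiff contDiff_snd.contMDiff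

/-- The derivative of `sliceMap`. -/
def tanVecL (w : imH) : imH × imH →L[ℝ] ModelE :=
  mfderiv 𝓘(ℝ, imH × imH) modelTS3 sliceMap (0, w)

/-- The tangent vector at `(1, w)` with components `a`. -/
def tanVec (w : imH) (a : imH × imH) : ModelE := tanVecL w a

lemma mc_zero (v : imH) : mc 0 v = v := by
  rw [mc_apply]
  apply imH_ext <;> simp [nsq, cI_apply, cJ_apply, cK_apply]

lemma ambD_tanVec (w : imH) (a : imH × imH) :
    ambD (1, w) (tanVec w a) = ((a.1 : ℍ[ℝ]), a.2) := by
  have hX : HasFDerivAt (fun z : imH × imH => (sig z.1 : ℍ[ℝ])) _ (0, w) :=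
    HasFDerivAt.comp (g := fun X : imH => ((sig X : SU2) : ℍ[ℝ])) (f := Prod.fst) (0, w)
      (hasFDerivAt_sig _) hasFDerivAt_fst
  have h := ambD_mfderiv_of_hasFDerivAt (f := sliceMap) (z := (0, w))
    ((contMDiff_sliceMap _).mdifferentiableAt (by simp)) hX hasFDerivAt_snd a
  rw [sliceMap_zero] at h
  refine h.trans (Prod.ext ?_ rfl)
  change mulLR (sig 0) 1 (mc 0 a.1 : imH) = _
  rw [mulLR_apply, mc_zero, sig_zero]
  simp

lemma tanVec_surjective (w : imH) : Function.Surjective (tanVec w) := by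
  have hi : Function.Injective (tanVecL w : imH × imH →ₗ[ℝ] ModelE) := by
    intro a b hab
    have := congrArg (ambD (1, w)) (show tanVec w a = tanVec w b from hab)
    rw [ambD_tanVec, ambD_tanVec] at this
    exact Prod.ext (Subtype.ext (Prod.mk.inj this).1) (Prod.mk.inj this).2
  have h3 : Module.finrank ℝ imH = 3 := by
    have := finrank_modelE
    rw [Module.finrank_prod, finrank_euclideanSpace_fin] at this
    omega
  have hf : Module.finrank ℝ (imH × imH) = Module.finrank ℝ ModelE := by
    rw [finrank_modelE, Module.finrank_prod, h3]
  exact (LinearMap.injective_iff_surjective_of_finrank_eq_finrank hf).1 hi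

variable {a : ℝ≥0∞} {κ : DiffForm modelTS3 TS3 2}

lemma mfderiv_act_comp {F : Type*} [NormedAddCommGroup F] [NormedSpace ℝ F] (h : SU2 × SU2)
    {f : F → TS3} {z : F} (hf : MDifferentiableAt 𝓘(ℝ, F) modelTS3 f z) (v : F) :
    (mfderiv 𝓘(ℝ, F) modelTS3 (act h ∘ f) z : F →L[ℝ] ModelE) v
      = actD h (f z) ((mfderiv 𝓘(ℝ, F) modelTS3 f z : F →L[ℝ] ModelE) v) := by
  have := mfderiv_comp z ((contMDiff_act h (f z)).mdifferentiableAt (by simp)) hf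
  exact DFunLike.congr_fun this v

lemma IsInvariantOn.invariantAlong {U : Set TS3} (h : IsInvariantOn κ U) {p : TS3} (hp : p ∈ U) :
    InvariantAlong κ p := by
  intro x v w
  have := DFunLike.congr_fun (h x p hp) ![v, w]
  refine Eq.trans ?_ this
  change κ (act x p) _ = κ (act x p) _
  congr 1
  funext i
  fin_cases i <;> rfl

lemma slice_invariant (hs : κ.SmoothOn (tube a)) (hinv : IsInvariantOn κ (tube a \ singularOrbit))
    (h : SU2 × SU2) {z : imH × imH} (hz : ‖z.2‖ₑ < a) (v w : imH × imH) :
    κ.pullback (act h ∘ sliceMap) z ![v, w] = κ.pullback sliceMap z ![v, w] := by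
  have hsl (z : imH × imH) : MDifferentiableAt 𝓘(ℝ, imH × imH) modelTS3 sliceMap z :=
    (contMDiff_sliceMap _).mdifferentiableAt (by simp)
  have h1 (z : imH × imH) (hz : ‖z.2‖ₑ < a) (h0 : z.2 ≠ 0) :
      κ.pullback (act h ∘ sliceMap) z ![v, w] = κ.pullback sliceMap z ![v, w] := by
    rw [κ.pullback_val, κ.pullback_val, mfderiv_act_comp h (hsl z), mfderiv_act_comp h (hsl z)]
    exact hinv.invariantAlong (p := sliceMap z) ⟨hz, h0⟩ h _ _
  by_cases h0 : z.2 = 0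
  swap
  · exact h1 z hz h0
  let l : ℝ → imH × imH := fun r => (z.1, r • imQ 1 0 0)
  have hl : Continuous l := by fun_prop
  have l0 : l 0 = z := Prod.ext rfl (by simp [l, h0])
  have hi : imQ 1 0 0 ≠ 0 := fun e => by
    have := congrArg (fun X : imH => (X : ℍ[ℝ]).imI) e
    simp at this
  have c1 := (hs.contDiffAt_pullback_apply (isOpen_tube a)
    (((contMDiff_act h).comp contMDiff_sliceMap) z) (act_mem_tube h hz) ![v, w]).continuousAt
  have c2 := (hs.contDiffAt_pullback_apply (isOpen_tube a) (contMDiff_sliceMap z) hz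
    ![v, w]).continuousAt
  rw [← l0] at c1 c2
  have d1 := (ContinuousAt.comp (f := l) c1 hl.continuousAt).tendsto.mono_left
    (nhdsWithin_le_nhds (s := {0}ᶜ))
  have d2 := (ContinuousAt.comp (f := l) c2 hl.continuousAt).tendsto.mono_left
    (nhdsWithin_le_nhds (s := {0}ᶜ))
  have hev : ∀ᶠ r in 𝓝[≠] (0 : ℝ), ‖(l r).2‖ₑ < a := by
    refine (continuous_enorm.comp (continuous_snd.comp hl)).continuousAt.tendsto.mono_left
      nhdsWithin_le_nhds |>.eventually (gt_mem_nhds ?_)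
    change ‖(l 0).2‖ₑ < a
    rwa [l0]
  have key := tendsto_nhds_unique_of_eventuallyEq d1 d2 (by
    filter_upwards [hev, self_mem_nhdsWithin] with r hr hr0
    exact h1 _ hr (smul_ne_zero hr0 hi))
  simpa [l0] using key

lemma invariantAlong_slice (hs : κ.SmoothOn (tube a))
    (hinv : IsInvariantOn κ (tube a \ singularOrbit)) {w : imH} (hw : ‖w‖ₑ < a) :
    InvariantAlong κ (1, w) := by
  intro h x y
  obtain ⟨x, rfl⟩ := tanVec_surjective w x
  obtain ⟨y, rfl⟩ := tanVec_surjective w y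
  have hsl : MDifferentiableAt 𝓘(ℝ, imH × imH) modelTS3 sliceMap (0, w) :=
    (contMDiff_sliceMap _).mdifferentiableAt (by simp)
  have := slice_invariant hs hinv h (z := (0, w)) hw x y
  rw [κ.pullback_val, κ.pullback_val, mfderiv_act_comp h hsl, mfderiv_act_comp h hsl] at this
  simp only [Function.comp_apply, sliceMap_zero] at this
  exact this

lemma d_invariant_slice (hs : κ.SmoothOn (tube a))
    (hinv : IsInvariantOn κ (tube a \ singularOrbit)) {w : imH} (hw : ‖w‖ₑ < a) (h : SU2 × SU2)
    (x y z : ModelE) : κ.d.val₃ (act h (1, w)) (actD h (1, w) x) (actD h (1, w) y)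
      (actD h (1, w) z) = κ.d.val₃ (1, w) x y z := by
  obtain ⟨x, rfl⟩ := tanVec_surjective w x
  obtain ⟨y, rfl⟩ := tanVec_surjective w y
  obtain ⟨z, rfl⟩ := tanVec_surjective w z
  have hsl : MDifferentiableAt 𝓘(ℝ, imH × imH) modelTS3 sliceMap (0, w) :=
    (contMDiff_sliceMap _).mdifferentiableAt (by simp)
  have hmem : sliceMap (0, w) ∈ tube a := hw
  have hn : {z : imH × imH | ‖z.2‖ₑ < a} ∈ 𝓝 ((0, w) : imH × imH) :=
    (isOpen_lt (continuous_enorm.comp continuous_snd) continuous_const).mem_nhds hw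
  have he : κ.pullback (act h ∘ sliceMap) =ᶠ[𝓝 (0, w)] κ.pullback sliceMap := by
    filter_upwards [hn] with z hz
    refine ContinuousAlternatingMap.ext fun v => ?_
    have hv : v = ![v 0, v 1] := by funext i; fin_cases i <;> rfl
    rw [hv]
    exact slice_invariant hs hinv h hz _ _
  have e1 := κ.extDeriv_pullback (contMDiff_sliceMap (0, w)) (hs.diffAt (isOpen_tube a) hmem)
  have e2 := κ.extDeriv_pullback (((contMDiff_act h).comp contMDiff_sliceMap) (0, w))
    (hs.diffAt (isOpen_tube a) (act_mem_tube h hmem))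
  rw [he.extDeriv_eq, e1] at e2
  have := DFunLike.congr_fun e2 ![x, y, z]
  rw [κ.d.pullback_val₃, κ.d.pullback_val₃, mfderiv_act_comp h hsl, mfderiv_act_comp h hsl,
    mfderiv_act_comp h hsl] at this
  simp only [Function.comp_apply, sliceMap_zero] at this
  exact this.symm

lemma actD_injective (h : SU2 × SU2) (p : TS3) : Function.Injective (actD h p) := by
  intro u v huv
  have e := congrArg (ambD (act h p)) huv
  rw [ambD_actD, ambD_actD] at e
  obtain ⟨e1, e2⟩ := Prod.mk.inj e
  refine ambD_injective p (Prod.ext ?_ ?_)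
  · have := mul_right_cancel₀ (norm_ne_zero_iff.1 (by rw [norm_eq_of_mem_sphere]; exact one_ne_zero)) e1
    exact mul_left_cancel₀ (norm_ne_zero_iff.1 (by rw [norm_eq_of_mem_sphere]; exact one_ne_zero)) this
  · have := congrArg (adj h.2⁻¹) e2
    rwa [← adj_mul, ← adj_mul, inv_mul_cancel, adj_one, adj_one] at this

/-- The action of `h` on the tangent space at `p`. -/
def actEquiv (h : SU2 × SU2) (p : TS3) : ModelE ≃ₗ[ℝ] ModelE :=
  LinearEquiv.ofInjectiveEndo (actD h p : ModelE →ₗ[ℝ] ModelE) (actD_injective h p)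

lemma actEquiv_apply (h : SU2 × SU2) (p : TS3) (v : ModelE) : actEquiv h p v = actD h p v := rfl

/-- The diagonal acts on the fibre over the base point by the adjoint representation. -/
lemma actD_tanVec (q : SU2) (w : imH) (x : imH × imH) :
    actD (q, q) (1, w) (tanVec w x) = tanVec (adj q w) (adj q x.1, adj q x.2) := by
  have hp : act (q, q) (1, w) = (1, adj q w) := by simp [act]
  refine ambD_injective (1, adj q w) ?_
  have := ambD_actD (q, q) (1, w) (tanVec w x)
  rw [hp] at this
  rw [this, ambD_tanVec, ambD_tanVec]
  rfl

lemma val_tanVec_adj (hs : κ.SmoothOn (tube a))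
    (hinv : IsInvariantOn κ (tube a \ singularOrbit)) (q : SU2) {w : imH} (hw : ‖w‖ₑ < a)
    (x y : imH × imH) : κ.val (1, adj q w) (tanVec (adj q w) (adj q x.1, adj q x.2))
      (tanVec (adj q w) (adj q y.1, adj q y.2)) = κ.val (1, w) (tanVec w x) (tanVec w y) := by
  have := invariantAlong_slice hs hinv hw (q, q) (tanVec w x) (tanVec w y)
  rw [actD_tanVec, actD_tanVec] at this
  have hp : act (q, q) (1, w) = (1, adj q w) := by simp [act]
  rwa [hp] at this

lemma val₃_tanVec_adj (hs : κ.SmoothOn (tube a))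
    (hinv : IsInvariantOn κ (tube a \ singularOrbit)) (q : SU2) {w : imH} (hw : ‖w‖ₑ < a)
    (x y z : imH × imH) : κ.d.val₃ (1, adj q w) (tanVec (adj q w) (adj q x.1, adj q x.2))
      (tanVec (adj q w) (adj q y.1, adj q y.2)) (tanVec (adj q w) (adj q z.1, adj q z.2))
      = κ.d.val₃ (1, w) (tanVec w x) (tanVec w y) (tanVec w z) := by
  have := d_invariant_slice hs hinv hw (q, q) (tanVec w x) (tanVec w y) (tanVec w z)
  rw [actD_tanVec, actD_tanVec, actD_tanVec] at this
  have hp : act (q, q) (1, w) = (1, adj q w) := by simp [act]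
  rwa [hp] at this

end Slice

section Coefficients

/-- The quaternion with the given coordinates. -/
def quat (x y z w : ℝ) : ℍ[ℝ] := ⟨x, y, z, w⟩

@[simp] lemma re_quat (x y z w : ℝ) : (quat x y z w).re = x := rfl
@[simp] lemma imI_quat (x y z w : ℝ) : (quat x y z w).imI = y := rfl
@[simp] lemma imJ_quat (x y z w : ℝ) : (quat x y z w).imJ = z := rfl
@[simp] lemma imK_quat (x y z w : ℝ) : (quat x y z w).imK = w := rfl

/-- A quaternion of norm one, as an element of `SU₂`. -/
def unitQ (x y z w : ℝ) (h : x ^ 2 + y ^ 2 + z ^ 2 + w ^ 2 = 1) : SU2 :=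
  ⟨quat x y z w, by
    rw [mem_sphere_zero_iff_norm, ← sq_eq_sq₀ (norm_nonneg _) zero_le_one, pow_two,
      ← Quaternion.normSq_eq_norm_mul_self, Quaternion.normSq_def']
    simpa using h⟩

lemma coe_adj (q : SU2) (w : imH) : (adj q w : ℍ[ℝ]) = (q : ℍ[ℝ]) * w * star (q : ℍ[ℝ]) := by
  rw [← coe_inv_SU2]
  rfl

lemma coe_unitQ (x y z w : ℝ) (h : x ^ 2 + y ^ 2 + z ^ 2 + w ^ 2 = 1) :
    (unitQ x y z w h : ℍ[ℝ]) = quat x y z w := rfl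

lemma sq_inv_sqrt_two : ((√2 : ℝ)⁻¹) ^ 2 = 1 / 2 := by
  rw [inv_pow, Real.sq_sqrt (by norm_num)]
  norm_num

/-- The rotation by `π` about the first axis. -/
def rotI : SU2 := unitQ 0 1 0 0 (by norm_num)

/-- The rotation by `π` about the second axis. -/
def rotJ : SU2 := unitQ 0 0 1 0 (by norm_num)

/-- The rotation by `π / 2` about the first axis. -/
def rotQuarter : SU2 := unitQ (√2)⁻¹ (√2)⁻¹ 0 0 (by rw [sq_inv_sqrt_two]; norm_num)

/-- The cyclic permutation of the axes. -/
def rotCycle : SU2 := unitQ (1 / 2) (1 / 2) (1 / 2) (1 / 2) (by norm_num)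

lemma adj_rotI (x y z : ℝ) : adj rotI (imQ x y z) = imQ x (-y) (-z) := by
  apply imH_ext <;> rw [coe_adj, rotI, coe_unitQ] <;> simp

lemma adj_rotJ (x y z : ℝ) : adj rotJ (imQ x y z) = imQ (-x) y (-z) := by
  apply imH_ext <;> rw [coe_adj, rotJ, coe_unitQ] <;> simp

lemma adj_rotQuarter (x y z : ℝ) : adj rotQuarter (imQ x y z) = imQ x (-z) y := by
  have h := sq_inv_sqrt_two
  apply imH_ext <;> rw [coe_adj, rotQuarter, coe_unitQ] <;> simp
  · linear_combination 2 * x * h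
  · linear_combination -2 * z * h
  · linear_combination 2 * y * h

lemma adj_rotCycle (x y z : ℝ) : adj rotCycle (imQ x y z) = imQ z x y := by
  apply imH_ext <;> rw [coe_adj, rotCycle, coe_unitQ] <;> simp <;> ring

/-- The element of `su₂ + su₂` with the given coordinates. -/
def vec6 (v₁ v₂ v₃ u₁ u₂ u₃ : ℝ) : imH × imH := (imQ v₁ v₂ v₃, imQ u₁ u₂ u₃)

lemma vec6_eq (v₁ v₂ v₃ u₁ u₂ u₃ : ℝ) : vec6 v₁ v₂ v₃ u₁ u₂ u₃
    = v₁ • vec6 1 0 0 0 0 0 + v₂ • vec6 0 1 0 0 0 0 + v₃ • vec6 0 0 1 0 0 0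
      + u₁ • vec6 0 0 0 1 0 0 + u₂ • vec6 0 0 0 0 1 0 + u₃ • vec6 0 0 0 0 0 1 := by
  refine Prod.ext ?_ ?_ <;> apply imH_ext <;> simp [vec6]

lemma neg_vec6 (v₁ v₂ v₃ u₁ u₂ u₃ : ℝ) : vec6 (-v₁) (-v₂) (-v₃) (-u₁) (-u₂) (-u₃)
    = - vec6 v₁ v₂ v₃ u₁ u₂ u₃ := by
  refine Prod.ext ?_ ?_ <;> apply imH_ext <;> simp [vec6]

variable {a : ℝ≥0∞} {κ : DiffForm modelTS3 TS3 2}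

/-- The form `κ` at `γ_t`, in the parametrisation `sliceMap`. -/
def sliceForm {k : ℕ} (κ : DiffForm modelTS3 TS3 k) (t : ℝ) : (imH × imH) [⋀^Fin k]→L[ℝ] ℝ :=
  κ.pullback sliceMap (0, imQ t 0 0)

lemma sliceForm_two (κ : DiffForm modelTS3 TS3 2) (t : ℝ) (x y : imH × imH) :
    sliceForm κ t ![x, y] = κ.val (gammaCurve t) (tanVec (imQ t 0 0) x) (tanVec (imQ t 0 0) y) := by
  rw [sliceForm, κ.pullback_val, sliceMap_zero]
  rfl

lemma sliceForm_three (κ : DiffForm modelTS3 TS3 3) (t : ℝ) (x y z : imH × imH) :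
    sliceForm κ t ![x, y, z] = κ.val₃ (gammaCurve t) (tanVec (imQ t 0 0) x)
      (tanVec (imQ t 0 0) y) (tanVec (imQ t 0 0) z) := by
  rw [sliceForm, κ.pullback_val₃, sliceMap_zero]
  rfl

lemma enorm_imQ (t : ℝ) : ‖imQ t 0 0‖ₑ = ‖t‖ₑ := by
  have h1 : imQ t 0 0 = t • imQ 1 0 0 := by apply imH_ext <;> simp
  have h2 : ‖imQ 1 0 0‖ = 1 := by
    change ‖(imQ 1 0 0 : ℍ[ℝ])‖ = 1
    rw [← sq_eq_sq₀ (norm_nonneg _) zero_le_one, pow_two, ← Quaternion.normSq_eq_norm_mul_self,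
      Quaternion.normSq_def']
    simp
  rw [← ofReal_norm, ← ofReal_norm, h1, norm_smul, h2, mul_one]

lemma contDiffAt_sliceForm {k : ℕ} {η : DiffForm modelTS3 TS3 k} (hs : η.SmoothOn (tube a)) {t : ℝ}
    (ht : ‖t‖ₑ < a) (v : Fin k → imH × imH) : ContDiffAt ℝ ∞ (fun t => sliceForm η t v) t := by
  have hm : sliceMap (0, imQ t 0 0) ∈ tube a := by
    change ‖imQ t 0 0‖ₑ < a
    rwa [enorm_imQ]
  have hl : ContDiff ℝ ∞ (fun t : ℝ => ((0 : imH), imQ t 0 0)) := by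
    have : (fun t : ℝ => ((0 : imH), imQ t 0 0)) = fun t => t • ((0 : imH), imQ 1 0 0) := by
      funext t
      refine Prod.ext (by simp) ?_
      apply imH_ext <;> simp
    rw [this]
    fun_prop
  exact ContDiffAt.comp (g := fun z => η.pullback sliceMap z v) t
    (hs.contDiffAt_pullback_apply (isOpen_tube a) (contMDiff_sliceMap _) hm v) hl.contDiffAt

variable {t : ℝ}

section Symmetries

variable (hs : κ.SmoothOn (tube a)) (hinv : IsInvariantOn κ (tube a \ singularOrbit))
  (ht : ‖t‖ₑ < a)
include hs hinv ht

lemma sliceForm_rotI (v₁ v₂ v₃ u₁ u₂ u₃ v₁' v₂' v₃' u₁' u₂' u₃' : ℝ) :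
    sliceForm κ t ![vec6 v₁ (-v₂) (-v₃) u₁ (-u₂) (-u₃), vec6 v₁' (-v₂') (-v₃') u₁' (-u₂') (-u₃')]
      = sliceForm κ t ![vec6 v₁ v₂ v₃ u₁ u₂ u₃, vec6 v₁' v₂' v₃' u₁' u₂' u₃'] := by
  have := val_tanVec_adj hs hinv rotI (w := imQ t 0 0) (by rwa [enorm_imQ])
    (vec6 v₁ v₂ v₃ u₁ u₂ u₃) (vec6 v₁' v₂' v₃' u₁' u₂' u₃')
  simp only [vec6, adj_rotI, neg_zero] at this
  rw [sliceForm_two, sliceForm_two]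
  exact this

lemma sliceForm_rotQuarter (v₁ v₂ v₃ u₁ u₂ u₃ v₁' v₂' v₃' u₁' u₂' u₃' : ℝ) :
    sliceForm κ t ![vec6 v₁ (-v₃) v₂ u₁ (-u₃) u₂, vec6 v₁' (-v₃') v₂' u₁' (-u₃') u₂']
      = sliceForm κ t ![vec6 v₁ v₂ v₃ u₁ u₂ u₃, vec6 v₁' v₂' v₃' u₁' u₂' u₃'] := by
  have := val_tanVec_adj hs hinv rotQuarter (w := imQ t 0 0) (by rwa [enorm_imQ])
    (vec6 v₁ v₂ v₃ u₁ u₂ u₃) (vec6 v₁' v₂' v₃' u₁' u₂' u₃')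
  simp only [vec6, adj_rotQuarter, neg_zero] at this
  rw [sliceForm_two, sliceForm_two]
  exact this

lemma sliceForm_rotJ (v₁ v₂ v₃ u₁ u₂ u₃ v₁' v₂' v₃' u₁' u₂' u₃' : ℝ) :
    sliceForm κ (-t) ![vec6 (-v₁) v₂ (-v₃) (-u₁) u₂ (-u₃),
        vec6 (-v₁') v₂' (-v₃') (-u₁') u₂' (-u₃')]
      = sliceForm κ t ![vec6 v₁ v₂ v₃ u₁ u₂ u₃, vec6 v₁' v₂' v₃' u₁' u₂' u₃'] := by
  have := val_tanVec_adj hs hinv rotJ (w := imQ t 0 0) (by rwa [enorm_imQ])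
    (vec6 v₁ v₂ v₃ u₁ u₂ u₃) (vec6 v₁' v₂' v₃' u₁' u₂' u₃')
  simp only [vec6, adj_rotJ, neg_zero] at this
  rw [sliceForm_two, sliceForm_two]
  exact this

lemma sliceForm_d_rotJ (v₁ v₂ v₃ u₁ u₂ u₃ v₁' v₂' v₃' u₁' u₂' u₃' v₁'' v₂'' v₃'' u₁'' u₂'' u₃'' : ℝ) :
    sliceForm κ.d (-t) ![vec6 (-v₁) v₂ (-v₃) (-u₁) u₂ (-u₃),
        vec6 (-v₁') v₂' (-v₃') (-u₁') u₂' (-u₃'), vec6 (-v₁'') v₂'' (-v₃'') (-u₁'') u₂'' (-u₃'')]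
      = sliceForm κ.d t ![vec6 v₁ v₂ v₃ u₁ u₂ u₃, vec6 v₁' v₂' v₃' u₁' u₂' u₃',
        vec6 v₁'' v₂'' v₃'' u₁'' u₂'' u₃''] := by
  have := val₃_tanVec_adj hs hinv rotJ (w := imQ t 0 0) (by rwa [enorm_imQ])
    (vec6 v₁ v₂ v₃ u₁ u₂ u₃) (vec6 v₁' v₂' v₃' u₁' u₂' u₃') (vec6 v₁'' v₂'' v₃'' u₁'' u₂'' u₃'')
  simp only [vec6, adj_rotJ, neg_zero] at this
  rw [sliceForm_three, sliceForm_three]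
  exact this

lemma sliceForm_d_rotI (v₁ v₂ v₃ u₁ u₂ u₃ v₁' v₂' v₃' u₁' u₂' u₃' v₁'' v₂'' v₃'' u₁'' u₂'' u₃'' : ℝ) :
    sliceForm κ.d t ![vec6 v₁ (-v₂) (-v₃) u₁ (-u₂) (-u₃),
        vec6 v₁' (-v₂') (-v₃') u₁' (-u₂') (-u₃'), vec6 v₁'' (-v₂'') (-v₃'') u₁'' (-u₂'') (-u₃'')]
      = sliceForm κ.d t ![vec6 v₁ v₂ v₃ u₁ u₂ u₃, vec6 v₁' v₂' v₃' u₁' u₂' u₃',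
        vec6 v₁'' v₂'' v₃'' u₁'' u₂'' u₃''] := by
  have := val₃_tanVec_adj hs hinv rotI (w := imQ t 0 0) (by rwa [enorm_imQ])
    (vec6 v₁ v₂ v₃ u₁ u₂ u₃) (vec6 v₁' v₂' v₃' u₁' u₂' u₃') (vec6 v₁'' v₂'' v₃'' u₁'' u₂'' u₃'')
  simp only [vec6, adj_rotI, neg_zero] at this
  rw [sliceForm_three, sliceForm_three]
  exact this

end Symmetries

/-- The value of `κ` on `b₁ = (0, i)`, `a₁ = (i, 0)`. -/
def kf (κ : DiffForm modelTS3 TS3 2) (t : ℝ) : ℝ :=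
  sliceForm κ t ![vec6 0 0 0 1 0 0, vec6 1 0 0 0 0 0]

/-- The value of `κ` on `a₂ = (j, 0)`, `b₂ = (0, j)`. -/
def kp (κ : DiffForm modelTS3 TS3 2) (t : ℝ) : ℝ :=
  sliceForm κ t ![vec6 0 1 0 0 0 0, vec6 0 0 0 0 1 0]

/-- The value of `κ` on `a₂ = (j, 0)`, `b₃ = (0, k)`. -/
def kq (κ : DiffForm modelTS3 TS3 2) (t : ℝ) : ℝ :=
  sliceForm κ t ![vec6 0 1 0 0 0 0, vec6 0 0 0 0 0 1]

/-- The value of `κ` on `a₂ = (j, 0)`, `a₃ = (k, 0)`. -/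
def kr (κ : DiffForm modelTS3 TS3 2) (t : ℝ) : ℝ :=
  sliceForm κ t ![vec6 0 1 0 0 0 0, vec6 0 0 1 0 0 0]

/-- The value of `κ` on `b₂ = (0, j)`, `b₃ = (0, k)`. -/
def km (κ : DiffForm modelTS3 TS3 2) (t : ℝ) : ℝ :=
  sliceForm κ t ![vec6 0 0 0 0 1 0, vec6 0 0 0 0 0 1]

lemma alt2_self {W : Type*} [AddCommGroup W] [Module ℝ W] [TopologicalSpace W]
    (α : W [⋀^Fin 2]→L[ℝ] ℝ) (x : W) : α ![x, x] = 0 := by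
  have := alt2_swap α x x
  linarith

lemma sliceForm_vec6 (hs : κ.SmoothOn (tube a)) (hinv : IsInvariantOn κ (tube a \ singularOrbit))
    (ht : ‖t‖ₑ < a) (v₁ v₂ v₃ u₁ u₂ u₃ v₁' v₂' v₃' u₁' u₂' u₃' : ℝ) :
    sliceForm κ t ![vec6 v₁ v₂ v₃ u₁ u₂ u₃, vec6 v₁' v₂' v₃' u₁' u₂' u₃']
      = - kf κ t * (v₁ * u₁' - v₁' * u₁)
        + kp κ t * (v₂ * u₂' - v₂' * u₂ + v₃ * u₃' - v₃' * u₃)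
        + kq κ t * (v₂ * u₃' - v₂' * u₃ - v₃ * u₂' + v₃' * u₂)
        + kr κ t * (v₂ * v₃' - v₂' * v₃) + km κ t * (u₂ * u₃' - u₂' * u₃) := by
  have I := sliceForm_rotI hs hinv ht
  have Q := sliceForm_rotQuarter hs hinv ht
  have n2 := neg_vec6 0 1 0 0 0 0
  have n3 := neg_vec6 0 0 1 0 0 0
  have m2 := neg_vec6 0 0 0 0 1 0
  have m3 := neg_vec6 0 0 0 0 0 1
  simp only [neg_zero] at n2 n3 m2 m3
  set α := sliceForm κ t with hα
  have i1 := I 1 0 0 0 0 0 0 1 0 0 0 0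
  have i2 := I 1 0 0 0 0 0 0 0 1 0 0 0
  have i3 := I 1 0 0 0 0 0 0 0 0 0 1 0
  have i4 := I 1 0 0 0 0 0 0 0 0 0 0 1
  have j1 := I 0 0 0 1 0 0 0 1 0 0 0 0
  have j2 := I 0 0 0 1 0 0 0 0 1 0 0 0
  have j3 := I 0 0 0 1 0 0 0 0 0 0 1 0
  have j4 := I 0 0 0 1 0 0 0 0 0 0 0 1
  have q1 := Q 0 1 0 0 0 0 0 0 0 0 1 0
  have q2 := Q 0 1 0 0 0 0 0 0 0 0 0 1
  simp only [neg_zero, n2, n3, m2, m3, alt2_neg_right]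
    at i1 i2 i3 i4 j1 j2 j3 j4 q1 q2
  rw [vec6_eq v₁, vec6_eq v₁']
  simp only [alt2_add_left, alt2_add_right, alt2_smul_left, alt2_smul_right, alt2_self]
  rw [kf, kp, kq, kr, km, ← hα]
  have s (x y) := alt2_swap α x y
  have s1 := s (vec6 0 0 0 1 0 0) (vec6 1 0 0 0 0 0)
  have s2 := s (vec6 0 0 0 0 1 0) (vec6 0 1 0 0 0 0)
  have s3 := s (vec6 0 0 0 0 0 1) (vec6 0 0 1 0 0 0)
  have s4 := s (vec6 0 0 0 0 0 1) (vec6 0 1 0 0 0 0)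
  have s5 := s (vec6 0 0 0 0 1 0) (vec6 0 0 1 0 0 0)
  have s6 := s (vec6 0 0 1 0 0 0) (vec6 0 1 0 0 0 0)
  have s7 := s (vec6 0 0 0 0 0 1) (vec6 0 0 0 0 1 0)
  have t1 := s (vec6 0 1 0 0 0 0) (vec6 1 0 0 0 0 0)
  have t2 := s (vec6 0 0 1 0 0 0) (vec6 1 0 0 0 0 0)
  have t3 := s (vec6 0 0 0 0 1 0) (vec6 1 0 0 0 0 0)
  have t4 := s (vec6 0 0 0 0 0 1) (vec6 1 0 0 0 0 0)
  have t5 := s (vec6 0 1 0 0 0 0) (vec6 0 0 0 1 0 0)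
  have t6 := s (vec6 0 0 1 0 0 0) (vec6 0 0 0 1 0 0)
  have t7 := s (vec6 0 0 0 0 1 0) (vec6 0 0 0 1 0 0)
  have t8 := s (vec6 0 0 0 0 0 1) (vec6 0 0 0 1 0 0)
  have z {x : ℝ} (h : -x = x) : x = 0 := by linarith
  rw [t1, t2, t3, t4, t5, t6, t7, t8, z i1, z i2, z i3, z i4, z j1, z j2, z j3, z j4, s2, s3, s4,
    s5, s6, s7, q1, ← q2, s1]
  ring

lemma frameVec_eq_tanVec (t : ℝ) (c : Fin 6 → ℝ) : frameVec t c = tanVec (imQ t 0 0)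
    (vec6 (c 1) ((2 * √2)⁻¹ * (c 2 - c 4)) ((2 * √2)⁻¹ * (c 3 - c 5)) (c 0)
      (2 * t * (2 * √2)⁻¹ * c 5) (- (2 * t * (2 * √2)⁻¹ * c 4))) := by
  refine ambD_injective (gammaCurve t) ((ambD_frameVec t c).trans ?_)
  exact (ambD_tanVec (imQ t 0 0) (vec6 _ _ _ _ _ _)).symm

lemma inv_two_sqrt_two_sq : (2 * √2 : ℝ)⁻¹ ^ 2 = 1 / 8 := by
  rw [inv_pow, mul_pow, Real.sq_sqrt (by norm_num)]
  norm_num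

/-- The coefficient of `ω²`. -/
def coef₂ (κ : DiffForm modelTS3 TS3 2) (t : ℝ) : ℝ := kr κ t / 8

/-- The coefficient of `ω³`. -/
def coef₃ (κ : DiffForm modelTS3 TS3 2) (t : ℝ) : ℝ :=
  (kr κ t - 4 * t * kp κ t + 4 * t ^ 2 * km κ t) / 8

/-- The coefficient of `ω⁴`. -/
def coef₄ (κ : DiffForm modelTS3 TS3 2) (t : ℝ) : ℝ := - (t * kq κ t) / 4

/-- The coefficient of `ω⁵`. -/
def coef₅ (κ : DiffForm modelTS3 TS3 2) (t : ℝ) : ℝ := (- kr κ t + 2 * t * kp κ t) / 8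

lemma val_frameVec (hs : κ.SmoothOn (tube a)) (hinv : IsInvariantOn κ (tube a \ singularOrbit))
    (ht : ‖t‖ₑ < a) (c d : Fin 6 → ℝ) : κ.val (gammaCurve t) (frameVec t c) (frameVec t d)
      = invForm (kf κ t) (coef₂ κ t) (coef₃ κ t) (coef₄ κ t) (coef₅ κ t) c d := by
  rw [frameVec_eq_tanVec, frameVec_eq_tanVec, ← sliceForm_two, sliceForm_vec6 hs hinv ht]
  have h := inv_two_sqrt_two_sq
  generalize (2 * √2 : ℝ)⁻¹ = s at h
  rw [coef₂, coef₃, coef₄, coef₅]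
  simp only [invForm, coWedge]
  grind

lemma kf_neg (hs : κ.SmoothOn (tube a)) (hinv : IsInvariantOn κ (tube a \ singularOrbit))
    (ht : ‖t‖ₑ < a) : kf κ (-t) = kf κ t := by
  have h := sliceForm_rotJ hs hinv ht 0 0 0 1 0 0 1 0 0 0 0 0
  have n1 := neg_vec6 0 0 0 1 0 0
  have n2 := neg_vec6 1 0 0 0 0 0
  simp only [neg_zero] at h n1 n2
  rw [n1, n2, alt2_neg_right, alt2_neg_left, neg_neg] at h
  exact h

lemma kp_neg (hs : κ.SmoothOn (tube a)) (hinv : IsInvariantOn κ (tube a \ singularOrbit))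
    (ht : ‖t‖ₑ < a) : kp κ (-t) = kp κ t := by
  have h := sliceForm_rotJ hs hinv ht 0 1 0 0 0 0 0 0 0 0 1 0
  simp only [neg_zero] at h
  exact h

lemma kq_neg (hs : κ.SmoothOn (tube a)) (hinv : IsInvariantOn κ (tube a \ singularOrbit))
    (ht : ‖t‖ₑ < a) : kq κ (-t) = - kq κ t := by
  have h := sliceForm_rotJ hs hinv ht 0 1 0 0 0 0 0 0 0 0 0 1
  have n1 := neg_vec6 0 0 0 0 0 1
  simp only [neg_zero] at h n1
  rw [n1, alt2_neg_right] at h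
  rw [kq, kq]
  linarith

lemma kr_neg (hs : κ.SmoothOn (tube a)) (hinv : IsInvariantOn κ (tube a \ singularOrbit))
    (ht : ‖t‖ₑ < a) : kr κ (-t) = - kr κ t := by
  have h := sliceForm_rotJ hs hinv ht 0 1 0 0 0 0 0 0 1 0 0 0
  have n1 := neg_vec6 0 0 1 0 0 0
  simp only [neg_zero] at h n1
  rw [n1, alt2_neg_right] at h
  rw [kr, kr]
  linarith

lemma km_neg (hs : κ.SmoothOn (tube a)) (hinv : IsInvariantOn κ (tube a \ singularOrbit))
    (ht : ‖t‖ₑ < a) : km κ (-t) = - km κ t := by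
  have h := sliceForm_rotJ hs hinv ht 0 0 0 0 1 0 0 0 0 0 0 1
  have n1 := neg_vec6 0 0 0 0 0 1
  simp only [neg_zero] at h n1
  rw [n1, alt2_neg_right] at h
  rw [km, km]
  linarith

lemma kp_zero (ha : 0 < a) (hs : κ.SmoothOn (tube a))
    (hinv : IsInvariantOn κ (tube a \ singularOrbit)) : kp κ 0 = - kf κ 0 := by
  have h := val_tanVec_adj hs hinv rotCycle (w := imQ 0 0 0)
    (by rw [enorm_imQ, enorm_zero]; exact ha) (vec6 1 0 0 0 0 0) (vec6 0 0 0 1 0 0)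
  simp only [vec6, adj_rotCycle] at h
  rw [kp, kf, ← alt2_swap, sliceForm_two, sliceForm_two]
  exact h

lemma contDiffAt_coef (hs : κ.SmoothOn (tube a)) (ht : ‖t‖ₑ < a) :
    ContDiffAt ℝ ∞ (kf κ) t ∧ ContDiffAt ℝ ∞ (kp κ) t ∧ ContDiffAt ℝ ∞ (kq κ) t ∧
      ContDiffAt ℝ ∞ (kr κ) t ∧ ContDiffAt ℝ ∞ (km κ) t :=
  ⟨contDiffAt_sliceForm hs ht _, contDiffAt_sliceForm hs ht _, contDiffAt_sliceForm hs ht _,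
    contDiffAt_sliceForm hs ht _, contDiffAt_sliceForm hs ht _⟩

lemma contDiffAt_coef₂ (hs : κ.SmoothOn (tube a)) (ht : ‖t‖ₑ < a) :
    ContDiffAt ℝ ∞ (coef₂ κ) t :=
  (contDiffAt_coef hs ht).2.2.2.1.div_const _

lemma contDiffAt_coef₃ (hs : κ.SmoothOn (tube a)) (ht : ‖t‖ₑ < a) :
    ContDiffAt ℝ ∞ (coef₃ κ) t := by
  obtain ⟨-, h2, -, h4, h5⟩ := contDiffAt_coef hs ht
  unfold coef₃
  fun_prop

lemma contDiffAt_coef₄ (hs : κ.SmoothOn (tube a)) (ht : ‖t‖ₑ < a) :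
    ContDiffAt ℝ ∞ (coef₄ κ) t := by
  obtain ⟨-, -, h3, -, -⟩ := contDiffAt_coef hs ht
  unfold coef₄
  fun_prop

lemma contDiffAt_coef₅ (hs : κ.SmoothOn (tube a)) (ht : ‖t‖ₑ < a) :
    ContDiffAt ℝ ∞ (coef₅ κ) t := by
  obtain ⟨-, h2, -, h4, -⟩ := contDiffAt_coef hs ht
  unfold coef₅
  fun_prop

end Coefficients

section PointwiseRelations

lemma eq_zero_of_orthogonal_basis {W V : Type*} [AddCommGroup W] [Module ℝ W] [AddCommGroup V]
    [Module ℝ V] {n : ℕ} [FiniteDimensional ℝ W] (hW : Module.finrank ℝ W = n)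
    (g : W →ₗ[ℝ] W →ₗ[ℝ] ℝ) (hs : ∀ v w, g v w = g w v) (hp : ∀ v, v ≠ 0 → 0 < g v v)
    (e : Fin n → W) (he : ∀ i, e i ≠ 0) (ho : ∀ i j, i < j → g (e i) (e j) = 0) {f : W →ₗ[ℝ] V}
    (hf : ∀ i, f (e i) = 0) : f = 0 := by
  refine LinearMap.ext fun x => ?_
  have ho' (i j : Fin n) (h : i ≠ j) : g (e i) (e j) = 0 := by
    rcases lt_or_gt_of_ne h with h | h
    · exact ho i j h
    · rw [hs, ho j i h]
  have h0 : x - ∑ i, (g x (e i) / g (e i) (e i)) • e i = 0 := by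
    refine eq_zero_of_orthogonal hW g hs hp e he ho fun j => ?_
    rw [map_sub, map_sum, LinearMap.sub_apply, LinearMap.sum_apply, Finset.sum_eq_single j]
    · rw [map_smul, LinearMap.smul_apply, smul_eq_mul, div_mul_cancel₀ _ (hp _ (he j)).ne', sub_self]
    · intro i _ hij
      rw [map_smul, LinearMap.smul_apply, ho' i j hij, smul_zero]
    · simp
  have h1 := congrArg f h0
  rw [map_sub, map_sum, map_zero, sub_eq_zero] at h1
  rw [h1]
  refine Finset.sum_eq_zero fun i _ => ?_
  rw [map_smul, hf, smul_zero]

lemma invForm_add_left (x₁ x₂ x₃ x₄ x₅ : ℝ) (c c' d : Fin 6 → ℝ) :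
    invForm x₁ x₂ x₃ x₄ x₅ (c + c') d = invForm x₁ x₂ x₃ x₄ x₅ c d + invForm x₁ x₂ x₃ x₄ x₅ c' d := by
  simp only [invForm, coWedge, Pi.add_apply]; ring

lemma invForm_smul_left (x₁ x₂ x₃ x₄ x₅ r : ℝ) (c d : Fin 6 → ℝ) :
    invForm x₁ x₂ x₃ x₄ x₅ (r • c) d = r * invForm x₁ x₂ x₃ x₄ x₅ c d := by
  simp only [invForm, coWedge, Pi.smul_apply, smul_eq_mul]; ring

lemma invForm_swap (x₁ x₂ x₃ x₄ x₅ : ℝ) (c d : Fin 6 → ℝ) :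
    invForm x₁ x₂ x₃ x₄ x₅ c d = - invForm x₁ x₂ x₃ x₄ x₅ d c := by
  simp only [invForm, coWedge]; ring

/-- The bilinear form `invForm`. -/
def invBilin (x₁ x₂ x₃ x₄ x₅ : ℝ) : (Fin 6 → ℝ) →ₗ[ℝ] (Fin 6 → ℝ) →ₗ[ℝ] ℝ :=
  LinearMap.mk₂ ℝ (invForm x₁ x₂ x₃ x₄ x₅)
    (invForm_add_left x₁ x₂ x₃ x₄ x₅)
    (fun r c d => invForm_smul_left x₁ x₂ x₃ x₄ x₅ r c d)
    (fun c d d' => by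
      rw [invForm_swap, invForm_add_left, invForm_swap _ _ _ _ _ d, invForm_swap _ _ _ _ _ d']
      ring)
    (fun r c d => by
      rw [invForm_swap, invForm_smul_left, invForm_swap _ _ _ _ _ d, smul_eq_mul]
      ring)

lemma invBilin_apply (x₁ x₂ x₃ x₄ x₅ : ℝ) (c d : Fin 6 → ℝ) :
    invBilin x₁ x₂ x₃ x₄ x₅ c d = invForm x₁ x₂ x₃ x₄ x₅ c d := rfl

/-- The wedge pairing of two 2-forms, evaluated on four vectors. -/
def wedgePair {W : Type*} (η ζ : W → W → ℝ) (a b c d : W) : ℝ :=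
  η a b * ζ c d + η c d * ζ a b - η a c * ζ b d - η b d * ζ a c + η a d * ζ b c + η b c * ζ a d

lemma wedgePair_invForm (y₂ y₃ y₄ y₅ z₂ z₃ z₄ z₅ : ℝ) (a b c d : Fin 6 → ℝ) :
    wedgePair (invForm 0 y₂ y₃ y₄ y₅) (invForm 0 z₂ z₃ z₄ z₅) a b c d
      = wedgePair (coWedge 2 3) (coWedge 4 5) a b c d
        * (y₂ * z₃ + y₃ * z₂ - 2 * y₄ * z₄ - 2 * y₅ * z₅) := by
  simp only [wedgePair, invForm, coWedge]
  ring

variable {g : (Fin 6 → ℝ) →ₗ[ℝ] (Fin 6 → ℝ) →ₗ[ℝ] ℝ} {J D : (Fin 6 → ℝ) →ₗ[ℝ] Fin 6 → ℝ}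
  {f₁ f₂ f₃ f₄ f₅ : ℝ}

lemma J_unit (hp : ∀ v, v ≠ 0 → 0 < g v v) (hJ : ∀ v, J (J v) = -v)
    (hu : ∀ c, g ![1, 0, 0, 0, 0, 0] c = c 0)
    (hκ : ∀ c d, invForm f₁ f₂ f₃ f₄ f₅ c d = g (J c) d) :
    f₁ ≠ 0 ∧ J ![1, 0, 0, 0, 0, 0] = f₁⁻¹ • ![0, 1, 0, 0, 0, 0] := by
  have hf : f₁ ≠ 0 := by
    intro h
    have h0 : J ![1, 0, 0, 0, 0, 0] ≠ 0 := by
      intro h0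
      have := hJ ![1, 0, 0, 0, 0, 0]
      rw [h0, map_zero] at this
      have := congrFun this 0
      simp at this
    have h1 := hp _ h0
    rw [← hκ, h] at h1
    simp [invForm, coWedge] at h1
  refine ⟨hf, ?_⟩
  have h1 : J ![0, 1, 0, 0, 0, 0] = -f₁ • ![1, 0, 0, 0, 0, 0] := by
    by_contra h
    have h2 := hp _ (sub_ne_zero.2 h)
    set d := J ![0, 1, 0, 0, 0, 0] - -f₁ • ![1, 0, 0, 0, 0, 0] with hd
    have h3 : g d d = 0 := by
      nth_rewrite 1 [hd]
      rw [LinearMap.map_sub₂, LinearMap.map_smul₂, hu, ← hκ]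
      simp [invForm, coWedge]
    exact h2.ne' h3
  have h2 := hJ ![0, 1, 0, 0, 0, 0]
  rw [h1, map_smul] at h2
  have h3 : f₁ • J ![1, 0, 0, 0, 0, 0] = ![0, 1, 0, 0, 0, 0] := by
    rw [neg_smul] at h2
    exact neg_injective h2
  rw [← h3, smul_smul, inv_mul_cancel₀ hf, one_smul]

lemma pointwise_relations {x₂ x₃ x₄ x₅ y₂ y₃ y₄ y₅ : ℝ}
    (hs : ∀ v w, g v w = g w v) (hp : ∀ v, v ≠ 0 → 0 < g v v)
    (hJ : ∀ v, J (J v) = -v) (hgJ : ∀ v w, g (J v) w = - g v (J w))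
    (hD : ∀ v w, g (D v) w = - g v (D w)) (hDJ : ∀ v, D (J v) = - J (D v))
    (hu : ∀ c, g ![1, 0, 0, 0, 0, 0] c = c 0) (hDu : D ![1, 0, 0, 0, 0, 0] = 0)
    (hne : ∃ v, D v ≠ 0)
    (hκ : ∀ c d, invForm f₁ f₂ f₃ f₄ f₅ c d = g (J c) d)
    (hσ : ∀ c d, invForm 0 x₂ x₃ x₄ x₅ c d = 3 * g (D c) d)
    (hτ : ∀ c d, invForm 0 0 0 (2 * f₅ / f₁) (-2 * f₄ / f₁) c d = 3 * g (D c) (J d))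
    (hN : ∀ c d, c 0 = 0 → c 1 = 0 → d 0 = 0 → d 1 = 0 →
      invForm 0 y₂ y₃ y₄ y₅ c d + invForm 0 y₂ y₃ y₄ y₅ (J c) (J d)
        = 4 * (3 * g (D (D d)) (J c) - 3 * g (D (D c)) (J d))) :
    ∃ lam a b : ℝ, 0 < lam ∧ y₂ + 12 * lam * f₂ = a * x₂ ∧ y₃ + 12 * lam * f₃ = a * x₃ ∧
      y₄ + 12 * lam * f₄ = a * x₄ + b * (2 * f₅ / f₁) ∧
      y₅ + 12 * lam * f₅ = a * x₅ + b * (-2 * f₄ / f₁) ∧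
      f₂ * x₃ + f₃ * x₂ - 2 * f₄ * x₄ - 2 * f₅ * x₅ = 0 ∧ x₄ * f₅ = x₅ * f₄ ∧
      x₂ * x₃ - x₄ ^ 2 - x₅ ^ 2 = -4 * (f₄ ^ 2 + f₅ ^ 2) / f₁ ^ 2 ∧
      -4 * (f₄ ^ 2 + f₅ ^ 2) / f₁ ^ 2 = 9 * lam * (f₂ * f₃ - f₄ ^ 2 - f₅ ^ 2) ∧
      f₂ * f₃ - f₄ ^ 2 - f₅ ^ 2 ≠ 0 := by
  obtain ⟨hf₁, hJu⟩ := J_unit hp hJ hu hκ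
  have hW : Module.finrank ℝ (Fin 6 → ℝ) = 6 := by simp
  obtain ⟨v₁, v₂, lam, n, hlam, hn, d1, d2, u1, ju1, u2, ju2, g11, g22, g12, g1J2⟩ :=
    exists_adapted_basis hW g hs hp J hJ hgJ D hD hDJ (u := ![1, 0, 0, 0, 0, 0]) (by rw [hu]; rfl)
      hDu hne
  have hc0 (c : Fin 6 → ℝ) (h : g ![1, 0, 0, 0, 0, 0] c = 0) : c 0 = 0 := (hu c).symm.trans h
  have hc1 (c : Fin 6 → ℝ) (h : g (J ![1, 0, 0, 0, 0, 0]) c = 0) : c 1 = 0 := by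
    rw [← hκ] at h
    simpa [invForm, coWedge, hf₁] using h
  have p10 := hc0 v₁ u1
  have p11 := hc1 v₁ ju1
  have p20 := hc0 v₂ u2
  have p21 := hc1 v₂ ju2
  have uj1 : g ![1, 0, 0, 0, 0, 0] (J v₁) = 0 := by have := hgJ ![1, 0, 0, 0, 0, 0] v₁; linarith
  have uj2 : g ![1, 0, 0, 0, 0, 0] (J v₂) = 0 := by have := hgJ ![1, 0, 0, 0, 0, 0] v₂; linarith
  have juj1 : g (J ![1, 0, 0, 0, 0, 0]) (J v₁) = 0 := by rw [hgJ, hJ, map_neg, u1]; simp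
  have juj2 : g (J ![1, 0, 0, 0, 0, 0]) (J v₂) = 0 := by rw [hgJ, hJ, map_neg, u2]; simp
  have q10 := hc0 _ uj1
  have q11 := hc1 _ juj1
  have q20 := hc0 _ uj2
  have q21 := hc1 _ juj2
  have gJself (v : Fin 6 → ℝ) : g v (J v) = 0 := by
    have h1 := hgJ v v
    rw [hs] at h1
    linarith
  have gJJ (v w : Fin 6 → ℝ) : g (J v) (J w) = g v w := by rw [hgJ, hJ, map_neg, neg_neg]
  have g21 : g v₂ v₁ = 0 := by rw [hs, g12]
  have gJ12 : g (J v₁) v₂ = 0 := by rw [hgJ, g1J2, neg_zero]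
  have g2J1 : g v₂ (J v₁) = 0 := by rw [hs, gJ12]
  have gJ21 : g (J v₂) v₁ = 0 := by rw [hs, g1J2]
  have gJs (v : Fin 6 → ℝ) : g (J v) v = 0 := by rw [hs, gJself]
  have dJ1 : D (J v₁) = - J v₂ := by rw [hDJ, d1]
  have dJ2 : D (J v₂) = lam • J v₁ := by rw [hDJ, d2, map_smul, neg_smul, neg_neg]
  have dd1 : D (D v₁) = -lam • v₁ := by rw [d1, d2]
  have dd2 : D (D v₂) = -lam • v₂ := by rw [d2, map_smul, d1]
  have ddJ1 : D (D (J v₁)) = -lam • J v₁ := by rw [dJ1, map_neg, dJ2, neg_smul]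
  have ddJ2 : D (D (J v₂)) = -lam • J v₂ := by rw [dJ2, map_smul, dJ1, smul_neg, neg_smul]
  have κ0 (c d : Fin 6 → ℝ) (hc : c 0 = 0) (hd : d 0 = 0) :
      invForm 0 f₂ f₃ f₄ f₅ c d = g (J c) d := by
    rw [← hκ]
    simp [invForm, coWedge, hc, hd]
  have hm (r : ℝ) (v w : Fin 6 → ℝ) : g (r • v) w = r * g v w := by simp
  have hng (v w : Fin 6 → ℝ) : g (-v) w = - g v w := by simp
  have hng' (v w : Fin 6 → ℝ) : g v (-w) = - g v w := by simp
  -- the table of the Kähler form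
  have k01 : invForm 0 f₂ f₃ f₄ f₅ v₁ (J v₁) = n := by rw [κ0 _ _ p10 q10, gJJ, g11]
  have k02 : invForm 0 f₂ f₃ f₄ f₅ v₁ v₂ = 0 := by rw [κ0 _ _ p10 p20, gJ12]
  have k03 : invForm 0 f₂ f₃ f₄ f₅ v₁ (J v₂) = 0 := by rw [κ0 _ _ p10 q20, gJJ, g12]
  have k12 : invForm 0 f₂ f₃ f₄ f₅ (J v₁) v₂ = 0 := by rw [κ0 _ _ q10 p20, hJ, hng, g12, neg_zero]
  have k13 : invForm 0 f₂ f₃ f₄ f₅ (J v₁) (J v₂) = 0 := by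
    rw [κ0 _ _ q10 q20, hJ, hng, g1J2, neg_zero]
  have k23 : invForm 0 f₂ f₃ f₄ f₅ v₂ (J v₂) = lam * n := by rw [κ0 _ _ p20 q20, gJJ, g22]
  -- the table of `σ`
  have s01 : invForm 0 x₂ x₃ x₄ x₅ v₁ (J v₁) = 0 := by rw [hσ, d1, g2J1, mul_zero]
  have s02 : invForm 0 x₂ x₃ x₄ x₅ v₁ v₂ = 3 * (lam * n) := by rw [hσ, d1, g22]
  have s03 : invForm 0 x₂ x₃ x₄ x₅ v₁ (J v₂) = 0 := by rw [hσ, d1, gJself, mul_zero]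
  have s12 : invForm 0 x₂ x₃ x₄ x₅ (J v₁) v₂ = 0 := by rw [hσ, dJ1, hng, gJs, neg_zero, mul_zero]
  have s13 : invForm 0 x₂ x₃ x₄ x₅ (J v₁) (J v₂) = - (3 * (lam * n)) := by
    rw [hσ, dJ1, hng, gJJ, g22]; ring
  have s23 : invForm 0 x₂ x₃ x₄ x₅ v₂ (J v₂) = 0 := by rw [hσ, d2, hm, g1J2, mul_zero, mul_zero]
  -- the table of `τ`
  set T := invForm 0 0 0 (2 * f₅ / f₁) (-2 * f₄ / f₁) with hT
  have t01 : T v₁ (J v₁) = 0 := by rw [hτ, d1, hJ, hng', g21, neg_zero, mul_zero]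
  have t02 : T v₁ v₂ = 0 := by rw [hτ, d1, gJself, mul_zero]
  have t03 : T v₁ (J v₂) = - (3 * (lam * n)) := by rw [hτ, d1, hJ, hng', g22]; ring
  have t12 : T (J v₁) v₂ = - (3 * (lam * n)) := by rw [hτ, dJ1, hng, gJJ, g22]; ring
  have t13 : T (J v₁) (J v₂) = 0 := by rw [hτ, dJ1, hJ, hng, hng', gJs]; simp
  have t23 : T v₂ (J v₂) = 0 := by rw [hτ, d2, hm, hJ, hng', g12]; simp
  -- the table of the remaining form
  have n01 : invForm 0 y₂ y₃ y₄ y₅ v₁ (J v₁) = - (12 * lam * n) := by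
    have h := hN v₁ (J v₁) p10 p11 q10 q11
    have e : invForm 0 y₂ y₃ y₄ y₅ (J v₁) (J (J v₁)) = invForm 0 y₂ y₃ y₄ y₅ v₁ (J v₁) := by
      rw [hJ, ← invBilin_apply, map_neg, invBilin_apply, invForm_swap, neg_neg]
    rw [e, ddJ1, dd1, hm, hm, gJJ, hJ, hng', g11] at h
    linarith
  have n23 : invForm 0 y₂ y₃ y₄ y₅ v₂ (J v₂) = - (12 * lam * (lam * n)) := by
    have h := hN v₂ (J v₂) p20 p21 q20 q21
    have e : invForm 0 y₂ y₃ y₄ y₅ (J v₂) (J (J v₂)) = invForm 0 y₂ y₃ y₄ y₅ v₂ (J v₂) := by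
      rw [hJ, ← invBilin_apply, map_neg, invBilin_apply, invForm_swap, neg_neg]
    rw [e, ddJ2, dd2, hm, hm, gJJ, hJ, hng', g22] at h
    linarith
  have n13 : invForm 0 y₂ y₃ y₄ y₅ (J v₁) (J v₂) = - invForm 0 y₂ y₃ y₄ y₅ v₁ v₂ := by
    have h := hN v₁ v₂ p10 p11 p20 p21
    rw [dd1, dd2, hm, hm, g2J1, g1J2] at h
    linarith
  have n12 : invForm 0 y₂ y₃ y₄ y₅ (J v₁) v₂ = invForm 0 y₂ y₃ y₄ y₅ v₁ (J v₂) := by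
    have h := hN v₁ (J v₂) p10 p11 q20 q21
    have e : invForm 0 y₂ y₃ y₄ y₅ (J v₁) (J (J v₂)) = - invForm 0 y₂ y₃ y₄ y₅ (J v₁) v₂ := by
      rw [hJ, ← invBilin_apply, map_neg, invBilin_apply]
    rw [e, dd1, ddJ2, hm, hm, gJJ, hJ, hng', g21, g12] at h
    linarith
  have hln : 3 * (lam * n) ≠ 0 := by positivity
  refine ⟨lam, invForm 0 y₂ y₃ y₄ y₅ v₁ v₂ / (3 * (lam * n)),
    - invForm 0 y₂ y₃ y₄ y₅ v₁ (J v₂) / (3 * (lam * n)), hlam, ?_⟩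
  set a := invForm 0 y₂ y₃ y₄ y₅ v₁ v₂ / (3 * (lam * n)) with ha
  set b := - invForm 0 y₂ y₃ y₄ y₅ v₁ (J v₂) / (3 * (lam * n)) with hb
  have ha' : invForm 0 y₂ y₃ y₄ y₅ v₁ v₂ = a * (3 * (lam * n)) := by rw [ha, div_mul_cancel₀ _ hln]
  have hb' : invForm 0 y₂ y₃ y₄ y₅ v₁ (J v₂) = - (b * (3 * (lam * n))) := by
    rw [hb, div_mul_cancel₀ _ hln, neg_neg]
  let r₂ := y₂ + 12 * lam * f₂ - a * x₂
  let r₃ := y₃ + 12 * lam * f₃ - a * x₃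
  let r₄ := y₄ + 12 * lam * f₄ - (a * x₄ + b * (2 * f₅ / f₁))
  let r₅ := y₅ + 12 * lam * f₅ - (a * x₅ + b * (-2 * f₄ / f₁))
  have hr (c d : Fin 6 → ℝ) : invForm 0 r₂ r₃ r₄ r₅ c d = invForm 0 y₂ y₃ y₄ y₅ c d
      + 12 * lam * invForm 0 f₂ f₃ f₄ f₅ c d - a * invForm 0 x₂ x₃ x₄ x₅ c d - b * T c d := by
    simp only [invForm, hT, r₂, r₃, r₄, r₅]
    ring
  have hzero : invBilin 0 r₂ r₃ r₄ r₅ = 0 := by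
    have r01 : invForm 0 r₂ r₃ r₄ r₅ v₁ (J v₁) = 0 := by rw [hr, n01, k01, s01, t01]; ring
    have r02 : invForm 0 r₂ r₃ r₄ r₅ v₁ v₂ = 0 := by rw [hr, ha', k02, s02, t02]; ring
    have r03 : invForm 0 r₂ r₃ r₄ r₅ v₁ (J v₂) = 0 := by rw [hr, hb', k03, s03, t03]; ring
    have r12 : invForm 0 r₂ r₃ r₄ r₅ (J v₁) v₂ = 0 := by rw [hr, n12, hb', k12, s12, t12]; ring
    have r13 : invForm 0 r₂ r₃ r₄ r₅ (J v₁) (J v₂) = 0 := by rw [hr, n13, ha', k13, s13, t13]; ring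
    have r23 : invForm 0 r₂ r₃ r₄ r₅ v₂ (J v₂) = 0 := by rw [hr, n23, k23, s23, t23]; ring
    have ru (c : Fin 6 → ℝ) : invForm 0 r₂ r₃ r₄ r₅ ![1, 0, 0, 0, 0, 0] c = 0 := by
      simp [invForm, coWedge]
    have rju (c : Fin 6 → ℝ) : invForm 0 r₂ r₃ r₄ r₅ (J ![1, 0, 0, 0, 0, 0]) c = 0 := by
      rw [hJu]; simp [invForm, coWedge]
    have rs (c : Fin 6 → ℝ) : invForm 0 r₂ r₃ r₄ r₅ c c = 0 := by
      have := invForm_swap 0 r₂ r₃ r₄ r₅ c c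
      linarith
    have rsw {c d : Fin 6 → ℝ} (h : invForm 0 r₂ r₃ r₄ r₅ c d = 0) :
        invForm 0 r₂ r₃ r₄ r₅ d c = 0 := by rw [invForm_swap, h, neg_zero]
    have hv1 : v₁ ≠ 0 := by rintro rfl; rw [map_zero] at g11; exact hn.ne g11
    have hv2 : v₂ ≠ 0 := by rintro rfl; rw [map_zero] at g22; exact (by positivity : 0 < lam * n).ne g22
    have hu0 : (![1, 0, 0, 0, 0, 0] : Fin 6 → ℝ) ≠ 0 := fun h => by simpa using congrFun h 0
    have hJ0 {v : Fin 6 → ℝ} (hv : v ≠ 0) : J v ≠ 0 := by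
      intro h
      have := hJ v
      rw [h, map_zero] at this
      exact hv (neg_eq_zero.1 this.symm)
    have he : ∀ i : Fin 6, (![![1, 0, 0, 0, 0, 0], J ![1, 0, 0, 0, 0, 0], v₁, J v₁, v₂, J v₂] :
        Fin 6 → Fin 6 → ℝ) i ≠ 0 := by
      intro i
      fin_cases i
      exacts [hu0, hJ0 hu0, hv1, hJ0 hv1, hv2, hJ0 hv2]
    have ho : ∀ i j : Fin 6, i < j → g ((![![1, 0, 0, 0, 0, 0], J ![1, 0, 0, 0, 0, 0], v₁, J v₁, v₂,
        J v₂] : Fin 6 → Fin 6 → ℝ) i) ((![![1, 0, 0, 0, 0, 0], J ![1, 0, 0, 0, 0, 0], v₁, J v₁, v₂,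
        J v₂] : Fin 6 → Fin 6 → ℝ) j) = 0 := by
      have gJJ12 : g (J v₁) (J v₂) = 0 := by rw [gJJ, g12]
      intro i j hij
      fin_cases i <;> fin_cases j <;> first | exact absurd hij (by decide) | skip
      exacts [gJself _, u1, uj1, u2, uj2, ju1, juj1, ju2, juj2, gJself _, g12, g1J2, gJ12, gJJ12,
        gJself _]
    refine eq_zero_of_orthogonal_basis hW g hs hp _ he ho fun i => ?_
    refine eq_zero_of_orthogonal_basis hW g hs hp _ he ho fun j => ?_
    change invForm 0 r₂ r₃ r₄ r₅ _ _ = 0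
    fin_cases i
    · exact ru _
    · exact rju _
    · fin_cases j
      exacts [rsw (ru _), rsw (rju _), rs _, r01, r02, r03]
    · fin_cases j
      exacts [rsw (ru _), rsw (rju _), rsw r01, rs _, r12, r13]
    · fin_cases j
      exacts [rsw (ru _), rsw (rju _), rsw r02, rsw r12, rs _, r23]
    · fin_cases j
      exacts [rsw (ru _), rsw (rju _), rsw r03, rsw r13, rsw r23, rs _]
  have hz (c d : Fin 6 → ℝ) : invForm 0 r₂ r₃ r₄ r₅ c d = 0 := by
    rw [← invBilin_apply, hzero]; rfl
  have z2 := hz ![0, 0, 1, 0, 0, 0] ![0, 0, 0, 1, 0, 0]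
  have z3 := hz ![0, 0, 0, 0, 1, 0] ![0, 0, 0, 0, 0, 1]
  have z4 := hz ![0, 0, 1, 0, 0, 0] ![0, 0, 0, 0, 1, 0]
  have z5 := hz ![0, 0, 1, 0, 0, 0] ![0, 0, 0, 0, 0, 1]
  simp only [invForm, coWedge, cons6_0, cons6_1, cons6_2, cons6_3, cons6_4, cons6_5] at z2 z3 z4 z5
  -- the pairings
  have pωω := wedgePair_invForm f₂ f₃ f₄ f₅ f₂ f₃ f₄ f₅ v₁ (J v₁) v₂ (J v₂)
  have pωα := wedgePair_invForm f₂ f₃ f₄ f₅ x₂ x₃ x₄ x₅ v₁ (J v₁) v₂ (J v₂)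
  have pαα := wedgePair_invForm x₂ x₃ x₄ x₅ x₂ x₃ x₄ x₅ v₁ (J v₁) v₂ (J v₂)
  have pατ := wedgePair_invForm x₂ x₃ x₄ x₅ 0 0 (2 * f₅ / f₁) (-2 * f₄ / f₁) v₁ (J v₁) v₂ (J v₂)
  have pττ := wedgePair_invForm 0 0 (2 * f₅ / f₁) (-2 * f₄ / f₁) 0 0 (2 * f₅ / f₁) (-2 * f₄ / f₁)
    v₁ (J v₁) v₂ (J v₂)
  generalize wedgePair (coWedge 2 3) (coWedge 4 5) v₁ (J v₁) v₂ (J v₂) = δ at *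
  rw [← hT] at pττ pατ
  simp only [wedgePair, k01, k02, k03, k12, k13, k23, s01, s02, s03, s12, s13, s23, t01, t02, t03,
    t12, t13, t23] at pωω pωα pαα pατ pττ
  have hδ : δ ≠ 0 := by
    rintro rfl
    have : 0 < n * (lam * n) := by positivity
    linarith
  refine ⟨by linarith, by linarith, by linarith, by linarith, ?_, ?_, ?_, ?_, ?_⟩
  · refine mul_left_cancel₀ hδ ?_
    linarith
  · refine mul_left_cancel₀ hδ ?_
    field_simp at pατ
    linarith
  · refine mul_left_cancel₀ hδ ?_
    have e : δ * (-4 * (f₄ ^ 2 + f₅ ^ 2) / f₁ ^ 2)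
        = δ * (0 * 0 + 0 * 0 - 2 * (2 * f₅ / f₁) * (2 * f₅ / f₁)
          - 2 * (-2 * f₄ / f₁) * (-2 * f₄ / f₁)) / 2 := by
      field_simp
      ring
    rw [e, ← pττ]
    linarith
  · refine mul_left_cancel₀ hδ ?_
    have e : δ * (-4 * (f₄ ^ 2 + f₅ ^ 2) / f₁ ^ 2)
        = δ * (0 * 0 + 0 * 0 - 2 * (2 * f₅ / f₁) * (2 * f₅ / f₁)
          - 2 * (-2 * f₄ / f₁) * (-2 * f₄ / f₁)) / 2 := by
      field_simp
      ring
    rw [e, ← pττ]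
    linear_combination (9 * lam / 2) * pωω
  · intro h
    have h1 : f₂ * f₃ + f₃ * f₂ - 2 * f₄ * f₄ - 2 * f₅ * f₅ = 0 := by linarith
    rw [h1, mul_zero] at pωω
    have : 0 < n * (lam * n) := by positivity
    linarith

end PointwiseRelations

section TypeOfDifferential

open IsNearlyKahlerWith

variable {E : Type*} [NormedAddCommGroup E] [NormedSpace ℝ E]
  {H : Type*} [TopologicalSpace H] {I : ModelWithCorners ℝ E H}
  {M : Type*} [TopologicalSpace M] [ChartedSpace H M]
  [I.Boundaryless] [IsManifold I ∞ M] [FiniteDimensional ℝ E]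
  {cov : (∀ x : M, TangentSpace I x) → ∀ x : M, TangentSpace I x →L[ℝ] TangentSpace I x}
  {U : Set M} {p : M}
  {g : ∀ x : M, TangentSpace I x →L[ℝ] TangentSpace I x →L[ℝ] ℝ}
  {J : ∀ x : M, TangentSpace I x →L[ℝ] TangentSpace I x} {κ : DiffForm I M 2}

/-- Differentiability of a vector field at a point. -/
abbrev FieldDiffAt (X : ∀ q : M, TangentSpace I q) (p : M) : Prop := MDiffAt (T% X) p

lemma val₃_endoAt (h : IsNearlyKahlerWith g J cov U) (hp : p ∈ U)
    (hK : ∀ p ∈ U, ∀ v w : TangentSpace I p, κ p ![v, w] = g p (J p v) w) (hκ : κ.DiffAt p)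
    (x y z : E) : κ.d.val₃ p (endoAt J p x) y z = κ.d.val₃ p x (endoAt J p y) z := by
  rw [d_apply h hp hK hκ, d_apply h hp hK hκ, nablaJ_skew h hp, nablaJ_J h hp, nablaJ_J h hp,
    neg_neg, nablaJ_skew h hp y x, map_neg]

lemma exists_val₃_ne_zero (h : IsNearlyKahlerWith g J cov U) (hp : p ∈ U)
    (hK : ∀ p ∈ U, ∀ v w : TangentSpace I p, κ p ![v, w] = g p (J p v) w) (hκ : κ.DiffAt p)
    (hstrict : ∀ x ∈ U, ∀ v : TangentSpace I x, v ≠ 0 →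
      ∃ Y : ∀ x : M, TangentSpace I x, MDiffAt (T% Y) x ∧
        cov (fun y => J y (Y y)) x v - J x (cov Y x v) ≠ 0) {v : E} (hv : v ≠ 0) :
    ∃ x y : E, nablaJ J cov p v x ≠ 0 ∧ κ.d.val₃ p v x y ≠ 0 := by
  obtain ⟨Y, hY, hne⟩ := hstrict p hp v hv
  have e := nablaJ_field h hp hY v
  obtain ⟨y, hy⟩ : ∃ y : E, nablaJ J cov p v y ≠ 0 := ⟨Y p, fun h0 => hne (e.trans h0)⟩
  refine ⟨y, nablaJ J cov p v y, hy, ?_⟩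
  rw [d_apply h hp hK hκ]
  have h2 : 0 < bilinAt g p (nablaJ J cov p v y) (nablaJ J cov p v y) := h.metric.pos p hp _ hy
  positivity

lemma val_endoAt_pos (h : IsNearlyKahlerWith g J cov U) (hp : p ∈ U)
    (hK : ∀ p ∈ U, ∀ v w : TangentSpace I p, κ p ![v, w] = g p (J p v) w) {v : E} (hv : v ≠ 0) :
    0 < κ.val p v (endoAt J p v) := by
  have e : κ.val p v (endoAt J p v) = bilinAt g p v v :=
    (hK p hp _ _).trans (h.hermitian p hp _ _)
  rw [e]
  exact h.metric.pos p hp v hv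

/-- The value of a form, on the model space. -/
def DiffForm.formAt {k : ℕ} (η : DiffForm I M k) (p : M) : E [⋀^Fin k]→L[ℝ] ℝ := η p

lemma isStableForm_d (hE : Module.finrank ℝ E = 6) (h : IsNearlyKahlerWith g J cov U) (hp : p ∈ U)
    (hK : ∀ p ∈ U, ∀ v w : TangentSpace I p, κ p ![v, w] = g p (J p v) w) (hκ : κ.DiffAt p)
    (hstrict : ∀ x ∈ U, ∀ v : TangentSpace I x, v ≠ 0 →
      ∃ Y : ∀ x : M, TangentSpace I x, MDiffAt (T% Y) x ∧
        cov (fun y => J y (Y y)) x v - J x (cov Y x v) ≠ 0) : IsStableForm (κ.d.formAt p) := by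
  refine isStableForm_of_type hE (endoAt J p : E →ₗ[ℝ] E) (endoAt_sq h hp)
    (val₃_endoAt h hp hK hκ) fun h0 => ?_
  have : Nontrivial E := Module.nontrivial_of_finrank_pos (R := ℝ) (by omega)
  obtain ⟨v, hv⟩ := exists_ne (0 : E)
  obtain ⟨x, y, -, hxy⟩ := exists_val₃_ne_zero h hp hK hκ hstrict hv
  exact hxy (DFunLike.congr_fun h0 ![v, x, y])

end TypeOfDifferential

section Invariance

open IsNearlyKahlerWith

variable {a : ℝ≥0∞} {κ : DiffForm modelTS3 TS3 2}
  {cov : (∀ x : TS3, TangentSpace modelTS3 x) →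
    ∀ x : TS3, TangentSpace modelTS3 x →L[ℝ] TangentSpace modelTS3 x}
  {g : ∀ x : TS3, TangentSpace modelTS3 x →L[ℝ] TangentSpace modelTS3 x →L[ℝ] ℝ}
  {J : ∀ x : TS3, TangentSpace modelTS3 x →L[ℝ] TangentSpace modelTS3 x}

lemma adj_ne_zero (q : SU2) {w : imH} (hw : w ≠ 0) : adj q w ≠ 0 := by
  rw [← norm_ne_zero_iff, norm_adj, norm_ne_zero_iff]
  exact hw

lemma endoAt_act (hs : κ.SmoothOn (tube a)) (hinv : IsInvariantOn κ (tube a \ singularOrbit))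
    (h : IsNearlyKahlerWith g J cov (tube a \ singularOrbit))
    (hK : ∀ p ∈ tube a \ singularOrbit, ∀ v w : TangentSpace modelTS3 p,
      κ p ![v, w] = g p (J p v) w)
    (hstrict : ∀ x ∈ tube a \ singularOrbit, ∀ v : TangentSpace modelTS3 x, v ≠ 0 →
      ∃ Y : ∀ x : TS3, TangentSpace modelTS3 x, FieldDiffAt Y x ∧
        cov (fun y => J y (Y y)) x v - J x (cov Y x v) ≠ 0)
    {w : imH} (hw : ‖w‖ₑ < a) (hw0 : w ≠ 0) (x : SU2 × SU2) (v : ModelE) :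
    endoAt J (act x (1, w)) (actD x (1, w) v) = actD x (1, w) (endoAt J (1, w) v) := by
  have hp : ((1, w) : TS3) ∈ tube a \ singularOrbit := ⟨hw, hw0⟩
  have hq : act x (1, w) ∈ tube a \ singularOrbit := ⟨act_mem_tube x hp.1, adj_ne_zero _ hw0⟩
  have hκp := hs.diffAt (isOpen_tube a) hp.1
  have hκq := hs.diffAt (isOpen_tube a) hq.1
  let A := actEquiv x (1, w)
  let J' : ModelE →ₗ[ℝ] ModelE :=
    A.symm.toLinearMap ∘ₗ (endoAt J (act x (1, w)) : ModelE →ₗ[ℝ] ModelE) ∘ₗ A.toLinearMap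
  have hAJ (v : ModelE) : actD x (1, w) (J' v) = endoAt J (act x (1, w)) (actD x (1, w) v) :=
    A.apply_symm_apply _
  have hd := d_invariant_slice hs hinv hw x
  have hi := hinv.invariantAlong hp x
  have key := complexStructure_unique (θ := κ.d.formAt (1, w)) (κ := κ.formAt (1, w))
    (fun v hv => by
      obtain ⟨x, y, -, hxy⟩ := exists_val₃_ne_zero h hp hK hκp hstrict hv
      exact ⟨x, y, hxy⟩)
    (endoAt J (1, w) : ModelE →ₗ[ℝ] ModelE) J' (endoAt_sq h hp)
    (fun v => A.injective (by
      refine (hAJ _).trans ?_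
      rw [hAJ, endoAt_sq h hq, map_neg]
      rfl))
    (val₃_endoAt h hp hK hκp)
    (fun v y z => by
      refine (hd _ _ _).symm.trans (Eq.trans ?_ (hd _ _ _))
      rw [hAJ, hAJ]
      exact val₃_endoAt h hq hK hκq _ _ _)
    (fun v hv => val_endoAt_pos h hp hK hv)
    (fun v hv => by
      change 0 < κ.val (1, w) v (J' v)
      rw [← hi, hAJ]
      exact val_endoAt_pos h hq hK fun h0 => hv (actD_injective x _ (h0.trans (map_zero _).symm)))
  rw [← hAJ]
  exact congrArg (actD x (1, w)) (LinearMap.congr_fun key v).symm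

/-- The radial unit vector field on the complement of the singular orbit. -/
def radialField (q : TS3) : TangentSpace modelTS3 q :=
  show ModelE from (0, ‖q.2‖⁻¹ • q.2)

lemma radialField_act (h : SU2 × SU2) (p : TS3) :
    actD h p (radialField p) = (radialField (act h p) : ModelE) := by
  refine ambD_injective _ ((ambD_actD h p _).trans ?_)
  refine Prod.ext ?_ ?_
  · change (h.1 : ℍ[ℝ]) * (sphD p.1 0) * _ = sphD _ 0
    rw [map_zero, map_zero, mul_zero, zero_mul]
  · change adj h.2 (‖p.2‖⁻¹ • p.2) = ‖adj h.2 p.2‖⁻¹ • adj h.2 p.2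
    rw [norm_adj, ← adjL_apply, ← adjL_apply, map_smul]

lemma mdifferentiableAt_radialField {p : TS3} (hp : p.2 ≠ 0) : FieldDiffAt radialField p := by
  refine mdifferentiableAt_coord.2 ?_
  have h1 : ∀ᶠ q in 𝓝 p, q ∈ (extChartAt modelTS3 p).source :=
    extChartAt_source_mem_nhds p
  have h2 : (fun q => (mfderiv modelTS3 𝓘(ℝ, ModelE) (extChartAt modelTS3 p) q : ModelE →L[ℝ] ModelE)
      (radialField q)) =ᶠ[𝓝 p] fun q => ((0 : EuclideanSpace ℝ (Fin 3)), ‖q.2‖⁻¹ • q.2) := by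
    filter_upwards [h1] with q hq
    let f : TS3 → ModelE := fun x => extChartAt modelTS3 p x
    have hfd : MDifferentiableAt modelTS3 𝓘(ℝ, ModelE) f q := mdifferentiableAt_extChartAt' hq
    have hq1 : q.1 ∈ (extChartAt (𝓡 3) p.1).source := by
      rw [extChartAt_prod] at hq
      exact hq.1
    have c1 := mfderiv_comp q
      (mdifferentiableAt_iff_differentiableAt.2 (differentiableAt_fst (𝕜 := ℝ) (p := f q))) hfd
    have c2 := mfderiv_comp q
      (mdifferentiableAt_iff_differentiableAt.2 (differentiableAt_snd (𝕜 := ℝ) (p := f q))) hfd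
    rw [mfderiv_eq_fderiv, fderiv_fst] at c1
    rw [mfderiv_eq_fderiv, fderiv_snd] at c2
    have c3 := mfderiv_comp q (mdifferentiableAt_extChartAt' hq1)
      (mdifferentiableAt_fst (I := 𝓡 3) (I' := 𝓘(ℝ, imH)))
    rw [mfderiv_fst] at c3
    refine Prod.ext ?_ ?_
    · refine (DFunLike.congr_fun c1 (radialField q)).symm.trans ?_
      refine (DFunLike.congr_fun c3 (radialField q)).trans ?_
      exact map_zero (show EuclideanSpace ℝ (Fin 3) →L[ℝ] EuclideanSpace ℝ (Fin 3) from
        mfderiv (𝓡 3) 𝓘(ℝ, EuclideanSpace ℝ (Fin 3)) (extChartAt (𝓡 3) p.1) q.1)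
    · refine (DFunLike.congr_fun c2 (radialField q)).symm.trans ?_
      exact DFunLike.congr_fun (mfderiv_snd (I := 𝓡 3) (I' := 𝓘(ℝ, imH))) (radialField q)
  refine MDifferentiableAt.congr_of_eventuallyEq ?_ h2
  have h3 : DifferentiableAt ℝ (fun w : imH => ((0 : EuclideanSpace ℝ (Fin 3)), ‖w‖⁻¹ • w)) p.2 :=
    (differentiableAt_const _).prodMk
      (((differentiableAt_id.norm ℝ hp).inv (norm_ne_zero_iff.2 hp)).smul differentiableAt_id)
  exact h3.mdifferentiableAt.comp p (contMDiff_snd_TS3.mdifferentiableAt one_ne_zero)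

end Invariance

section AlongGeodesic

open IsNearlyKahlerWith

lemma norm_imQ (t : ℝ) : ‖imQ t 0 0‖ = |t| := by
  have := congrArg ENNReal.toReal (enorm_imQ t)
  rwa [toReal_enorm, toReal_enorm] at this

lemma imQ_ne_zero {t : ℝ} (ht : t ≠ 0) : imQ t 0 0 ≠ 0 := by
  rw [← norm_ne_zero_iff, norm_imQ]
  exact abs_ne_zero.2 ht

lemma gammaCurve_mem_tube {a : ℝ≥0∞} {t : ℝ} (ht : ‖t‖ₑ < a) : gammaCurve t ∈ tube a := by
  change ‖imQ t 0 0‖ₑ < a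
  rwa [enorm_imQ]

lemma gammaCurve_mem {a : ℝ≥0∞} {t : ℝ} (ht : ‖t‖ₑ < a) (h0 : t ≠ 0) :
    gammaCurve t ∈ tube a \ singularOrbit := ⟨gammaCurve_mem_tube ht, imQ_ne_zero h0⟩

lemma isOpen_enorm_lt (a : ℝ≥0∞) : IsOpen {t : ℝ | ‖t‖ₑ < a} :=
  isOpen_lt continuous_enorm continuous_const

lemma frameVec_add (t : ℝ) (c d : Fin 6 → ℝ) : frameVec t (c + d) = frameVec t c + frameVec t d := by
  simp [frameVec, add_smul, Finset.sum_add_distrib]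

lemma frameVec_smul (t r : ℝ) (c : Fin 6 → ℝ) : frameVec t (r • c) = r • frameVec t c := by
  simp [frameVec, Finset.smul_sum, smul_smul]

/-- The frame along `γ` as a linear isomorphism. -/
def frameEquiv {t : ℝ} (ht : t ≠ 0) : (Fin 6 → ℝ) ≃ₗ[ℝ] ModelE :=
  LinearEquiv.ofBijective
    { toFun := frameVec t, map_add' := frameVec_add t, map_smul' := frameVec_smul t }
    ⟨frameVec_injective ht, (LinearMap.injective_iff_surjective_of_finrank_eq_finrank
      (by rw [finrank_modelE]; simp)).1 (frameVec_injective ht)⟩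

lemma frameEquiv_apply {t : ℝ} (ht : t ≠ 0) (c : Fin 6 → ℝ) : frameEquiv ht c = frameVec t c := rfl

/-- A bilinear form in the frame along `γ`. -/
def frameBilin (t : ℝ) (B : ModelE →L[ℝ] ModelE →L[ℝ] ℝ) : (Fin 6 → ℝ) →ₗ[ℝ] (Fin 6 → ℝ) →ₗ[ℝ] ℝ :=
  LinearMap.mk₂ ℝ (fun c d => B (frameVec t c) (frameVec t d))
    (fun c c' d => by rw [frameVec_add, map_add]; rfl)
    (fun r c d => by rw [frameVec_smul, map_smul]; rfl)
    (fun c d d' => by rw [frameVec_add, map_add])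
    (fun r c d => by rw [frameVec_smul, map_smul])

lemma frameBilin_apply (t : ℝ) (B : ModelE →L[ℝ] ModelE →L[ℝ] ℝ) (c d : Fin 6 → ℝ) :
    frameBilin t B c d = B (frameVec t c) (frameVec t d) := rfl

/-- An endomorphism in the frame along `γ`. -/
def frameEndo {t : ℝ} (ht : t ≠ 0) (L : ModelE →ₗ[ℝ] ModelE) : (Fin 6 → ℝ) →ₗ[ℝ] Fin 6 → ℝ :=
  (frameEquiv ht).symm.toLinearMap ∘ₗ L ∘ₗ (frameEquiv ht).toLinearMap

lemma frameVec_frameEndo {t : ℝ} (ht : t ≠ 0) (L : ModelE →ₗ[ℝ] ModelE) (c : Fin 6 → ℝ) :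
    frameVec t (frameEndo ht L c) = L (frameVec t c) := (frameEquiv ht).apply_symm_apply _

variable {a : ℝ≥0∞} {κ : DiffForm modelTS3 TS3 2}
  {cov : (∀ x : TS3, TangentSpace modelTS3 x) →
    ∀ x : TS3, TangentSpace modelTS3 x →L[ℝ] TangentSpace modelTS3 x}
  {g : ∀ x : TS3, TangentSpace modelTS3 x →L[ℝ] TangentSpace modelTS3 x →L[ℝ] ℝ}
  {J : ∀ x : TS3, TangentSpace modelTS3 x →L[ℝ] TangentSpace modelTS3 x}

/-- The hypotheses of the main theorem: an invariant strict nearly Kähler structure on the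
complement of the singular orbit, for which `γ` is a normal geodesic, with smooth Kähler form. -/
structure IsNormalNearlyKahler (a : ℝ≥0∞) (κ : DiffForm modelTS3 TS3 2)
    (g : ∀ x : TS3, TangentSpace modelTS3 x →L[ℝ] TangentSpace modelTS3 x →L[ℝ] ℝ)
    (J : ∀ x : TS3, TangentSpace modelTS3 x →L[ℝ] TangentSpace modelTS3 x)
    (cov : (∀ x : TS3, TangentSpace modelTS3 x) →
      ∀ x : TS3, TangentSpace modelTS3 x →L[ℝ] TangentSpace modelTS3 x) : Prop where
  smooth : κ.SmoothOn (tube a)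
  inv : IsInvariantOn κ (tube a \ singularOrbit)
  nk : IsNearlyKahlerWith g J cov (tube a \ singularOrbit)
  kahler : ∀ p ∈ tube a \ singularOrbit, ∀ v w : TangentSpace modelTS3 p,
    κ p ![v, w] = g p (J p v) w
  strict : ∀ x ∈ tube a \ singularOrbit, ∀ v : TangentSpace modelTS3 x, v ≠ 0 →
    ∃ Y : ∀ x : TS3, TangentSpace modelTS3 x, FieldDiffAt Y x ∧
      cov (fun y => J y (Y y)) x v - J x (cov Y x v) ≠ 0
  unit : ∀ t : ℝ, t ≠ 0 → ‖t‖ₑ < a → g (gammaCurve t) (xiVec t) (xiVec t) = 1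
  orth : ∀ t : ℝ, t ≠ 0 → ‖t‖ₑ < a → ∀ X : imH × imH,
    g (gammaCurve t) (xiVec t) (hatVec X (gammaCurve t)) = 0

/-- The coefficient of `ξ* ∧ ω²` in the differential. -/
def dcoef₂ (κ : DiffForm modelTS3 TS3 2) (t : ℝ) : ℝ := deriv (coef₂ κ) t + kf κ t / 4

/-- The coefficient of `ξ* ∧ ω³` in the differential. -/
def dcoef₃ (κ : DiffForm modelTS3 TS3 2) (t : ℝ) : ℝ := deriv (coef₃ κ) t - kf κ t / 4

/-- The coefficient of `ξ* ∧ ω⁴` in the differential. -/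
def dcoef₄ (κ : DiffForm modelTS3 TS3 2) (t : ℝ) : ℝ := deriv (coef₄ κ) t

/-- The coefficient of `ξ* ∧ ω⁵` in the differential. -/
def dcoef₅ (κ : DiffForm modelTS3 TS3 2) (t : ℝ) : ℝ := deriv (coef₅ κ) t

lemma contDiffAt_deriv_of_enorm {f : ℝ → ℝ} (hf : ∀ t : ℝ, ‖t‖ₑ < a → ContDiffAt ℝ ∞ f t) {t : ℝ}
    (ht : ‖t‖ₑ < a) : ContDiffAt ℝ ∞ (deriv f) t := by
  have h : ContDiffOn ℝ ∞ f {t : ℝ | ‖t‖ₑ < a} := fun t ht => (hf t ht).contDiffWithinAt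
  exact (h.deriv_of_isOpen (isOpen_enorm_lt a) (m := ∞) (by simp)).contDiffAt
    ((isOpen_enorm_lt a).mem_nhds ht)

lemma contDiffAt_dcoef (hs : κ.SmoothOn (tube a)) {t : ℝ} (ht : ‖t‖ₑ < a) :
    ContDiffAt ℝ ∞ (dcoef₂ κ) t ∧ ContDiffAt ℝ ∞ (dcoef₃ κ) t ∧ ContDiffAt ℝ ∞ (dcoef₄ κ) t ∧
      ContDiffAt ℝ ∞ (dcoef₅ κ) t :=
  ⟨(contDiffAt_deriv_of_enorm (fun _ => contDiffAt_coef₂ hs) ht).add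
      ((contDiffAt_coef hs ht).1.div_const _),
    (contDiffAt_deriv_of_enorm (fun _ => contDiffAt_coef₃ hs) ht).sub
      ((contDiffAt_coef hs ht).1.div_const _),
    contDiffAt_deriv_of_enorm (fun _ => contDiffAt_coef₄ hs) ht,
    contDiffAt_deriv_of_enorm (fun _ => contDiffAt_coef₅ hs) ht⟩

lemma _root_.ContDiffAt.hasDerivAt_top {f : ℝ → ℝ} {t : ℝ} (hf : ContDiffAt ℝ ∞ f t) :
    HasDerivAt f (deriv f t) t := (hf.differentiableAt (by simp)).hasDerivAt

lemma val₃_frameVec (hs : κ.SmoothOn (tube a)) (hinv : IsInvariantOn κ (tube a \ singularOrbit))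
    {t : ℝ} (ht : ‖t‖ₑ < a) (c d e : Fin 6 → ℝ) :
    κ.d.val₃ (gammaCurve t) (frameVec t c) (frameVec t d) (frameVec t e)
      = triForm (dcoef₂ κ t) (dcoef₃ κ t) (dcoef₄ κ t) (dcoef₅ κ t) 0 0 (2 * coef₅ κ t)
        (-2 * coef₄ κ t) c d e := by
  have hn : ∀ᶠ t' : ℝ in 𝓝 t, ‖t'‖ₑ < a := (isOpen_enorm_lt a).mem_nhds ht
  refine d_invariant (hs.diffAt (isOpen_tube a) (gammaCurve_mem_tube ht)) ?_ ?_
    (contDiffAt_coef hs ht).1.hasDerivAt_top (contDiffAt_coef₂ hs ht).hasDerivAt_top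
    (contDiffAt_coef₃ hs ht).hasDerivAt_top (contDiffAt_coef₄ hs ht).hasDerivAt_top
    (contDiffAt_coef₅ hs ht).hasDerivAt_top c d e
  · filter_upwards [hn] with t' ht'
    exact invariantAlong_slice hs hinv (by rwa [enorm_imQ])
  · filter_upwards [hn] with t' ht' c d
    exact val_frameVec hs hinv ht' c d

lemma nablaJ_add_left (p : TS3) (u v w : ModelE) :
    nablaJ J cov p (u + v) w = nablaJ J cov p u w + nablaJ J cov p v w := by
  refine (congrArg₂ (· - ·) (map_add _ _ _) ((congrArg _ (map_add _ _ _)).trans (map_add _ _ _))).trans ?_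
  exact add_sub_add_comm _ _ _ _

lemma nablaJ_smul_left (p : TS3) (r : ℝ) (u w : ModelE) :
    nablaJ J cov p (r • u) w = r • nablaJ J cov p u w := by
  refine (congrArg₂ (· - ·) (map_smul _ _ _) ((congrArg _ (map_smul _ _ _)).trans (map_smul _ _ _))).trans ?_
  exact (smul_sub _ _ _).symm

/-- The endomorphism `∇_u J`. -/
def nablaJLin {U : Set TS3} {p : TS3} (h : IsNearlyKahlerWith g J cov U) (hp : p ∈ U) (u : ModelE) :
    ModelE →ₗ[ℝ] ModelE where
  toFun v := nablaJ J cov p u v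
  map_add' v w := by
    rw [nablaJ_skew h hp u (v + w), nablaJ_add_left, neg_add, ← nablaJ_skew h hp u v,
      ← nablaJ_skew h hp u w]
  map_smul' r v := by
    rw [nablaJ_skew h hp u (r • v), nablaJ_smul_left]
    exact (smul_neg r _).symm.trans (congrArg (r • ·) (nablaJ_skew h hp u v).symm)

lemma bilinAt_frame (h : IsNormalNearlyKahler a κ g J cov) {t : ℝ} (ht : ‖t‖ₑ < a) (h0 : t ≠ 0)
    (c : Fin 6 → ℝ) :
    bilinAt g (gammaCurve t) (frameVec t ![1, 0, 0, 0, 0, 0]) (frameVec t c) = c 0 := by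
  have e0 : frameVec t ![1, 0, 0, 0, 0, 0] = frameE t 0 := by
    rw [frameVec, Fin.sum_univ_six]
    simp
  have g0 : bilinAt g (gammaCurve t) (frameE t 0) (frameE t 0) = 1 := h.unit t h0 ht
  have g1 : bilinAt g (gammaCurve t) (frameE t 0) (frameE t 1) = 0 := h.orth t h0 ht _
  have g2 : bilinAt g (gammaCurve t) (frameE t 0) (frameE t 2) = 0 := h.orth t h0 ht _
  have g3 : bilinAt g (gammaCurve t) (frameE t 0) (frameE t 3) = 0 := h.orth t h0 ht _
  have g4 : bilinAt g (gammaCurve t) (frameE t 0) (frameE t 4) = 0 := h.orth t h0 ht _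
  have g5 : bilinAt g (gammaCurve t) (frameE t 0) (frameE t 5) = 0 := h.orth t h0 ht _
  rw [e0, frameVec, Fin.sum_univ_six]
  simp only [map_add, map_smul, g0, g1, g2, g3, g4, g5, smul_eq_mul]
  ring

/-- The metric, the complex structure and the form `κ` in the frame along `γ`. -/
lemma frame_structure (h : IsNormalNearlyKahler a κ g J cov) {t : ℝ} (ht : ‖t‖ₑ < a) (h0 : t ≠ 0) :
    (∀ v w, frameBilin t (bilinAt g (gammaCurve t)) v w
      = frameBilin t (bilinAt g (gammaCurve t)) w v) ∧
    (∀ v, v ≠ 0 → 0 < frameBilin t (bilinAt g (gammaCurve t)) v v) ∧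
    (∀ v, frameEndo h0 (endoAt J (gammaCurve t)) (frameEndo h0 (endoAt J (gammaCurve t)) v) = -v) ∧
    (∀ v w, frameBilin t (bilinAt g (gammaCurve t)) (frameEndo h0 (endoAt J (gammaCurve t)) v) w
      = - frameBilin t (bilinAt g (gammaCurve t)) v (frameEndo h0 (endoAt J (gammaCurve t)) w)) ∧
    (∀ c, frameBilin t (bilinAt g (gammaCurve t)) ![1, 0, 0, 0, 0, 0] c = c 0) ∧
    (∀ c d, invForm (kf κ t) (coef₂ κ t) (coef₃ κ t) (coef₄ κ t) (coef₅ κ t) c d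
      = frameBilin t (bilinAt g (gammaCurve t)) (frameEndo h0 (endoAt J (gammaCurve t)) c) d) := by
  have hp := gammaCurve_mem ht h0
  refine ⟨fun v w => bilinAt_symm h.nk hp _ _, fun v hv => ?_, fun v => ?_, fun v w => ?_,
    bilinAt_frame h ht h0, fun c d => ?_⟩
  · refine h.nk.metric.pos _ hp _ fun e => hv ?_
    exact (frameEquiv h0).map_eq_zero_iff.1 e
  · refine frameVec_injective h0 ?_
    rw [frameVec_frameEndo, frameVec_frameEndo]
    refine (endoAt_sq h.nk hp _).trans ?_
    exact ((frameEquiv h0).map_neg v).symm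
  · rw [frameBilin_apply, frameBilin_apply, frameVec_frameEndo, frameVec_frameEndo]
    exact bilinAt_endoAt h.nk hp _ _
  · rw [← val_frameVec h.smooth h.inv ht, frameBilin_apply, frameVec_frameEndo]
    exact h.kahler _ hp _ _

lemma endoAt_frame (h : IsNormalNearlyKahler a κ g J cov) {t : ℝ} (ht : ‖t‖ₑ < a) (h0 : t ≠ 0) :
    kf κ t ≠ 0 ∧ endoAt J (gammaCurve t) (frameVec t ![1, 0, 0, 0, 0, 0])
      = frameVec t ((kf κ t)⁻¹ • ![0, 1, 0, 0, 0, 0]) := by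
  obtain ⟨-, hp, hJ, -, hu, hκ⟩ := frame_structure h ht h0
  obtain ⟨h1, h2⟩ := J_unit hp hJ hu hκ
  refine ⟨h1, ?_⟩
  rw [← h2, frameVec_frameEndo]
  rfl

lemma radialField_gammaCurve {t : ℝ} (ht : 0 < t) :
    (radialField (gammaCurve t) : ModelE) = frameVec t ![1, 0, 0, 0, 0, 0] := by
  refine ambD_injective (gammaCurve t) (Eq.trans ?_ (ambD_frameVec t _).symm)
  refine Prod.ext ?_ ?_
  · change sphD _ 0 = _
    rw [map_zero]
    ext <;> simp
  · change ‖imQ t 0 0‖⁻¹ • imQ t 0 0 = _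
    rw [norm_imQ, abs_of_pos ht]
    apply imH_ext <;> simp [ht.ne']

/-- The contraction of the differential with the radial field. -/
def sigmaForm (κ : DiffForm modelTS3 TS3 2) : DiffForm modelTS3 TS3 2 := κ.d.interior radialField

/-- The contraction of the differential with the image of the radial field under `J`. -/
def tauForm (κ : DiffForm modelTS3 TS3 2)
    (J : ∀ x : TS3, TangentSpace modelTS3 x →L[ℝ] TangentSpace modelTS3 x) :
    DiffForm modelTS3 TS3 2 := κ.d.interior fun q => J q (radialField q)

lemma sigmaForm_val (p : TS3) (v w : ModelE) :
    (sigmaForm κ).val p v w = κ.d.val₃ p (radialField p) v w := rfl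

lemma tauForm_val (p : TS3) (v w : ModelE) :
    (tauForm κ J).val p v w = κ.d.val₃ p (endoAt J p (radialField p)) v w := rfl

lemma triForm_unit (x₂ x₃ x₄ x₅ w₂ w₃ w₄ w₅ : ℝ) (c d : Fin 6 → ℝ) :
    triForm x₂ x₃ x₄ x₅ w₂ w₃ w₄ w₅ ![1, 0, 0, 0, 0, 0] c d = invForm 0 x₂ x₃ x₄ x₅ c d := by
  simp only [triForm, invForm, coWedge, cons6_0, cons6_1, cons6_2, cons6_3, cons6_4, cons6_5]
  ring

lemma triForm_second (x₂ x₃ x₄ x₅ w₂ w₃ w₄ w₅ r : ℝ) (c d : Fin 6 → ℝ) :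
    triForm x₂ x₃ x₄ x₅ w₂ w₃ w₄ w₅ (r • ![0, 1, 0, 0, 0, 0]) c d
      = r * invForm 0 w₂ w₃ w₄ w₅ c d := by
  simp only [triForm, invForm, coWedge, Pi.smul_apply, smul_eq_mul, cons6_0, cons6_1, cons6_2,
    cons6_3, cons6_4, cons6_5]
  ring

lemma sigmaForm_frame (h : IsNormalNearlyKahler a κ g J cov) {t : ℝ} (ht : ‖t‖ₑ < a) (h0 : 0 < t)
    (c d : Fin 6 → ℝ) : (sigmaForm κ).val (gammaCurve t) (frameVec t c) (frameVec t d)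
      = invForm 0 (dcoef₂ κ t) (dcoef₃ κ t) (dcoef₄ κ t) (dcoef₅ κ t) c d := by
  rw [sigmaForm_val, radialField_gammaCurve h0, val₃_frameVec h.smooth h.inv ht, triForm_unit]

lemma tauForm_frame (h : IsNormalNearlyKahler a κ g J cov) {t : ℝ} (ht : ‖t‖ₑ < a) (h0 : 0 < t)
    (c d : Fin 6 → ℝ) : (tauForm κ J).val (gammaCurve t) (frameVec t c) (frameVec t d)
      = invForm 0 0 0 (2 * coef₅ κ t / kf κ t) (-2 * coef₄ κ t / kf κ t) c d := by
  rw [tauForm_val, radialField_gammaCurve h0, (endoAt_frame h ht h0.ne').2,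
    val₃_frameVec h.smooth h.inv ht, triForm_second]
  simp only [invForm]
  ring

lemma sigmaForm_invariant (h : IsNormalNearlyKahler a κ g J cov) {t : ℝ} (ht : ‖t‖ₑ < a) :
    InvariantAlong (sigmaForm κ) (gammaCurve t) := by
  intro x v w
  rw [sigmaForm_val, sigmaForm_val, ← radialField_act]
  exact d_invariant_slice h.smooth h.inv (by rwa [enorm_imQ]) x _ _ _

lemma tauForm_invariant (h : IsNormalNearlyKahler a κ g J cov) {t : ℝ} (ht : ‖t‖ₑ < a)
    (h0 : t ≠ 0) : InvariantAlong (tauForm κ J) (gammaCurve t) := by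
  intro x v w
  have hw : ‖imQ t 0 0‖ₑ < a := by rwa [enorm_imQ]
  have e := endoAt_act h.smooth h.inv h.nk h.kahler h.strict hw (imQ_ne_zero h0) x
    (radialField (gammaCurve t))
  rw [tauForm_val, tauForm_val, ← radialField_act]
  refine (congrArg (fun u => κ.d.val₃ _ u _ _) e).trans ?_
  exact d_invariant_slice h.smooth h.inv hw x _ _ _

end AlongGeodesic

section Relations

open IsNearlyKahlerWith

variable {a : ℝ≥0∞} {κ : DiffForm modelTS3 TS3 2}
  {cov : (∀ x : TS3, TangentSpace modelTS3 x) →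
    ∀ x : TS3, TangentSpace modelTS3 x →L[ℝ] TangentSpace modelTS3 x}
  {g : ∀ x : TS3, TangentSpace modelTS3 x →L[ℝ] TangentSpace modelTS3 x →L[ℝ] ℝ}
  {J : ∀ x : TS3, TangentSpace modelTS3 x →L[ℝ] TangentSpace modelTS3 x}

lemma radialField_diffAt {p : TS3} (hp : p ∈ tube a \ singularOrbit) : FieldDiffAt radialField p :=
  mdifferentiableAt_radialField hp.2

lemma sigmaForm_diffAt (hs : κ.SmoothOn (tube a)) {p : TS3} (hp : p ∈ tube a \ singularOrbit) :
    (sigmaForm κ).DiffAt p :=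
  ((hs.d (isOpen_tube a)).diffAt (isOpen_tube a) hp.1).interior (radialField_diffAt hp)

lemma tauForm_diffAt (h : IsNormalNearlyKahler a κ g J cov) {p : TS3}
    (hp : p ∈ tube a \ singularOrbit) : (tauForm κ J).DiffAt p :=
  ((h.smooth.d (isOpen_tube a)).diffAt (isOpen_tube a) hp.1).interior
    (mdifferentiableAt_J h.nk hp (radialField_diffAt hp))

lemma val₃_swap12 (η : DiffForm modelTS3 TS3 3) (p : TS3) (x y z : ModelE) :
    η.val₃ p x y z = - η.val₃ p x z y := alt3_swap12 _ _ _ _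

lemma val₃_J12 (h : IsNormalNearlyKahler a κ g J cov) {p : TS3} (hp : p ∈ tube a \ singularOrbit)
    (x y z : ModelE) : κ.d.val₃ p (endoAt J p x) y z = κ.d.val₃ p x (endoAt J p y) z :=
  val₃_endoAt h.nk hp h.kahler (h.smooth.diffAt (isOpen_tube a) hp.1) x y z

lemma val₃_J13 (h : IsNormalNearlyKahler a κ g J cov) {p : TS3} (hp : p ∈ tube a \ singularOrbit)
    (x y z : ModelE) : κ.d.val₃ p (endoAt J p x) y z = κ.d.val₃ p x y (endoAt J p z) := by
  rw [val₃_swap12, val₃_J12 h hp, val₃_swap12, neg_neg]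

lemma hasDerivAt_tau (h : IsNormalNearlyKahler a κ g J cov) {t : ℝ} (ht : ‖t‖ₑ < a) (h0 : 0 < t)
    {f : ℝ → ℝ} (hf : ContDiffAt ℝ ∞ f t) (r : ℝ) :
    ∃ z, HasDerivAt (fun t => r * f t / kf κ t) z t :=
  ⟨_, (((hf.hasDerivAt_top.const_mul r)).div (contDiffAt_coef h.smooth ht).1.hasDerivAt_top
    (endoAt_frame h ht h0.ne').1)⟩

lemma d_sigmaForm (h : IsNormalNearlyKahler a κ g J cov) {t : ℝ} (ht : ‖t‖ₑ < a) (h0 : 0 < t)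
    (c d : Fin 6 → ℝ) : (sigmaForm κ).d.val₃ (gammaCurve t) (frameVec t ![1, 0, 0, 0, 0, 0])
      (frameVec t c) (frameVec t d) = invForm 0 (deriv (dcoef₂ κ) t) (deriv (dcoef₃ κ) t)
        (deriv (dcoef₄ κ) t) (deriv (dcoef₅ κ) t) c d := by
  have hn : ∀ᶠ t' : ℝ in 𝓝 t, ‖t'‖ₑ < a := (isOpen_enorm_lt a).mem_nhds ht
  have hpos : ∀ᶠ t' : ℝ in 𝓝 t, 0 < t' := lt_mem_nhds h0
  obtain ⟨c2, c3, c4, c5⟩ := contDiffAt_dcoef h.smooth ht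
  have := d_invariant (η := sigmaForm κ) (sigmaForm_diffAt h.smooth (gammaCurve_mem ht h0.ne'))
    (by filter_upwards [hn] with t' ht' using sigmaForm_invariant h ht')
    (by filter_upwards [hn, hpos] with t' ht' hp' c d using sigmaForm_frame h ht' hp' c d)
    (hasDerivAt_const t 0) c2.hasDerivAt_top c3.hasDerivAt_top c4.hasDerivAt_top c5.hasDerivAt_top
    ![1, 0, 0, 0, 0, 0] c d
  rw [this, triForm_unit]
  simp

lemma d_tauForm (h : IsNormalNearlyKahler a κ g J cov) {t : ℝ} (ht : ‖t‖ₑ < a) (h0 : 0 < t)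
    (c d : Fin 6 → ℝ) : (tauForm κ J).d.val₃ (gammaCurve t)
      (frameVec t ((kf κ t)⁻¹ • ![0, 1, 0, 0, 0, 0])) (frameVec t c) (frameVec t d)
      = invForm 0 0 0 (-4 * coef₄ κ t / kf κ t ^ 2) (-4 * coef₅ κ t / kf κ t ^ 2) c d := by
  have hn : ∀ᶠ t' : ℝ in 𝓝 t, ‖t'‖ₑ < a := (isOpen_enorm_lt a).mem_nhds ht
  have hpos : ∀ᶠ t' : ℝ in 𝓝 t, 0 < t' := lt_mem_nhds h0
  obtain ⟨z₄, hz₄⟩ := hasDerivAt_tau h ht h0 (contDiffAt_coef₅ h.smooth ht) 2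
  obtain ⟨z₅, hz₅⟩ := hasDerivAt_tau h ht h0 (contDiffAt_coef₄ h.smooth ht) (-2)
  have hf := (endoAt_frame h ht h0.ne').1
  have := d_invariant (η := tauForm κ J) (tauForm_diffAt h (gammaCurve_mem ht h0.ne'))
    (by filter_upwards [hn, hpos] with t' ht' hp' using tauForm_invariant h ht' hp'.ne')
    (by filter_upwards [hn, hpos] with t' ht' hp' c d using tauForm_frame h ht' hp' c d)
    (hasDerivAt_const t 0) (hasDerivAt_const t 0) (hasDerivAt_const t 0) hz₄ hz₅
    ((kf κ t)⁻¹ • ![0, 1, 0, 0, 0, 0]) c d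
  rw [this, triForm_second]
  simp only [invForm]
  field_simp
  ring

lemma frame_relations (h : IsNormalNearlyKahler a κ g J cov) {t : ℝ} (ht : ‖t‖ₑ < a) (h0 : 0 < t) :
    ∃ lam A B : ℝ, 0 < lam ∧
      deriv (dcoef₂ κ) t + 12 * lam * coef₂ κ t = A * dcoef₂ κ t ∧
      deriv (dcoef₃ κ) t + 12 * lam * coef₃ κ t = A * dcoef₃ κ t ∧
      deriv (dcoef₄ κ) t - 4 * coef₄ κ t / kf κ t ^ 2 + 12 * lam * coef₄ κ t
        = A * dcoef₄ κ t + B * (2 * coef₅ κ t / kf κ t) ∧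
      deriv (dcoef₅ κ) t - 4 * coef₅ κ t / kf κ t ^ 2 + 12 * lam * coef₅ κ t
        = A * dcoef₅ κ t + B * (-2 * coef₄ κ t / kf κ t) ∧
      coef₂ κ t * dcoef₃ κ t + coef₃ κ t * dcoef₂ κ t - 2 * coef₄ κ t * dcoef₄ κ t
        - 2 * coef₅ κ t * dcoef₅ κ t = 0 ∧
      dcoef₄ κ t * coef₅ κ t = dcoef₅ κ t * coef₄ κ t ∧
      dcoef₂ κ t * dcoef₃ κ t - dcoef₄ κ t ^ 2 - dcoef₅ κ t ^ 2
        = -4 * (coef₄ κ t ^ 2 + coef₅ κ t ^ 2) / kf κ t ^ 2 ∧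
      -4 * (coef₄ κ t ^ 2 + coef₅ κ t ^ 2) / kf κ t ^ 2
        = 9 * lam * (coef₂ κ t * coef₃ κ t - coef₄ κ t ^ 2 - coef₅ κ t ^ 2) ∧
      coef₂ κ t * coef₃ κ t - coef₄ κ t ^ 2 - coef₅ κ t ^ 2 ≠ 0 := by
  have hp := gammaCurve_mem ht h0.ne'
  have hκ := h.smooth.diffAt (isOpen_tube a) hp.1
  obtain ⟨gs, gp, jj, gJ, hu, hk⟩ := frame_structure h ht h0.ne'
  obtain ⟨hf, hJu⟩ := endoAt_frame h ht h0.ne'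
  set u := frameVec t ![1, 0, 0, 0, 0, 0] with hudef
  set D := frameEndo h0.ne' (nablaJLin h.nk hp u) with hDdef
  set j := frameEndo h0.ne' (endoAt J (gammaCurve t) : ModelE →ₗ[ℝ] ModelE) with hj
  have hDv (c : Fin 6 → ℝ) : frameVec t (D c) = nablaJ J cov (gammaCurve t) u (frameVec t c) :=
    frameVec_frameEndo h0.ne' _ c
  have hjv (c : Fin 6 → ℝ) : frameVec t (j c) = endoAt J (gammaCurve t) (frameVec t c) :=
    frameVec_frameEndo h0.ne' _ c
  have hneg (c : Fin 6 → ℝ) : frameVec t (-c) = - frameVec t c := (frameEquiv h0.ne').map_neg c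
  have hzero : frameVec t 0 = 0 := (frameEquiv h0.ne').map_zero
  have hrad : (radialField (gammaCurve t) : ModelE) = u := radialField_gammaCurve h0
  have hJu' : j ![1, 0, 0, 0, 0, 0] = (kf κ t)⁻¹ • ![0, 1, 0, 0, 0, 0] :=
    frameVec_injective h0.ne' ((hjv _).trans hJu)
  have hτ (c d : Fin 6 → ℝ) : invForm 0 0 0 (2 * coef₅ κ t / kf κ t) (-2 * coef₄ κ t / kf κ t) c d
      = 3 * frameBilin t (bilinAt g (gammaCurve t)) (D c) (j d) := by
    rw [← tauForm_frame h ht h0, tauForm_val, hrad, val₃_J13 h hp, d_apply h.nk hp h.kahler hκ,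
      frameBilin_apply, hDv, hjv]
  have := pointwise_relations (y₂ := deriv (dcoef₂ κ) t) (y₃ := deriv (dcoef₃ κ) t)
    (y₄ := deriv (dcoef₄ κ) t - 4 * coef₄ κ t / kf κ t ^ 2)
    (y₅ := deriv (dcoef₅ κ) t - 4 * coef₅ κ t / kf κ t ^ 2) (x₂ := dcoef₂ κ t) (x₃ := dcoef₃ κ t)
    (x₄ := dcoef₄ κ t) (x₅ := dcoef₅ κ t) (D := D) gs gp jj gJ ?_ ?_ hu ?_ ?_ hk ?_ hτ ?_
  · exact this
  · intro v w
    rw [frameBilin_apply, frameBilin_apply, hDv, hDv]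
    exact metric_nablaJ h.nk hp _ _ _
  · intro v
    refine frameVec_injective h0.ne' ?_
    rw [hDv, hneg]
    exact (congrArg _ (hjv v)).trans ((nablaJ_J h.nk hp _ _).trans
      (congrArg Neg.neg ((congrArg _ (hDv v).symm).trans (hjv _).symm)))
  · refine frameVec_injective h0.ne' ?_
    rw [hDv, hzero]
    have := nablaJ_skew h.nk hp u u
    have h2 : (2 : ℝ) • nablaJ J cov (gammaCurve t) u u = 0 := by
      rw [two_smul]
      exact add_eq_zero_iff_eq_neg.2 this
    exact (smul_eq_zero.1 h2).resolve_left two_ne_zero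
  · obtain ⟨x, y, hxy, -⟩ := exists_val₃_ne_zero h.nk hp h.kahler hκ h.strict
      (v := u) (fun e => by
        have := frameVec_injective h0.ne' (e.trans hzero.symm)
        simpa using congrFun this 0)
    refine ⟨(frameEquiv h0.ne').symm x, fun e => hxy ?_⟩
    have e1 := hDv ((frameEquiv h0.ne').symm x)
    rw [e, hzero, ← frameEquiv_apply h0.ne', LinearEquiv.apply_symm_apply] at e1
    exact e1.symm
  · intro c d
    rw [← sigmaForm_frame h ht h0, sigmaForm_val, hrad, d_apply h.nk hp h.kahler hκ,
      frameBilin_apply, hDv]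
  · intro c d hc0 hc1 hd0 hd1
    have hU : ∀ᶠ q in 𝓝 (gammaCurve t), q ∈ tube a \ singularOrbit :=
      (isOpen_tube_diff a).mem_nhds hp
    have key := d_companion h.nk hp (σ := sigmaForm κ) (τ := tauForm κ J)
      (sigmaForm_diffAt h.smooth hp) (tauForm_diffAt h hp)
      (by filter_upwards [hU] with q hq v w using val₃_J12 h hq _ _ _)
      (by filter_upwards [hU] with q hq v w using val₃_J13 h hq _ _ _)
      u (frameVec t c) (frameVec t d)
    have hj01 {c : Fin 6 → ℝ} (h0c : c 0 = 0) (h1c : c 1 = 0) : j c 0 = 0 ∧ j c 1 = 0 := by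
      have e1 := gJ ![1, 0, 0, 0, 0, 0] c
      rw [← hk, hu] at e1
      have e2 := hk ![1, 0, 0, 0, 0, 0] (j c)
      rw [gJ, jj, map_neg, neg_neg, hu] at e2
      simp only [invForm, coWedge, cons6_0, cons6_1, cons6_2, cons6_3, cons6_4, cons6_5, h0c, h1c]
        at e1 e2
      refine ⟨by linarith, ?_⟩
      have : kf κ t * j c 1 = 0 := by linarith
      exact (mul_eq_zero.1 this).resolve_left hf
    rw [hJu, ← hjv, ← hjv, d_sigmaForm h ht h0, d_sigmaForm h ht h0, d_tauForm h ht h0,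
      d_tauForm h ht h0, ← hDv, ← hDv, tauForm_frame h ht h0, tauForm_frame h ht h0, hτ, hτ] at key
    rw [← key]
    simp only [invForm]
    ring

end Relations

section OrdinaryDifferentialEquation

variable {f₁ f₂ f₃ f₄ f₅ x₂ x₃ x₄ x₅ : ℝ → ℝ}

/-- The differential-algebraic relations satisfied by the coefficients of the Kähler form and of
its differential at one point, with `zᵢ` the derivative of `xᵢ`. -/
def StructureRelations (f₁ f₂ f₃ f₄ f₅ x₂ x₃ x₄ x₅ z₂ z₃ z₄ z₅ lam A B : ℝ) : Prop :=
  0 < lam ∧ z₂ + 12 * lam * f₂ = A * x₂ ∧ z₃ + 12 * lam * f₃ = A * x₃ ∧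
    z₄ - 4 * f₄ / f₁ ^ 2 + 12 * lam * f₄ = A * x₄ + B * (2 * f₅ / f₁) ∧
    z₅ - 4 * f₅ / f₁ ^ 2 + 12 * lam * f₅ = A * x₅ + B * (-2 * f₄ / f₁) ∧
    f₂ * x₃ + f₃ * x₂ - 2 * f₄ * x₄ - 2 * f₅ * x₅ = 0 ∧ x₄ * f₅ = x₅ * f₄ ∧
    x₂ * x₃ - x₄ ^ 2 - x₅ ^ 2 = -4 * (f₄ ^ 2 + f₅ ^ 2) / f₁ ^ 2 ∧
    -4 * (f₄ ^ 2 + f₅ ^ 2) / f₁ ^ 2 = 9 * lam * (f₂ * f₃ - f₄ ^ 2 - f₅ ^ 2) ∧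
    f₂ * f₃ - f₄ ^ 2 - f₅ ^ 2 ≠ 0

lemma structure_ode {b : ℝ} (hb : 0 < b) (h1 : ∀ t ∈ Ioo 0 b, f₁ t ≠ 0)
    (d1 : ∀ t ∈ Ioo 0 b, DifferentiableAt ℝ f₁ t)
    (d2 : ∀ t ∈ Ioo 0 b, HasDerivAt f₂ (x₂ t - f₁ t / 4) t)
    (d3 : ∀ t ∈ Ioo 0 b, HasDerivAt f₃ (x₃ t + f₁ t / 4) t)
    (d4 : ∀ t ∈ Ioo 0 b, HasDerivAt f₄ (x₄ t) t) (d5 : ∀ t ∈ Ioo 0 b, HasDerivAt f₅ (x₅ t) t)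
    (e2 : ∀ t ∈ Ioo 0 b, DifferentiableAt ℝ x₂ t) (e3 : ∀ t ∈ Ioo 0 b, DifferentiableAt ℝ x₃ t)
    (e4 : ∀ t ∈ Ioo 0 b, DifferentiableAt ℝ x₄ t) (e5 : ∀ t ∈ Ioo 0 b, DifferentiableAt ℝ x₅ t)
    (hrel : ∀ t ∈ Ioo 0 b, ∃ lam A B, StructureRelations (f₁ t) (f₂ t) (f₃ t) (f₄ t) (f₅ t) (x₂ t)
      (x₃ t) (x₄ t) (x₅ t) (deriv x₂ t) (deriv x₃ t) (deriv x₄ t) (deriv x₅ t) lam A B) :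
    (∃ lam, 0 < lam ∧ ∀ t ∈ Ioo 0 b, 4 * (f₄ t ^ 2 + f₅ t ^ 2)
      = 9 * lam * f₁ t ^ 2 * (f₄ t ^ 2 + f₅ t ^ 2 - f₂ t * f₃ t)) ∧
    ∃ C, ∀ t ∈ Ioo 0 b, f₄ t ^ 2 = C * (f₄ t ^ 2 + f₅ t ^ 2) := by
  set δ : ℝ → ℝ := fun t => f₄ t ^ 2 + f₅ t ^ 2 - f₂ t * f₃ t with hδ
  set R : ℝ → ℝ := fun t => f₄ t ^ 2 + f₅ t ^ 2 with hR
  set L : ℝ → ℝ := fun t => 4 * R t / (9 * f₁ t ^ 2 * δ t) with hL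
  have hδ0 : ∀ t ∈ Ioo 0 b, δ t ≠ 0 := by
    intro t ht h
    obtain ⟨lam, A, B, -, -, -, -, -, -, -, -, -, hne⟩ := hrel t ht
    refine hne ?_
    simp only [hδ] at h
    linarith
  have hLr : ∀ t ∈ Ioo 0 b, ∃ A B, StructureRelations (f₁ t) (f₂ t) (f₃ t) (f₄ t) (f₅ t) (x₂ t)
      (x₃ t) (x₄ t) (x₅ t) (deriv x₂ t) (deriv x₃ t) (deriv x₄ t) (deriv x₅ t) (L t) A B := by
    intro t ht
    obtain ⟨lam, A, B, h⟩ := hrel t ht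
    have e : L t = lam := by
      have h8 := h.2.2.2.2.2.2.2.2.1
      have hf := h1 t ht
      have hd := hδ0 t ht
      have e : f₂ t * f₃ t - f₄ t ^ 2 - f₅ t ^ 2 = - δ t := by simp only [hδ]; ring
      rw [e] at h8
      simp only [hL]
      rw [div_eq_iff (pow_ne_zero 2 hf)] at h8
      rw [div_eq_iff (by positivity)]
      simp only [hR]
      linarith
    rw [e]
    exact ⟨A, B, h⟩
  have hL0 : ∀ t ∈ Ioo 0 b, 0 < L t := fun t ht => (hLr t ht).choose_spec.choose_spec.1
  have hLe : ∀ t ∈ Ioo 0 b, 4 * R t = 9 * L t * f₁ t ^ 2 * δ t := by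
    intro t ht
    have hf := h1 t ht
    have hd := hδ0 t ht
    simp only [hL]
    field_simp
  have hR0 : ∀ t ∈ Ioo 0 b, R t ≠ 0 := by
    intro t ht h
    have := hLe t ht
    rw [h, mul_zero] at this
    have hf := h1 t ht
    have hd := hδ0 t ht
    have hl := (hL0 t ht).ne'
    exact absurd this.symm (by positivity)
  have dR : ∀ t ∈ Ioo 0 b, HasDerivAt R (2 * f₄ t * x₄ t + 2 * f₅ t * x₅ t) t := by
    intro t ht
    refine (((d4 t ht).pow 2).add ((d5 t ht).pow 2)).congr_deriv ?_
    simp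
  have hA : ∀ t ∈ Ioo 0 b, ∃ A B, StructureRelations (f₁ t) (f₂ t) (f₃ t) (f₄ t) (f₅ t) (x₂ t)
      (x₃ t) (x₄ t) (x₅ t) (deriv x₂ t) (deriv x₃ t) (deriv x₄ t) (deriv x₅ t) (L t) A B ∧
      deriv f₁ t = -A * f₁ t := by
    intro t ht
    obtain ⟨A, B, h⟩ := hLr t ht
    refine ⟨A, B, h, ?_⟩
    obtain ⟨-, r2, r3, r4, r5, p1, p2, p3, -, -⟩ := h
    have hf := h1 t ht
    have hd := (((e2 t ht).hasDerivAt.mul (e3 t ht).hasDerivAt).sub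
      ((e4 t ht).hasDerivAt.pow 2)).sub ((e5 t ht).hasDerivAt.pow 2)
    have hd' := ((dR t ht).const_mul (-4)).div ((d1 t ht).hasDerivAt.pow 2) (pow_ne_zero 2 hf)
    have hev : (fun t => x₂ t * x₃ t - x₄ t ^ 2 - x₅ t ^ 2) =ᶠ[𝓝 t]
        fun t => -4 * R t / f₁ t ^ 2 := by
      filter_upwards [isOpen_Ioo.mem_nhds ht] with s hs
      obtain ⟨_, _, _, _, _, _, _, _, _, _, h3, _, _⟩ := hrel s hs
      exact h3
    have key := HasDerivAt.unique (hd.congr_of_eventuallyEq (f₁ := fun t => -4 * R t / f₁ t ^ 2)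
      hev.symm) hd'
    simp [hR] at key
    have k1 : deriv x₂ t * x₃ t + x₂ t * deriv x₃ t - 2 * x₄ t * deriv x₄ t - 2 * x₅ t * deriv x₅ t
        = 2 * A * (x₂ t * x₃ t - x₄ t ^ 2 - x₅ t ^ 2)
          - 8 * (f₄ t * x₄ t + f₅ t * x₅ t) / f₁ t ^ 2 := by
      linear_combination x₃ t * r2 + x₂ t * r3 - 2 * x₄ t * r4 - 2 * x₅ t * r5 - 12 * L t * p1
        - 4 * B / f₁ t * p2
    rw [k1, p3] at key
    field_simp at key
    refine mul_left_cancel₀ (hR0 t ht) ?_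
    simp only [hR]
    linarith
  have h3 : ∀ t ∈ Ioo 0 b, f₁ t * (x₃ t - x₂ t) = -48 * (L t * δ t) := by
    intro t ht
    obtain ⟨A, B, h⟩ := hLr t ht
    obtain ⟨-, r2, r3, r4, r5, p1, p2, p3, p4, -⟩ := h
    have hf := h1 t ht
    have hd := ((((d2 t ht).mul (e3 t ht).hasDerivAt).add ((d3 t ht).mul (e2 t ht).hasDerivAt)).sub
      (((d4 t ht).const_mul 2).mul (e4 t ht).hasDerivAt)).sub
      (((d5 t ht).const_mul 2).mul (e5 t ht).hasDerivAt)
    have hev : (fun t => f₂ t * x₃ t + f₃ t * x₂ t - 2 * f₄ t * x₄ t - 2 * f₅ t * x₅ t) =ᶠ[𝓝 t]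
        fun _ => 0 := by
      filter_upwards [isOpen_Ioo.mem_nhds ht] with s hs
      obtain ⟨_, _, _, _, _, _, _, _, h3, _⟩ := hrel s hs
      exact h3
    have key := HasDerivAt.unique (hd.congr_of_eventuallyEq (f₁ := fun t => 0)
      hev.symm) (hasDerivAt_const t 0)
    simp only [hδ]
    linear_combination -4 * key + 4 * (2 * p3 + f₂ t * r3 + f₃ t * r2 - 2 * f₄ t * r4
      - 2 * f₅ t * r5) + 4 * A * p1 + 16 * p4
  have dδ : ∀ t ∈ Ioo 0 b, HasDerivAt δ (f₁ t * (f₃ t - f₂ t) / 4) t := by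
    intro t ht
    obtain ⟨A, B, h⟩ := hLr t ht
    have p1 := h.2.2.2.2.2.1
    refine ((dR t ht).sub ((d2 t ht).mul (d3 t ht))).congr_deriv ?_
    linear_combination -p1
  have dL : ∀ t ∈ Ioo 0 b, HasDerivAt L 0 t := by
    intro t ht
    have hdiff : DifferentiableAt ℝ L t :=
      ((dR t ht).differentiableAt.const_mul 4).div (((d1 t ht).pow 2).const_mul 9 |>.mul
        (dδ t ht).differentiableAt) (mul_ne_zero (mul_ne_zero (by norm_num)
          (pow_ne_zero 2 (h1 t ht))) (hδ0 t ht))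
    have hl := hdiff.hasDerivAt
    have hev : (fun t => f₁ t * (x₃ t - x₂ t)) =ᶠ[𝓝 t] fun t => -48 * (L t * δ t) := by
      filter_upwards [isOpen_Ioo.mem_nhds ht] with s hs using h3 s hs
    have key := HasDerivAt.unique (((d1 t ht).hasDerivAt.mul ((e3 t ht).hasDerivAt.sub
      (e2 t ht).hasDerivAt)).congr_of_eventuallyEq hev.symm) ((hl.mul (dδ t ht)).const_mul (-48))
    obtain ⟨A, B, ⟨-, r2, r3, -⟩, hA⟩ := hA t ht
    have hz : deriv L t * δ t = 0 := by
      simp only [Pi.sub_apply] at key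
      rw [hA] at key
      linear_combination (1 / 48) * key - (1 / 48) * f₁ t * (r3 - r2)
    rw [(mul_eq_zero.1 hz).resolve_right (hδ0 t ht)] at hl
    exact hl
  have hm : b / 2 ∈ Ioo 0 b := ⟨by linarith, by linarith⟩
  refine ⟨⟨L (b / 2), hL0 _ hm, fun t ht => ?_⟩, f₄ (b / 2) ^ 2 / R (b / 2), fun t ht => ?_⟩
  · have := isOpen_Ioo.is_const_of_deriv_eq_zero isPreconnected_Ioo
      (fun t ht => (dL t ht).differentiableAt.differentiableWithinAt)
      (fun t ht => (dL t ht).deriv) hm ht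
    rw [this]
    exact hLe t ht
  · have dC : ∀ t ∈ Ioo 0 b, HasDerivAt (fun t => f₄ t ^ 2 / R t) 0 t := by
      intro t ht
      refine (((d4 t ht).pow 2).div (dR t ht) (hR0 t ht)).congr_deriv ?_
      obtain ⟨A, B, h⟩ := hLr t ht
      have p2 := h.2.2.2.2.2.2.1
      rw [div_eq_zero_iff]
      left
      simp only [hR]
      simp
      linear_combination 2 * f₄ t * f₅ t * p2
    have := isOpen_Ioo.is_const_of_deriv_eq_zero isPreconnected_Ioo
      (fun t ht => (dC t ht).differentiableAt.differentiableWithinAt)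
      (fun t ht => (dC t ht).deriv) hm ht
    rw [this]
    exact (div_mul_cancel₀ _ (hR0 t ht)).symm

end OrdinaryDifferentialEquation

section SmoothExtension

variable {a : ℝ≥0∞} {κ : DiffForm modelTS3 TS3 2}
  {cov : (∀ x : TS3, TangentSpace modelTS3 x) →
    ∀ x : TS3, TangentSpace modelTS3 x →L[ℝ] TangentSpace modelTS3 x}
  {g : ∀ x : TS3, TangentSpace modelTS3 x →L[ℝ] TangentSpace modelTS3 x →L[ℝ] ℝ}
  {J : ∀ x : TS3, TangentSpace modelTS3 x →L[ℝ] TangentSpace modelTS3 x}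

lemma enorm_lt_of_mem_Ioo {b t : ℝ} (hb : ‖b‖ₑ < a) (ht : t ∈ Ioo 0 b) : ‖t‖ₑ < a := by
  refine lt_of_le_of_lt ?_ hb
  rw [← ofReal_norm, ← ofReal_norm, Real.norm_of_nonneg ht.1.le,
    Real.norm_of_nonneg (ht.1.trans ht.2).le]
  exact ENNReal.ofReal_le_ofReal ht.2.le

lemma coef_ode (h : IsNormalNearlyKahler a κ g J cov) {b : ℝ} (hb : 0 < b) (hba : ‖b‖ₑ < a) :
    (∃ lam, 0 < lam ∧ ∀ t ∈ Ioo 0 b, 4 * (coef₄ κ t ^ 2 + coef₅ κ t ^ 2)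
      = 9 * lam * kf κ t ^ 2 * (coef₄ κ t ^ 2 + coef₅ κ t ^ 2 - coef₂ κ t * coef₃ κ t)) ∧
    ∃ C, ∀ t ∈ Ioo 0 b, coef₄ κ t ^ 2 = C * (coef₄ κ t ^ 2 + coef₅ κ t ^ 2) := by
  have ha {t : ℝ} (ht : t ∈ Ioo 0 b) := enorm_lt_of_mem_Ioo hba ht
  have hs := h.smooth
  refine structure_ode hb (x₂ := dcoef₂ κ) (x₃ := dcoef₃ κ) (x₄ := dcoef₄ κ) (x₅ := dcoef₅ κ)
    (fun t ht => (endoAt_frame h (ha ht) ht.1.ne').1)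
    (fun t ht => (contDiffAt_coef hs (ha ht)).1.differentiableAt (by simp))
    (fun t ht => (contDiffAt_coef₂ hs (ha ht)).hasDerivAt_top.congr_deriv (by simp [dcoef₂]))
    (fun t ht => (contDiffAt_coef₃ hs (ha ht)).hasDerivAt_top.congr_deriv (by simp [dcoef₃]))
    (fun t ht => (contDiffAt_coef₄ hs (ha ht)).hasDerivAt_top)
    (fun t ht => (contDiffAt_coef₅ hs (ha ht)).hasDerivAt_top)
    (fun t ht => (contDiffAt_dcoef hs (ha ht)).1.differentiableAt (by simp))
    (fun t ht => (contDiffAt_dcoef hs (ha ht)).2.1.differentiableAt (by simp))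
    (fun t ht => (contDiffAt_dcoef hs (ha ht)).2.2.1.differentiableAt (by simp))
    (fun t ht => (contDiffAt_dcoef hs (ha ht)).2.2.2.differentiableAt (by simp))
    (fun t ht => frame_relations h (ha ht) ht.1)

lemma tendsto_div_of_hasDerivAt {f : ℝ → ℝ} {c : ℝ} (hf : HasDerivAt f c 0) (h0 : f 0 = 0) :
    Tendsto (fun t => f t / t) (𝓝[>] 0) (𝓝 c) := by
  have := (hasDerivAt_iff_tendsto_slope.1 hf).mono_left
    (nhdsWithin_mono 0 (s := Ioi (0 : ℝ)) (t := {0}ᶜ) fun t ht => (ne_of_gt ht : t ≠ 0))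
  refine this.congr fun t => ?_
  simp [slope_def_field, h0]

lemma deriv_eq_zero_of_even {f : ℝ → ℝ} {c : ℝ} (hf : HasDerivAt f c 0)
    (he : ∀ᶠ t in 𝓝 (0 : ℝ), f (-t) = f t) : c = 0 := by
  have h1 : HasDerivAt (fun t => f (-t)) (c * -1) 0 := by
    have hf' : HasDerivAt f c (-0) := by rwa [neg_zero]
    exact hf'.comp (0 : ℝ) (hasDerivAt_neg 0)
  have := (h1.congr_of_eventuallyEq (he.mono fun t ht => ht.symm)).unique hf
  linarith

lemma eventually_enorm_lt (ha : 0 < a) : ∀ᶠ t : ℝ in 𝓝 0, ‖t‖ₑ < a :=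
  (isOpen_enorm_lt a).mem_nhds (by simpa using ha)

lemma exists_pos_enorm_lt (ha : 0 < a) : ∃ b : ℝ, 0 < b ∧ ‖b‖ₑ < a := by
  have h := (eventually_enorm_lt ha).filter_mono (nhdsWithin_le_nhds (s := Ioi 0))
  obtain ⟨b, hb, hb0⟩ := (h.and self_mem_nhdsWithin).exists
  exact ⟨b, hb0, hb⟩

section AtZero

variable (ha : 0 < a) (hs : κ.SmoothOn (tube a))
  (hinv : IsInvariantOn κ (tube a \ singularOrbit))
include ha hs hinv

lemma coef_zero : kq κ 0 = 0 ∧ kr κ 0 = 0 ∧ km κ 0 = 0 := by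
  have h0 : ‖(0 : ℝ)‖ₑ < a := by simpa using ha
  have h1 := kq_neg hs hinv h0
  have h2 := kr_neg hs hinv h0
  have h3 := km_neg hs hinv h0
  rw [neg_zero] at h1 h2 h3
  exact ⟨by linarith, by linarith, by linarith⟩

lemma hasDerivAt_coef_zero : HasDerivAt (coef₂ κ) (deriv (kr κ) 0 / 8) 0 ∧
    HasDerivAt (coef₃ κ) ((deriv (kr κ) 0 + 4 * kf κ 0) / 8) 0 ∧ HasDerivAt (coef₄ κ) 0 0 ∧
    HasDerivAt (coef₅ κ) (-(deriv (kr κ) 0 + 2 * kf κ 0) / 8) 0 := by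
  have h0 : ‖(0 : ℝ)‖ₑ < a := by simpa using ha
  obtain ⟨-, dp, dq, dr, dm⟩ := contDiffAt_coef hs h0
  obtain ⟨zq, zr, zm⟩ := coef_zero ha hs hinv
  have zp := kp_zero ha hs hinv
  have hid := hasDerivAt_id (0 : ℝ)
  refine ⟨dr.hasDerivAt_top.div_const 8, ?_, ?_, ?_⟩
  · refine (((dr.hasDerivAt_top.sub ((hid.const_mul 4).mul dp.hasDerivAt_top)).add
      (((hid.pow 2).const_mul 4).mul dm.hasDerivAt_top)).div_const 8).congr_deriv ?_
    simp [zp]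
  · refine ((hid.mul dq.hasDerivAt_top).neg.div_const 4).congr_deriv ?_
    simp [zq]
  · refine ((dr.hasDerivAt_top.neg.add ((hid.const_mul 2).mul dp.hasDerivAt_top)).div_const
      8).congr_deriv ?_
    simp [zp]
    ring

end AtZero

lemma coef_at_zero (ha : 0 < a) (hs : κ.SmoothOn (tube a))
    (hinv : IsInvariantOn κ (tube a \ singularOrbit)) :
    coef₂ κ 0 = 0 ∧ coef₃ κ 0 = 0 ∧ coef₄ κ 0 = 0 ∧ coef₅ κ 0 = 0 := by
  obtain ⟨-, zr, -⟩ := coef_zero ha hs hinv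
  simp [coef₂, coef₃, coef₄, coef₅, zr]

lemma deriv_coef₅_ne_zero (h : IsNormalNearlyKahler a κ g J cov) (ha : 0 < a) (hf : kf κ 0 ≠ 0) :
    deriv (coef₅ κ) 0 ≠ 0 := by
  obtain ⟨b, hb, hba⟩ := exists_pos_enorm_lt ha
  obtain ⟨⟨lam, hlam, hL⟩, -⟩ := coef_ode h hb hba
  obtain ⟨d2, d3, d4, d5⟩ := hasDerivAt_coef_zero ha h.smooth h.inv
  obtain ⟨z2, z3, z4, z5⟩ := coef_at_zero ha h.smooth h.inv
  have l2 := tendsto_div_of_hasDerivAt d2 z2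
  have l3 := tendsto_div_of_hasDerivAt d3 z3
  have l4 := tendsto_div_of_hasDerivAt d4 z4
  have l5 := tendsto_div_of_hasDerivAt d5 z5
  have lf : Tendsto (kf κ) (𝓝[>] 0) (𝓝 (kf κ 0)) :=
    (contDiffAt_coef h.smooth (by simpa using ha)).1.continuousAt.tendsto.mono_left
      nhdsWithin_le_nhds
  have lim1 := ((l4.pow 2).add (l5.pow 2)).const_mul 4
  have lim2 := ((lf.pow 2).const_mul (9 * lam)).mul (((l4.pow 2).add (l5.pow 2)).sub (l2.mul l3))
  have key := tendsto_nhds_unique_of_eventuallyEq lim1 lim2 (by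
    filter_upwards [Ioo_mem_nhdsGT hb] with t ht
    have := hL t ht
    have ht0 := ht.1.ne'
    field_simp
    linarith)
  rw [d5.deriv]
  intro h0
  rw [h0] at key
  have h1 : deriv (kr κ) 0 = -2 * kf κ 0 := by linarith
  rw [h1] at key
  have h2 : 0 < lam * kf κ 0 ^ 2 * kf κ 0 ^ 2 := by positivity
  nlinarith

lemma coef₄_eq_zero_of_pos (h : IsNormalNearlyKahler a κ g J cov) (ha : 0 < a) (hf : kf κ 0 ≠ 0)
    {b : ℝ} (hb : 0 < b) (hba : ‖b‖ₑ < a) {t : ℝ} (ht : t ∈ Ioo 0 b) : coef₄ κ t = 0 := by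
  obtain ⟨-, C, hC⟩ := coef_ode h hb hba
  obtain ⟨-, -, d4, -⟩ := hasDerivAt_coef_zero ha h.smooth h.inv
  obtain ⟨-, -, z4, z5⟩ := coef_at_zero ha h.smooth h.inv
  have d5 := (contDiffAt_coef₅ h.smooth (t := 0) (by simpa using ha)).hasDerivAt_top
  have l4 := tendsto_div_of_hasDerivAt d4 z4
  have l5 := tendsto_div_of_hasDerivAt d5 z5
  have key := tendsto_nhds_unique_of_eventuallyEq (l4.pow 2)
    (((l4.pow 2).add (l5.pow 2)).const_mul C) (by
    filter_upwards [Ioo_mem_nhdsGT hb] with t ht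
    have := hC t ht
    have ht0 := ht.1.ne'
    field_simp
    linarith)
  have he := deriv_coef₅_ne_zero h ha hf
  have hC0 : C = 0 := by
    have : C * deriv (coef₅ κ) 0 ^ 2 = 0 := by linarith
    exact (mul_eq_zero.1 this).resolve_right (pow_ne_zero 2 he)
  have := hC t ht
  rw [hC0, zero_mul] at this
  exact pow_eq_zero_iff (two_ne_zero) |>.1 this

lemma coef₄_eq_zero (h : IsNormalNearlyKahler a κ g J cov) (ha : 0 < a) (hf : kf κ 0 ≠ 0)
    {t : ℝ} (ht : ‖t‖ₑ < a) : coef₄ κ t = 0 := by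
  have hpos {t : ℝ} (ht : ‖t‖ₑ < a) (h0 : 0 < t) : coef₄ κ t = 0 := by
    have h1 : ∀ᶠ s in 𝓝 t, ‖s‖ₑ < a := (isOpen_enorm_lt a).mem_nhds ht
    obtain ⟨b, hb, htb⟩ :=
      ((h1.filter_mono (nhdsWithin_le_nhds (s := Ioi t))).and self_mem_nhdsWithin).exists
    exact coef₄_eq_zero_of_pos h ha hf (h0.trans htb) hb ⟨h0, htb⟩
  rcases lt_trichotomy t 0 with h0 | rfl | h0
  · have h1 : ‖-t‖ₑ < a := by rwa [enorm_neg]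
    have h2 := hpos h1 (by linarith)
    rw [coef₄, kq_neg h.smooth h.inv ht] at h2
    rw [coef₄]
    linarith
  · exact (coef_at_zero ha h.smooth h.inv).2.2.1
  · exact hpos ht h0

end SmoothExtension

section SingularOrbit

variable {a : ℝ≥0∞} {κ : DiffForm modelTS3 TS3 2}
  {cov : (∀ x : TS3, TangentSpace modelTS3 x) →
    ∀ x : TS3, TangentSpace modelTS3 x →L[ℝ] TangentSpace modelTS3 x}
  {g : ∀ x : TS3, TangentSpace modelTS3 x →L[ℝ] TangentSpace modelTS3 x →L[ℝ] ℝ}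
  {J : ∀ x : TS3, TangentSpace modelTS3 x →L[ℝ] TangentSpace modelTS3 x}

lemma tanVec_eq_frameVec {t : ℝ} (ht : t ≠ 0) (v₁ v₂ v₃ u₁ u₂ u₃ : ℝ) :
    tanVec (imQ t 0 0) (vec6 v₁ v₂ v₃ u₁ u₂ u₃) = frameVec t
      ![u₁, v₁, 2 * √2 * (v₂ - u₃ / (2 * t)), 2 * √2 * (v₃ + u₂ / (2 * t)),
        2 * √2 * (- u₃ / (2 * t)), 2 * √2 * (u₂ / (2 * t))] := by
  rw [frameVec_eq_tanVec]
  have hq : (2 * √2)⁻¹ * (2 * √2) = 1 := inv_mul_cancel₀ (by positivity)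
  simp only [cons6_0, cons6_1, cons6_2, cons6_3, cons6_4, cons6_5]
  congr 2
  · linear_combination -v₂ * hq
  · linear_combination -v₃ * hq
  · have : 2 * t * (2 * √2)⁻¹ * (2 * √2 * (u₂ / (2 * t))) = 2 * t * (u₂ / (2 * t)) := by
      linear_combination 2 * t * (u₂ / (2 * t)) * hq
    rw [this]
    field_simp
  · have : 2 * t * (2 * √2)⁻¹ * (2 * √2 * (- u₃ / (2 * t))) = 2 * t * (- u₃ / (2 * t)) := by
      linear_combination 2 * t * (- u₃ / (2 * t)) * hq
    rw [this]
    field_simp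

lemma two_sqrt_two_sq : (2 * √2 : ℝ) ^ 2 = 8 := by
  rw [mul_pow, Real.sq_sqrt (by norm_num)]
  norm_num

section Values

variable (hs : κ.SmoothOn (tube a)) (hinv : IsInvariantOn κ (tube a \ singularOrbit)) {t : ℝ}
  (ht : ‖t‖ₑ < a) (h0 : t ≠ 0)
include hs hinv ht h0

lemma sliceForm_d_aba : sliceForm κ.d t ![vec6 1 0 0 0 0 0, vec6 0 1 0 0 0 0, vec6 0 0 0 0 0 1]
    = -8 * (coef₅ κ t / t) := by
  have h := two_sqrt_two_sq
  rw [sliceForm_three, tanVec_eq_frameVec h0, tanVec_eq_frameVec h0, tanVec_eq_frameVec h0,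
    val₃_frameVec hs hinv ht]
  generalize (2 * √2 : ℝ) = s at h
  simp only [triForm, invForm, coWedge, cons6_0, cons6_1, cons6_2, cons6_3, cons6_4, cons6_5]
  linear_combination (- coef₅ κ t / t) * h

lemma sliceForm_d_aaa : sliceForm κ.d t ![vec6 1 0 0 0 0 0, vec6 0 1 0 0 0 0, vec6 0 0 1 0 0 0]
    = 0 := by
  rw [sliceForm_three, tanVec_eq_frameVec h0, tanVec_eq_frameVec h0, tanVec_eq_frameVec h0,
    val₃_frameVec hs hinv ht]
  simp only [triForm, invForm, coWedge, cons6_0, cons6_1, cons6_2, cons6_3, cons6_4, cons6_5]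
  ring

lemma sliceForm_d_abb (h4 : coef₄ κ t = 0) :
    sliceForm κ.d t ![vec6 1 0 0 0 0 0, vec6 0 0 0 0 1 0, vec6 0 0 0 0 0 1] = 0 := by
  rw [sliceForm_three, tanVec_eq_frameVec h0, tanVec_eq_frameVec h0, tanVec_eq_frameVec h0,
    val₃_frameVec hs hinv ht]
  simp only [triForm, invForm, coWedge, cons6_0, cons6_1, cons6_2, cons6_3, cons6_4, cons6_5, h4]
  ring

lemma sliceForm_d_bbb : dcoef₂ κ t + dcoef₃ κ t + 2 * dcoef₅ κ t = t ^ 2 / 2 *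
    sliceForm κ.d t ![vec6 0 0 0 1 0 0, vec6 0 0 0 0 1 0, vec6 0 0 0 0 0 1] := by
  have h := two_sqrt_two_sq
  rw [sliceForm_three, tanVec_eq_frameVec h0, tanVec_eq_frameVec h0, tanVec_eq_frameVec h0,
    val₃_frameVec hs hinv ht]
  generalize (2 * √2 : ℝ) = s at h
  simp only [triForm, invForm, coWedge, cons6_0, cons6_1, cons6_2, cons6_3, cons6_4, cons6_5]
  field_simp
  rw [h]
  ring

end Values

lemma sliceForm_d_rotCycle (ha : 0 < a) (hs : κ.SmoothOn (tube a))
    (hinv : IsInvariantOn κ (tube a \ singularOrbit))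
    (v₁ v₂ v₃ u₁ u₂ u₃ v₁' v₂' v₃' u₁' u₂' u₃' v₁'' v₂'' v₃'' u₁'' u₂'' u₃'' : ℝ) :
    sliceForm κ.d 0 ![vec6 v₃ v₁ v₂ u₃ u₁ u₂, vec6 v₃' v₁' v₂' u₃' u₁' u₂',
        vec6 v₃'' v₁'' v₂'' u₃'' u₁'' u₂'']
      = sliceForm κ.d 0 ![vec6 v₁ v₂ v₃ u₁ u₂ u₃, vec6 v₁' v₂' v₃' u₁' u₂' u₃',
        vec6 v₁'' v₂'' v₃'' u₁'' u₂'' u₃''] := by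
  have := val₃_tanVec_adj hs hinv rotCycle (w := imQ 0 0 0) (by rw [enorm_imQ]; simpa using ha)
    (vec6 v₁ v₂ v₃ u₁ u₂ u₃) (vec6 v₁' v₂' v₃' u₁' u₂' u₃') (vec6 v₁'' v₂'' v₃'' u₁'' u₂'' u₃'')
  simp only [vec6, adj_rotCycle] at this
  rw [sliceForm_three, sliceForm_three]
  exact this

lemma tendsto_sliceForm_d (ha : 0 < a) (hs : κ.SmoothOn (tube a)) (v : Fin 3 → imH × imH) :
    Tendsto (fun t => sliceForm κ.d t v) (𝓝[>] 0) (𝓝 (sliceForm κ.d 0 v)) :=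
  (contDiffAt_sliceForm (hs.d (isOpen_tube a)) (t := 0)
    (by simpa using ha) v).continuousAt.tendsto.mono_left nhdsWithin_le_nhds

lemma sliceForm_d_zero (h : IsNormalNearlyKahler a κ g J cov) (ha : 0 < a) (hf : kf κ 0 ≠ 0) :
    sliceForm κ.d 0 ![vec6 1 0 0 0 0 0, vec6 0 1 0 0 0 0, vec6 0 0 1 0 0 0] = 0 ∧
    sliceForm κ.d 0 ![vec6 1 0 0 0 0 0, vec6 0 0 0 0 1 0, vec6 0 0 0 0 0 1] = 0 ∧
    sliceForm κ.d 0 ![vec6 1 0 0 0 0 0, vec6 0 1 0 0 0 0, vec6 0 0 0 0 0 1] ≠ 0 ∧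
    kf κ 0 ^ 2 * sliceForm κ.d 0 ![vec6 0 0 0 1 0 0, vec6 0 0 0 0 1 0, vec6 0 0 0 0 0 1]
      = - sliceForm κ.d 0 ![vec6 1 0 0 0 0 0, vec6 0 1 0 0 0 0, vec6 0 0 0 0 0 1] := by
  obtain ⟨b, hb, hba⟩ := exists_pos_enorm_lt ha
  have hs := h.smooth
  have hinv := h.inv
  have hev : ∀ᶠ t in 𝓝[>] (0 : ℝ), t ∈ Ioo 0 b := Ioo_mem_nhdsGT hb
  have z {t : ℝ} (ht : t ∈ Ioo 0 b) := enorm_lt_of_mem_Ioo hba ht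
  have h0 : ‖(0 : ℝ)‖ₑ < a := by simpa using ha
  have A0 := tendsto_nhds_unique_of_eventuallyEq (tendsto_sliceForm_d ha hs _) tendsto_const_nhds
    (hev.mono fun t ht => sliceForm_d_aaa hs hinv (z ht) ht.1.ne')
  have C0 := tendsto_nhds_unique_of_eventuallyEq (tendsto_sliceForm_d ha hs _) tendsto_const_nhds
    (hev.mono fun t ht => sliceForm_d_abb hs hinv (z ht) ht.1.ne' (coef₄_eq_zero h ha hf (z ht)))
  obtain ⟨z2, z3, z4, z5⟩ := coef_at_zero ha hs hinv
  have d5 := (contDiffAt_coef₅ hs h0).hasDerivAt_top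
  have l5 := tendsto_div_of_hasDerivAt d5 z5
  have B0 := tendsto_nhds_unique_of_eventuallyEq (tendsto_sliceForm_d ha hs _) (l5.const_mul (-8))
    (hev.mono fun t ht => sliceForm_d_aba hs hinv (z ht) ht.1.ne')
  have he := deriv_coef₅_ne_zero h ha hf
  refine ⟨A0, C0, by rw [B0]; simpa using he, ?_⟩
  have lD := tendsto_sliceForm_d ha hs ![vec6 0 0 0 1 0 0, vec6 0 0 0 0 1 0, vec6 0 0 0 0 0 1]
  set D := fun t => sliceForm κ.d t ![vec6 0 0 0 1 0 0, vec6 0 0 0 0 1 0, vec6 0 0 0 0 0 1] with hD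
  -- the even function `x₂ + x₅`
  obtain ⟨cf, cp, -, -, -⟩ := contDiffAt_coef hs h0
  have hy : HasDerivAt (fun t => dcoef₂ κ t + dcoef₅ κ t) 0 0 := by
    have hev0 := eventually_enorm_lt ha
    have ef := deriv_eq_zero_of_even cf.hasDerivAt_top
      (hev0.mono fun t ht => kf_neg hs hinv ht)
    have ep := deriv_eq_zero_of_even cp.hasDerivAt_top
      (hev0.mono fun t ht => kp_neg hs hinv ht)
    have cp' := (contDiffAt_deriv_of_enorm (fun t ht => (contDiffAt_coef hs ht).2.1)
      h0).hasDerivAt_top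
    have e : (fun t => dcoef₂ κ t + dcoef₅ κ t) =ᶠ[𝓝 0]
        fun t => (kp κ t + t * deriv (kp κ) t) / 4 + kf κ t / 4 := by
      filter_upwards [hev0] with t ht
      have e1 : HasDerivAt (fun t => coef₂ κ t + coef₅ κ t) (deriv (coef₂ κ) t + deriv (coef₅ κ) t) t :=
        (contDiffAt_coef₂ hs ht).hasDerivAt_top.add (contDiffAt_coef₅ hs ht).hasDerivAt_top
      have e2 : HasDerivAt (fun t => coef₂ κ t + coef₅ κ t) ((kp κ t + t * deriv (kp κ) t) / 4) t := by
        have : (fun t => coef₂ κ t + coef₅ κ t) = fun t => t * kp κ t / 4 := by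
          funext t
          rw [coef₂, coef₅]
          ring
        rw [this]
        refine (((hasDerivAt_id t).mul
          (contDiffAt_coef hs ht).2.1.hasDerivAt_top).div_const 4).congr_deriv ?_
        simp
      have := e1.unique e2
      rw [dcoef₂, dcoef₅]
      linarith
    refine HasDerivAt.congr_of_eventuallyEq ?_ e
    refine (((cp.hasDerivAt_top.add ((hasDerivAt_id (0 : ℝ)).mul cp')).div_const 4).add
      (cf.hasDerivAt_top.div_const 4)).congr_deriv ?_
    simp [ef, ep]
  have hy0 : dcoef₂ κ 0 + dcoef₅ κ 0 = 0 := by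
    obtain ⟨e2, -, -, e5⟩ := hasDerivAt_coef_zero ha hs hinv
    rw [dcoef₂, dcoef₅, e2.deriv, e5.deriv]
    ring
  have ly := tendsto_div_of_hasDerivAt hy hy0
  have lt : Tendsto (fun t : ℝ => t) (𝓝[>] 0) (𝓝 0) := tendsto_id.mono_left nhdsWithin_le_nhds
  have lf : Tendsto (kf κ) (𝓝[>] 0) (𝓝 (kf κ 0)) :=
    cf.continuousAt.tendsto.mono_left nhdsWithin_le_nhds
  have lx : Tendsto (dcoef₅ κ) (𝓝[>] 0) (𝓝 (deriv (coef₅ κ) 0)) :=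
    (contDiffAt_dcoef hs h0).2.2.2.continuousAt.tendsto.mono_left nhdsWithin_le_nhds
  have lim1 := (lf.pow 2).mul ((ly.mul (((lt.mul lD).div_const 2).sub ly)).sub
    ((lx.mul lD).div_const 2))
  have lim2 := (l5.pow 2).const_mul (-4)
  have key := tendsto_nhds_unique_of_eventuallyEq lim1 lim2 (by
    filter_upwards [hev] with t ht
    obtain ⟨_, _, _, _, _, _, _, _, _, _, h3, _, _⟩ := frame_relations h (z ht) ht.1
    have hfe := (endoAt_frame h (z ht) ht.1.ne').1
    have e4 := coef₄_eq_zero h ha hf (z ht)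
    have e4' : dcoef₄ κ t = 0 := by
      rw [dcoef₄]
      have : coef₄ κ =ᶠ[𝓝 t] fun _ => 0 := by
        filter_upwards [isOpen_Ioo.mem_nhds ht] with s hs using coef₄_eq_zero h ha hf (z hs)
      rw [this.deriv_eq]
      simp
    have hb3 := sliceForm_d_bbb hs hinv (z ht) ht.1.ne'
    rw [e4, e4'] at h3
    have e3 : dcoef₃ κ t = t ^ 2 / 2 * D t - dcoef₂ κ t - 2 * dcoef₅ κ t := by
      simp only [hD]
      linarith
    rw [e3] at h3
    have ht0 := ht.1.ne'
    field_simp at h3 ⊢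
    linarith)
  have hq : deriv (coef₅ κ) 0 * (kf κ 0 ^ 2 * D 0) = deriv (coef₅ κ) 0 * (8 * deriv (coef₅ κ) 0) := by
    linarith
  have := mul_left_cancel₀ he hq
  rw [B0]
  linarith

end SingularOrbit

section StableOnSingularOrbit

lemma add_vec6 (v₁ v₂ v₃ u₁ u₂ u₃ v₁' v₂' v₃' u₁' u₂' u₃' : ℝ) :
    vec6 v₁ v₂ v₃ u₁ u₂ u₃ + vec6 v₁' v₂' v₃' u₁' u₂' u₃'
      = vec6 (v₁ + v₁') (v₂ + v₂') (v₃ + v₃') (u₁ + u₁') (u₂ + u₂') (u₃ + u₃') := by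
  refine Prod.ext ?_ ?_ <;> apply imH_ext <;> simp [vec6]

lemma smul_vec6 (r v₁ v₂ v₃ u₁ u₂ u₃ : ℝ) :
    r • vec6 v₁ v₂ v₃ u₁ u₂ u₃ = vec6 (r * v₁) (r * v₂) (r * v₃) (r * u₁) (r * u₂) (r * u₃) := by
  refine Prod.ext ?_ ?_ <;> apply imH_ext <;> simp [vec6]

variable {a : ℝ≥0∞} {κ : DiffForm modelTS3 TS3 2}
  {cov : (∀ x : TS3, TangentSpace modelTS3 x) →
    ∀ x : TS3, TangentSpace modelTS3 x →L[ℝ] TangentSpace modelTS3 x}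
  {g : ∀ x : TS3, TangentSpace modelTS3 x →L[ℝ] TangentSpace modelTS3 x →L[ℝ] ℝ}
  {J : ∀ x : TS3, TangentSpace modelTS3 x →L[ℝ] TangentSpace modelTS3 x}

lemma sliceForm_d_axis (ha : 0 < a) (hs : κ.SmoothOn (tube a))
    (hinv : IsInvariantOn κ (tube a \ singularOrbit)) (v u v' u' x y z x' y' z' : ℝ) :
    sliceForm κ.d 0 ![vec6 v 0 0 u 0 0, vec6 v' 0 0 u' 0 0, vec6 x y z x' y' z'] = 0 := by
  have h0 : ‖(0 : ℝ)‖ₑ < a := by simpa using ha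
  have hI (x y z x' y' z' : ℝ) :
      sliceForm κ.d 0 ![vec6 v 0 0 u 0 0, vec6 v' 0 0 u' 0 0, vec6 x (-y) (-z) x' (-y') (-z')]
        = sliceForm κ.d 0 ![vec6 v 0 0 u 0 0, vec6 v' 0 0 u' 0 0, vec6 x y z x' y' z'] := by
    simpa using sliceForm_d_rotI hs hinv h0 v 0 0 u 0 0 v' 0 0 u' 0 0 x y z x' y' z'
  have hJ : sliceForm κ.d 0
      ![vec6 v 0 0 u 0 0, vec6 v' 0 0 u' 0 0, vec6 (-x) y (-z) (-x') y' (-z')]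
        = sliceForm κ.d 0 ![vec6 v 0 0 u 0 0, vec6 v' 0 0 u' 0 0, vec6 x y z x' y' z'] := by
    have h := sliceForm_d_rotJ hs hinv h0 v 0 0 u 0 0 v' 0 0 u' 0 0 x y z x' y' z'
    have e (v u : ℝ) : vec6 (-v) 0 0 (-u) 0 0 = - vec6 v 0 0 u 0 0 := by
      simpa using neg_vec6 v 0 0 u 0 0
    rw [neg_zero, e, e, alt3_neg, alt3_swap01, alt3_neg, ← alt3_swap01, neg_neg] at h
    exact h
  have h1 := hI x y z x' y' z'
  have h2 := hI (-x) y (-z) (-x') y' (-z')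
  have e : vec6 x y z x' y' z' + vec6 x (-y) (-z) x' (-y') (-z')
      + (vec6 (-x) y (-z) (-x') y' (-z') + vec6 (-x) (-y) (- -z) (-x') (-y') (- -z')) = 0 := by
    rw [add_vec6, add_vec6, add_vec6]
    ring_nf
    rfl
  have hz := alt3_smul_right (sliceForm κ.d 0) 0 0 (vec6 v 0 0 u 0 0) (vec6 v' 0 0 u' 0 0)
  rw [zero_smul, zero_mul, ← e, alt3_add_right, alt3_add_right, alt3_add_right] at hz
  linarith

lemma isStableForm_d_slice (h : IsNormalNearlyKahler a κ g J cov) (ha : 0 < a) (hf : kf κ 0 ≠ 0)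
    {W : Type*} [AddCommGroup W] [Module ℝ W] [TopologicalSpace W]
    (hW : Module.finrank ℝ W = 6) {θ : W [⋀^Fin 3]→L[ℝ] ℝ} (l : imH × imH → W)
    (hl : ∀ x y z, θ ![l x, l y, l z] = sliceForm κ.d 0 ![x, y, z]) : IsStableForm θ := by
  obtain ⟨haaa, habb, haab, hbbb⟩ := sliceForm_d_zero h ha hf
  have hax := sliceForm_d_axis ha h.smooth h.inv
  have cyc := sliceForm_d_rotCycle ha h.smooth h.inv
  have hay (v u v' u' x y z x' y' z' : ℝ) :
      sliceForm κ.d 0 ![vec6 0 v 0 0 u 0, vec6 0 v' 0 0 u' 0, vec6 x y z x' y' z'] = 0 := by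
    rw [cyc v 0 0 u 0 0 v' 0 0 u' 0 0 y z x y' z' x', hax]
  have haz (v u v' u' x y z x' y' z' : ℝ) :
      sliceForm κ.d 0 ![vec6 0 0 v 0 0 u, vec6 0 0 v' 0 0 u', vec6 x y z x' y' z'] = 0 := by
    rw [cyc 0 v 0 0 u 0 0 v' 0 0 u' 0 y z x y' z' x', hay]
  set f := kf κ 0
  have e1 : vec6 0 0 0 f 0 0 = f • vec6 0 0 0 1 0 0 := by simp [smul_vec6]
  have e2 : vec6 0 0 0 0 f 0 = f • vec6 0 0 0 0 1 0 := by simp [smul_vec6]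
  have e3 : vec6 0 0 0 0 0 f = f • vec6 0 0 0 0 0 1 := by simp [smul_vec6]
  have mid (r : ℝ) (x y z : imH × imH) : sliceForm κ.d 0 ![x, r • y, z]
      = r * sliceForm κ.d 0 ![x, y, z] := by
    rw [alt3_rot, alt3_smul, ← alt3_rot]
  set B := sliceForm κ.d 0 ![vec6 1 0 0 0 0 0, vec6 0 1 0 0 0 0, vec6 0 0 0 0 0 1] with hB
  have haba : sliceForm κ.d 0 ![vec6 1 0 0 0 0 0, vec6 0 0 0 0 1 0, vec6 0 0 1 0 0 0] = B := by
    rw [← cyc, ← alt3_rot]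
  have hbaa : sliceForm κ.d 0 ![vec6 0 0 0 1 0 0, vec6 0 1 0 0 0 0, vec6 0 0 1 0 0 0] = B := by
    rw [alt3_rot, cyc]
  have hbab : sliceForm κ.d 0 ![vec6 0 0 0 1 0 0, vec6 0 1 0 0 0 0, vec6 0 0 0 0 0 1] = 0 := by
    rw [alt3_rot, cyc, habb]
  have hbba : sliceForm κ.d 0 ![vec6 0 0 0 1 0 0, vec6 0 0 0 0 1 0, vec6 0 0 1 0 0 0] = 0 := by
    rw [alt3_rot, alt3_rot, cyc, cyc, habb]
  refine isStableForm_of_table hW (c := - (f * B)) ![l (vec6 0 0 0 f 0 0), l (vec6 1 0 0 0 0 0),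
    l (vec6 0 0 0 0 f 0), l (vec6 0 1 0 0 0 0), l (vec6 0 0 0 0 0 f), l (vec6 0 0 1 0 0 0)]
    (neg_ne_zero.2 (mul_ne_zero hf haab)) ?_ ?_ ?_ ?_ ?_ ?_ ?_ ?_ ?_ ?_ ?_
  · refine (hl _ _ _).trans ?_
    rw [e1, e2, e3, alt3_smul, mid, alt3_smul_right]
    linear_combination f * hbbb
  · refine (hl _ _ _).trans ?_
    rw [e1, alt3_smul, hbaa, neg_neg]
  · refine (hl _ _ _).trans ?_
    rw [e2, mid, haba, neg_neg]
  · refine (hl _ _ _).trans ?_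
    rw [e3, alt3_smul_right, neg_neg]
  · intro k
    fin_cases k <;> exact (hl _ _ _).trans (hax _ _ _ _ _ _ _ _ _ _)
  · intro k
    fin_cases k <;> exact (hl _ _ _).trans (hay _ _ _ _ _ _ _ _ _ _)
  · intro k
    fin_cases k <;> exact (hl _ _ _).trans (haz _ _ _ _ _ _ _ _ _ _)
  · refine (hl _ _ _).trans ?_
    rw [e1, e2, alt3_smul, mid, hbba, mul_zero, mul_zero]
  · refine (hl _ _ _).trans ?_
    rw [e1, e3, alt3_smul, alt3_smul_right, hbab, mul_zero, mul_zero]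
  · refine (hl _ _ _).trans ?_
    rw [e2, e3, mid, alt3_smul_right, habb, mul_zero, mul_zero]
  · exact (hl _ _ _).trans haaa

lemma isStableForm_d_singularOrbit (h : IsNormalNearlyKahler a κ g J cov) (ha : 0 < a)
    (hf : kf κ 0 ≠ 0) {p : TS3} (hp : p ∈ singularOrbit) : IsStableForm (κ.d.formAt p) := by
  have hw : ‖imQ 0 0 0‖ₑ < a := by
    rw [enorm_imQ]
    simpa using ha
  have e : imQ 0 0 0 = 0 := rfl
  have hp' : act (p.1, 1) (1, imQ 0 0 0) = p := by
    refine Prod.ext (by simp [act]) ?_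
    rw [show p.2 = 0 from hp, e]
    exact adj_one 0
  rw [← hp']
  refine isStableForm_d_slice h ha hf finrank_modelE
    (fun x => actD (p.1, 1) (1, imQ 0 0 0) (tanVec (imQ 0 0 0) x)) fun x y z => ?_
  rw [sliceForm_three]
  exact d_invariant_slice h.smooth h.inv hw _ _ _ _

end StableOnSingularOrbit
end NearlyKahler

end

theorem proposition6p2 (a : ℝ≥0∞) (ha : 0 < a)
    -- a smooth two-form on `M = tube a`, invariant on `M ∖ S`
    (κ : NearlyKahler.DiffForm NearlyKahler.modelTS3 NearlyKahler.TS3 2)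
    (hsmooth : κ.SmoothOn (NearlyKahler.tube a))
    (hinv : NearlyKahler.IsInvariantOn κ (NearlyKahler.tube a \ NearlyKahler.singularOrbit))
    -- a strict nearly Kähler structure on `M ∖ S` with Kähler form `κ`
    (g : ∀ p : NearlyKahler.TS3, TangentSpace NearlyKahler.modelTS3 p →L[ℝ]
      TangentSpace NearlyKahler.modelTS3 p →L[ℝ] ℝ)
    (J : ∀ p : NearlyKahler.TS3, TangentSpace NearlyKahler.modelTS3 p →L[ℝ]
      TangentSpace NearlyKahler.modelTS3 p)
    (hNK : NearlyKahler.IsStrictNearlyKahlerOn NearlyKahler.modelTS3 g J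
      (NearlyKahler.tube a \ NearlyKahler.singularOrbit))
    (hK : ∀ p ∈ NearlyKahler.tube a \ NearlyKahler.singularOrbit,
      ∀ v w : TangentSpace NearlyKahler.modelTS3 p, κ p ![v, w] = g p (J p v) w)
    -- `γ` has unit speed and is orthogonal to the orbits
    (hunit : ∀ t : ℝ, t ≠ 0 → ‖t‖ₑ < a →
      g (NearlyKahler.gammaCurve t) (NearlyKahler.xiVec t) (NearlyKahler.xiVec t) = 1)
    (horth : ∀ t : ℝ, t ≠ 0 → ‖t‖ₑ < a → ∀ X : NearlyKahler.imH × NearlyKahler.imH,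
      g (NearlyKahler.gammaCurve t) (NearlyKahler.xiVec t)
        (NearlyKahler.hatVec X (NearlyKahler.gammaCurve t)) = 0) :
    -- the (unique) coefficient functions `fᵢ` of `κ`, smoothly extended to `t = 0`
    ∃ f₁ f₂ f₃ f₄ f₅ : ℝ → ℝ,
      (∀ f ∈ [f₁, f₂, f₃, f₄, f₅], ContDiffOn ℝ ∞ f {t : ℝ | ‖t‖ₑ < a}) ∧
      (∀ t : ℝ, t ≠ 0 → ‖t‖ₑ < a → ∀ c d : Fin 6 → ℝ,
        κ (NearlyKahler.gammaCurve t)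
            ![∑ i, c i • NearlyKahler.frame t i, ∑ i, d i • NearlyKahler.frame t i]
          = NearlyKahler.invForm (f₁ t) (f₂ t) (f₃ t) (f₄ t) (f₅ t) c d) ∧
      (f₁ 0 ≠ 0 →
        (∀ t : ℝ, ‖t‖ₑ < a → f₄ t = 0) ∧ deriv f₅ 0 ≠ 0 ∧
        ∀ p ∈ NearlyKahler.tube a, NearlyKahler.IsStableForm (κ.d p)) := by
  open NearlyKahler in
  obtain ⟨cov, hLC, hnk, hstrict⟩ := hNK.nearlyKahler
  have nk : IsNearlyKahlerWith g J cov (tube a \ singularOrbit) :=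
    ⟨isOpen_tube_diff a, hNK.metric, hNK.complex, hNK.hermitian, hLC, hnk⟩
  have h : IsNormalNearlyKahler a κ g J cov :=
    ⟨hsmooth, hinv, nk, hK, hstrict, hunit, horth⟩
  refine ⟨kf κ, coef₂ κ, coef₃ κ, coef₄ κ, coef₅ κ, ?_,
    fun t _ ht c d => val_frameVec hsmooth hinv ht c d, fun hf =>
    ⟨fun t ht => coef₄_eq_zero h ha hf ht, deriv_coef₅_ne_zero h ha hf, fun p hp => ?_⟩⟩
  · simp only [List.mem_cons, List.not_mem_nil, or_false]
    rintro f (rfl | rfl | rfl | rfl | rfl) t ht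
    · exact (contDiffAt_coef hsmooth ht).1.contDiffWithinAt
    · exact (contDiffAt_coef₂ hsmooth ht).contDiffWithinAt
    · exact (contDiffAt_coef₃ hsmooth ht).contDiffWithinAt
    · exact (contDiffAt_coef₄ hsmooth ht).contDiffWithinAt
    · exact (contDiffAt_coef₅ hsmooth ht).contDiffWithinAt
  · by_cases h0 : p ∈ singularOrbit
    · exact isStableForm_d_singularOrbit h ha hf h0
    · have hst : IsStableForm (κ.d.formAt p) := isStableForm_d finrank_modelE nk ⟨hp, h0⟩ hK
        (hsmooth.diffAt (isOpen_tube a) hp) hstrict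
      exact hst
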